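/- Let $N\ge 1$ and $0<r_N^-<r_N^+<r_{N-1}^-<\dots<r_1^-<r_1^+$. Put $D_i=\{x\in\mathbb R^3: r_i^-<|x|<r_i^+\}$, $D=\bigcup_{i=1}^N D_i$, $\Gamma_i^\pm=\{|x|=r_i^\pm\}$, and let $v,v_{\mathrm r}>0$ be the wave speeds outside and inside $D$. For $k\in\mathbb C$ the Dirichlet-to-Neumann map $\mathcal T^k:\mathbb C^{2N}\to\mathbb C^{2N}$ sends $f=(f_i^\pm)$ to the radial derivatives $\bigl(\partial_r w|_{\Gamma_i^\pm}\bigr)$, taken from outside $D$, of the radially symmetric solution $w$ of $\Delta w+k^2w=0$ in $\mathbb R^3\setminus \overline D$, $w=f_i^\pm$ on $\Gamma_i^\pm$, which is outgoing, i.e. a multiple of $e^{\mathrm i k|x|}/|x|$ for $|x|\ge r_1^+$. (It is well defined for $k$ near $0$.) For $u\in H^1(D)$, $\mathcal T^k[u]$ denotes $\mathcal T^k$ applied to the vector of the mean values of the trace of $u$ over the spheres $\Gamma_i^\pm$ (the boundary values themselves if $u$ is radially symmetric). For $\omega\in\mathbb C$, $\delta\in\mathbb R$, $k=\omega/v$ and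 $u,\varphi\in H^1(D)$ let $$a(u,\varphi)=\sum_{i=1}^N\int_{D_i}\Bigl(\nabla u\cdot\nabla\overline \varphi-\frac{\omega^2}{v_{\mathrm r}^2}u\overline \varphi\Bigr)dx-\delta\sum_{i=1}^N\Bigl(\int_{\Gamma_i^+}\overline \varphi\,\mathcal T^k[u]_i^+\,d\sigma-\int_{\Gamma_i^-}\overline \varphi\,\mathcal T^k[u]_i^-\,d\sigma\Bigr),$$ $$a_{\omega,\delta}(u,\varphi)=a(u,\varphi)+\sum_{i=1}^N\int_{D_i}u\,dx\int_{D_i}\overline \varphi\,dx .$$ Let $V$ be $H^1(D)$ or its subspace of radially symmetric functions. Then there is $\varepsilon>0$ such that for all $\omega\in\mathbb C$, $\delta\in\mathbb R$ with $|\omega|<\varepsilon$, $|\delta|<\varepsilon$ the following holds. For every bounded antilinear functional $f$ on $V$ there is a unique $u_f\in V$ with $a_{\omega,\delta}(u_f,\varphi)=\langle f,\varphi\rangle$ for all $\varphi\in V$, and for every $j$ there is a unique $u_j\in V$ with $a_{\omega,\delta}(u_j,\varphi)=\int_{D_j}\overline \varphi\,dx$ for all $\varphi\in V$. Let $U_{ij}=\int_{D_i}u_j\,dx$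 and $F_i=\int_{D_i}u_f\,dx$. Then the variational problem $$\text{find }u\in V:\quad a(u,\varphi)=\langle f,\varphi\rangle\quad\text{for all }\varphi\in V$$ has a unique solution if and only if the $N\times N$ linear system $(I-U)x=F$ has a unique solution $x\in\mathbb C^N$. Moreover, $u\in V$ solves the variational problem if and only if $u=u_f+\sum_{j=1}^N x_ju_j$ for some solution $x$ of $(I-U)x=F$. -/

import Mathlib

open MeasureTheory Filter Topology
open scoped ComplexConjugate

noncomputable section

/-- Physical space `ℝ³` with its Euclidean norm. -/
abbrev Space3 : Type := EuclideanSpace ℝ (Fin 3)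

/-- The `l`-th standard unit vector of `ℝ³`. -/
def unitVec (l : Fin 3) : Space3 := EuclideanSpace.single l 1

/-- The radii of `N` nested concentric spherical shells. The index `0` is the outermost shell, so
`0 < r_N⁻ < r_N⁺ < r_{N-1}⁻ < ⋯ < r_1⁻ < r_1⁺` in the usual numbering. -/
structure NestedShells (N : ℕ) where
  rIn : Fin N → ℝ
  rOut : Fin N → ℝ
  rIn_pos : ∀ i, 0 < rIn i
  rIn_lt_rOut : ∀ i, rIn i < rOut i
  nested : ∀ i j, i < j → rOut j < rIn i

/-- The two boundary spheres of a shell: `outer` is `Γ⁺`, `inner` is `Γ⁻`. -/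
inductive Side
  | outer
  | inner

namespace NestedShells

variable {N : ℕ}

/-- The radius of the boundary sphere `Γ_i^±`. -/
def radius (S : NestedShells N) (i : Fin N) : Side → ℝ
  | Side.outer => S.rOut i
  | Side.inner => S.rIn i

/-- The resonator `D_i`. -/
def shell (S : NestedShells N) (i : Fin N) : Set Space3 :=
  {x | S.rIn i < ‖x‖ ∧ ‖x‖ < S.rOut i}

/-- The union `D` of the resonators. -/
def domain (S : NestedShells N) : Set Space3 := ⋃ i, S.shell i

/-! ### The Sobolev space `H¹(D)` -/

/-- Pairs of an `L²(D; ℂ)` function and an `L²(D; ℂ³)` field, with the Hilbert norm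
`‖(u, g)‖² = ‖u‖² + ‖g‖²`. -/
abbrev Pairs (S : NestedShells N) : Type :=
  WithLp 2 (Lp ℂ 2 (volume.restrict S.domain) ×
    Lp (EuclideanSpace ℂ (Fin 3)) 2 (volume.restrict S.domain))

/-- `g` is the weak gradient of `u` on `D`, tested against all `φ ∈ C_c^∞(D)`. -/
def IsWeakGradient (S : NestedShells N) (p : S.Pairs) : Prop :=
  ∀ φ : Space3 → ℝ, ContDiff ℝ ((⊤ : ℕ∞) : WithTop ℕ∞) φ → HasCompactSupport φ → tsupport φ ⊆ S.domain →
    ∀ l : Fin 3,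
      ∫ x in S.domain, (fderiv ℝ φ x (unitVec l)) • p.fst x =
        -∫ x in S.domain, φ x • (p.snd x) l

theorem integrable_test_smul {μ : Measure Space3} [IsFiniteMeasureOnCompacts μ]
    {ψ : Space3 → ℝ} (hψ : Continuous ψ) (hc : HasCompactSupport ψ) {u : Space3 → ℂ}
    (hu : MemLp u 2 μ) : Integrable (fun x => ψ x • u x) μ :=
  memLp_one_iff_integrable.mp
    (hu.smul (hψ.memLp_of_hasCompactSupport hc : MemLp ψ 2 μ) : MemLp (ψ • u) 1 μ)

theorem continuous_partial {φ : Space3 → ℝ} (hφ : ContDiff ℝ ((⊤ : ℕ∞) : WithTop ℕ∞) φ) (l : Fin 3) :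
    Continuous fun x => fderiv ℝ φ x (unitVec l) :=
  (hφ.continuous_fderiv (by simp)).clm_apply continuous_const

theorem hasCompactSupport_partial {φ : Space3 → ℝ} (hc : HasCompactSupport φ) (l : Fin 3) :
    HasCompactSupport fun x => fderiv ℝ φ x (unitVec l) :=
  hc.fderiv_apply (𝕜 := ℝ) (unitVec l)

theorem memLp_coord {μ : Measure Space3} {g : Space3 → EuclideanSpace ℂ (Fin 3)}
    (hg : MemLp g 2 μ) (l : Fin 3) : MemLp (fun x => g x l) 2 μ :=
  (EuclideanSpace.proj (𝕜 := ℂ) l).comp_memLp' hg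

/-- The Sobolev space `H¹(D)`, as the space of pairs `(u, ∇u)` with `u ∈ L²(D)` and weak gradient
`∇u ∈ L²(D)`; its norm is the `H¹` norm. -/
def H1 (S : NestedShells N) : Submodule ℂ S.Pairs where
  carrier := {p | S.IsWeakGradient p}
  zero_mem' := by
    intro φ _ _ _ l
    have h1 : (fun x => (fderiv ℝ φ x (unitVec l)) • (0 : S.Pairs).fst x)
        =ᵐ[volume.restrict S.domain] fun _ => 0 := by
      filter_upwards [Lp.coeFn_zero ℂ 2 (volume.restrict S.domain)] with x hx
      simp only [WithLp.zero_fst]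
      rw [hx]; simp
    have h2 : (fun x => φ x • ((0 : S.Pairs).snd x) l)
        =ᵐ[volume.restrict S.domain] fun _ => 0 := by
      filter_upwards [Lp.coeFn_zero (EuclideanSpace ℂ (Fin 3)) 2 (volume.restrict S.domain)]
        with x hx
      simp only [WithLp.zero_snd]
      rw [hx]; simp
    rw [integral_congr_ae h1, integral_congr_ae h2]
    simp
  add_mem' := by
    intro p q hp hq φ hφ hc hs l
    have h1 : (fun x => (fderiv ℝ φ x (unitVec l)) • (p + q).fst x)
        =ᵐ[volume.restrict S.domain] fun x =>
          (fderiv ℝ φ x (unitVec l)) • p.fst x + (fderiv ℝ φ x (unitVec l)) • q.fst x := by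
      filter_upwards [Lp.coeFn_add p.fst q.fst] with x hx
      simp only [WithLp.add_fst]
      rw [hx, Pi.add_apply, smul_add]
    have h2 : (fun x => φ x • ((p + q).snd x) l)
        =ᵐ[volume.restrict S.domain] fun x =>
          φ x • (p.snd x) l + φ x • (q.snd x) l := by
      filter_upwards [Lp.coeFn_add p.snd q.snd] with x hx
      simp only [WithLp.add_snd]
      rw [hx, Pi.add_apply, PiLp.add_apply, smul_add]
    have hc' := hasCompactSupport_partial hc l
    have hφ' := continuous_partial hφ l
    rw [integral_congr_ae h1, integral_congr_ae h2,
      integral_add (integrable_test_smul hφ' hc' (Lp.memLp p.fst))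
        (integrable_test_smul hφ' hc' (Lp.memLp q.fst)),
      integral_add (integrable_test_smul hφ.continuous hc (memLp_coord (Lp.memLp p.snd) l))
        (integrable_test_smul hφ.continuous hc (memLp_coord (Lp.memLp q.snd) l)),
      hp φ hφ hc hs l, hq φ hφ hc hs l, neg_add]
  smul_mem' := by
    intro c p hp φ hφ hc hs l
    have h1 : (fun x => (fderiv ℝ φ x (unitVec l)) • (c • p).fst x)
        =ᵐ[volume.restrict S.domain] fun x =>
          c • ((fderiv ℝ φ x (unitVec l)) • p.fst x) := by
      filter_upwards [Lp.coeFn_smul c p.fst] with x hx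
      simp only [WithLp.smul_fst]
      rw [hx, Pi.smul_apply, smul_comm]
    have h2 : (fun x => φ x • ((c • p).snd x) l)
        =ᵐ[volume.restrict S.domain] fun x => c • (φ x • (p.snd x) l) := by
      filter_upwards [Lp.coeFn_smul c p.snd] with x hx
      simp only [WithLp.smul_snd]
      rw [hx, Pi.smul_apply, PiLp.smul_apply, smul_comm]
    rw [integral_congr_ae h1, integral_congr_ae h2, integral_smul, integral_smul,
      hp φ hφ hc hs l, smul_neg]

/-- The radially symmetric functions in `H¹(D)`: those with `u(x) = g(|x|)` for almost every
`x ∈ D`, for some profile `g`. -/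
def H1rad (S : NestedShells N) : Submodule ℂ S.Pairs where
  carrier := {p | p ∈ S.H1 ∧
    ∃ g : ℝ → ℂ, ∀ᵐ x ∂(volume.restrict S.domain), p.fst x = g ‖x‖}
  zero_mem' := by
    refine ⟨S.H1.zero_mem, 0, ?_⟩
    filter_upwards [Lp.coeFn_zero ℂ 2 (volume.restrict S.domain)] with x hx
    simp only [WithLp.zero_fst]
    rw [hx]; simp
  add_mem' := by
    rintro p q ⟨hp, g, hg⟩ ⟨hq, h, hh⟩
    refine ⟨S.H1.add_mem hp hq, g + h, ?_⟩
    filter_upwards [Lp.coeFn_add p.fst q.fst, hg, hh] with x hx h1 h2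
    simp only [WithLp.add_fst]
    rw [hx, Pi.add_apply, h1, h2, Pi.add_apply]
  smul_mem' := by
    rintro c p ⟨hp, g, hg⟩
    refine ⟨S.H1.smul_mem c hp, c • g, ?_⟩
    filter_upwards [Lp.coeFn_smul c p.fst, hg] with x hx h1
    simp only [WithLp.smul_fst]
    rw [hx, Pi.smul_apply, h1, Pi.smul_apply]

/-! ### Traces on the boundary spheres -/

/-- The one-sided collar of thickness `ε` of `Γ_i^±`, on the side of `D_i`. -/
def collar (S : NestedShells N) (i : Fin N) (ε : ℝ) : Side → Set Space3
  | Side.outer => {x | S.rOut i - ε < ‖x‖ ∧ ‖x‖ < S.rOut i}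
  | Side.inner => {x | S.rIn i < ‖x‖ ∧ ‖x‖ < S.rIn i + ε}

/-- The surface integral `∫_{Γ_i^±} u dσ` of the trace of `u` from inside `D_i`: the limit of the
volume integrals over collars of `Γ_i^±` inside `D_i`, divided by their thickness. -/
def surfaceIntegral (S : NestedShells N) (i : Fin N) (s : Side) (u : Space3 → ℂ) : ℂ :=
  limUnder (𝓝[>] (0 : ℝ)) fun ε => (ε : ℂ)⁻¹ * ∫ x in S.collar i ε s, u x

/-- The vector `(u|_{Γ_i^±}) ∈ ℂ^{2N}` of boundary values of `u`: the mean of the trace of `u` over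
each sphere. It is the trace itself where the trace is constant on the sphere, in particular for
radially symmetric `u`. -/
def boundaryValue (S : NestedShells N) (u : Space3 → ℂ) (i : Fin N) (s : Side) : ℂ :=
  S.surfaceIntegral i s u / (4 * Real.pi * S.radius i s ^ 2 : ℝ)

/-! ### The Dirichlet-to-Neumann map -/

/-- The host medium `ℝ³ \ D`, without the interfaces. -/
def host (S : NestedShells N) : Set Space3 :=
  {x | ∀ i, ‖x‖ < S.rIn i ∨ S.rOut i < ‖x‖}

/-- The host medium together with the interfaces. -/
def closedHost (S : NestedShells N) : Set Space3 :=
  {x | ∀ i, ‖x‖ ≤ S.rIn i ∨ S.rOut i ≤ ‖x‖}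

/-- `w` is the radially symmetric solution of the exterior Dirichlet problem
`Δ w + k² w = 0` in `ℝ³ \ D`, `w = f_i^±` on `Γ_i^±`, with `w` outgoing. For complex `k` (possibly
with negative imaginary part, or zero) the outgoing condition on radial waves says that `w` is a
multiple of `e^{ik|x|}/|x|`, that is, of `h_0^{(1)}(k|x|)` if `k ≠ 0`, in the unbounded
component. -/
structure IsExteriorSolution (S : NestedShells N) (k : ℂ) (f : Fin N → Side → ℂ)
    (w : Space3 → ℂ) : Prop where
  radial : ∀ x ∈ S.closedHost, ∀ y ∈ S.closedHost, ‖x‖ = ‖y‖ → w x = w y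
  contDiffOn : ContDiffOn ℝ 2 w S.host
  helmholtz : ∀ x ∈ S.host, Laplacian.laplacian w x + k ^ 2 * w x = 0
  continuousOn : ContinuousOn w S.closedHost
  dirichlet : ∀ i s x, ‖x‖ = S.radius i s → w x = f i s
  outgoing : ∃ c : ℂ, ∀ x : Space3, (∀ i, S.rOut i ≤ ‖x‖) →
    w x = c * (Complex.exp (Complex.I * k * ‖x‖) / ‖x‖)

/-- The one-sided derivative of `w` on `Γ_i^±` in the direction `x/|x|`, taken from the side of the
host medium. -/
def normalDeriv (S : NestedShells N) (w : Space3 → ℂ) (i : Fin N) : Side → ℂ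
  | Side.outer =>
      derivWithin (fun r : ℝ => w (r • unitVec 0)) (Set.Ici (S.rOut i)) (S.rOut i)
  | Side.inner =>
      derivWithin (fun r : ℝ => w (r • unitVec 0)) (Set.Iic (S.rIn i)) (S.rIn i)

open Classical in
/-- The Dirichlet-to-Neumann map `𝒯^k : ℂ^{2N} → ℂ^{2N}`, `f ↦ ∂w/∂ν` with `w` the solution of the
exterior problem with data `f` (and `0` if `k` is exceptional and there is no solution). -/
def dtn (S : NestedShells N) (k : ℂ) (f : Fin N → Side → ℂ) : Fin N → Side → ℂ :=
  if h : ∃ w, S.IsExteriorSolution k f w then S.normalDeriv h.choose else 0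

/-! ### The sesquilinear forms -/

/-- The form `a(u, v)`, with wave speeds `vel` in the host and `velR` in the resonators, frequency
`ω`, contrast `δ`, and `k = ω / vel`. -/
def form (S : NestedShells N) (vel velR : ℝ) (ω : ℂ) (δ : ℝ) (u v : S.Pairs) : ℂ :=
  (∑ i, ∫ x in S.shell i,
      ((∑ l, (u.snd x) l * conj ((v.snd x) l)) - ω ^ 2 / velR ^ 2 * u.fst x * conj (v.fst x)))
    - δ * ∑ i,
      (S.dtn (ω / vel) (S.boundaryValue u.fst) i Side.outer *
          S.surfaceIntegral i Side.outer (fun x => conj (v.fst x))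
        - S.dtn (ω / vel) (S.boundaryValue u.fst) i Side.inner *
          S.surfaceIntegral i Side.inner (fun x => conj (v.fst x)))

/-- The form `a_{ω,δ}(u, v) = a(u, v) + ∑ᵢ ∫_{D_i} u ∫_{D_i} v̄`. -/
def modifiedForm (S : NestedShells N) (vel velR : ℝ) (ω : ℂ) (δ : ℝ) (u v : S.Pairs) : ℂ :=
  S.form vel velR ω δ u v +
    ∑ i, (∫ x in S.shell i, u.fst x) * ∫ x in S.shell i, conj (v.fst x)

/-- `u ∈ V` solves `a(u, v) = ⟨f, v⟩` for all `v ∈ V`. -/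
def SolvesVariational (S : NestedShells N) (vel velR : ℝ) (ω : ℂ) (δ : ℝ)
    {V : Submodule ℂ S.Pairs} (f : V →L⋆[ℂ] ℂ) (u : V) : Prop :=
  ∀ v : V, S.form vel velR ω δ u v = f v

/-- `u ∈ V` solves `a_{ω,δ}(u, v) = ⟨f, v⟩` for all `v ∈ V`. -/
def SolvesModified (S : NestedShells N) (vel velR : ℝ) (ω : ℂ) (δ : ℝ)
    {V : Submodule ℂ S.Pairs} (f : V →L⋆[ℂ] ℂ) (u : V) : Prop :=
  ∀ v : V, S.modifiedForm vel velR ω δ u v = f v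

/-- `u ∈ V` solves `a_{ω,δ}(u, v) = ∫_{D_j} v̄` for all `v ∈ V`. -/
def SolvesUnitSource (S : NestedShells N) (vel velR : ℝ) (ω : ℂ) (δ : ℝ)
    {V : Submodule ℂ S.Pairs} (j : Fin N) (u : V) : Prop :=
  ∀ v : V, S.modifiedForm vel velR ω δ u v = ∫ x in S.shell j, conj ((v : S.Pairs).fst x)

/-- The matrix `U_{ij} = ∫_{D_i} u_j`. -/
def massMatrix (S : NestedShells N) {V : Submodule ℂ S.Pairs} (u : Fin N → V) :
    Matrix (Fin N) (Fin N) ℂ :=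
  Matrix.of fun i j => ∫ x in S.shell i, (u j : S.Pairs).fst x

/-- The vector `F_i = ∫_{D_i} u_f`. -/
def massVector (S : NestedShells N) {V : Submodule ℂ S.Pairs} (uf : V) : Fin N → ℂ :=
  fun i => ∫ x in S.shell i, (uf : S.Pairs).fst x

end NestedShells

end

noncomputable section

namespace NestedShells

variable {N : ℕ}

/-! ### The shells and their collars as measurable sets -/

/-! The form `a_{ω,δ}` is represented on the Hilbert space `V` by a bounded operator `A (ω, δ)`. At
`(0, 0)` it is `∫ ∇u·∇v̄ + ∑ ∫_{D_i} u ∫_{D_i} v̄`, which is coercive by a Poincaré inequality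
(`exists_poincare`), hence `A 0` is invertible. `A` is norm-continuous at `0` and the units are
open, so `A (ω, δ)` is bijective for small parameters (`exists_modifiedForm_operator`,
`eventually_bijective`). This gives `u_f` and the `u_j`.

The form `a` differs from `a_{ω,δ}` by a form of finite rank, so the variational problem reads `A w
= y + ∑ m_i(w) e_i` with `m_i(w) = ∫_{D_i} w`, where `y` represents `f` and `A u_j = e_j`. Applying
the inverse of `A` gives `w = u_f + ∑ m_j(w) u_j`, and applying `m_i` to this gives `(I - U) x = F`
for `x = m(w)`. Conversely, a solution `x` gives back a solution `w` with `m(w) = x`, so solutions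
correspond one to one (`reduction_to_linear_system`).

Three analytic facts support the argument.

The Dirichlet-to-Neumann map: for a radial Helmholtz solution `w`, the function `r w` solves `u'' +
k² u = 0` in each component of the host. Everything is then explicit in terms of `sin (k L) / k`,
which is entire in `k` and equals `L ≠ 0` at `k = 0`. So near `k = 0` the problem is solvable and
the map is linear with coefficients continuous at `0` (`exists_dtn_coefficients`).

The traces: testing the weak gradient against `φ(|x|) x / |x|³` shows that the spherical means of an
`H¹` function are absolutely continuous in the radius. Hence the collar averages converge, and the
limit is a bounded functional by Banach-Steinhaus (`exists_trace`).

The Poincaré inequality: split `u` into its average over rotations and the rest. The average is a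
function of one variable, controlled by its derivative and its mean. The rest is controlled in `L²`
by duality: moving a test function along a one-parameter group of rotations is a flow along a
bounded divergence-free field tangent to the spheres, so one integration by parts brings in `∇u` and
never a derivative of the test function. No compact embedding is needed. -/

theorem isOpen_shell (S : NestedShells N) (i : Fin N) : IsOpen (S.shell i) :=
  (isOpen_lt continuous_const continuous_norm).inter (isOpen_lt continuous_norm continuous_const)

theorem isOpen_domain (S : NestedShells N) : IsOpen S.domain :=
  isOpen_iUnion S.isOpen_shell

theorem measurableSet_shell (S : NestedShells N) (i : Fin N) : MeasurableSet (S.shell i) :=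
  (S.isOpen_shell i).measurableSet

theorem measurableSet_domain (S : NestedShells N) : MeasurableSet S.domain :=
  S.isOpen_domain.measurableSet

theorem shell_subset_domain (S : NestedShells N) (i : Fin N) : S.shell i ⊆ S.domain :=
  Set.subset_iUnion _ i

theorem pairwise_disjoint_shell (S : NestedShells N) :
    Pairwise (Function.onFun Disjoint S.shell) := by
  intro i j hij
  rw [Function.onFun, Set.disjoint_left]
  rintro x ⟨h1, h2⟩ ⟨h3, h4⟩
  rcases lt_or_gt_of_ne hij with h | h
  · linarith [S.nested i j h]
  · linarith [S.nested j i h]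

theorem isOpen_collar (S : NestedShells N) (i : Fin N) (ε : ℝ) (s : Side) :
    IsOpen (S.collar i ε s) := by
  cases s
  · exact (isOpen_lt continuous_const continuous_norm).inter
      (isOpen_lt continuous_norm continuous_const)
  · exact (isOpen_lt continuous_const continuous_norm).inter
      (isOpen_lt continuous_norm continuous_const)

theorem collar_subset_shell (S : NestedShells N) (i : Fin N) (s : Side) {ε : ℝ}
    (hε : ε < S.rOut i - S.rIn i) : S.collar i ε s ⊆ S.shell i := by
  cases s
  · rintro x ⟨h1, h2⟩
    exact ⟨by linarith, h2⟩
  · rintro x ⟨h1, h2⟩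
    exact ⟨h1, by linarith⟩

theorem exists_radius_bound (S : NestedShells N) : ∃ b : ℝ, 0 < b ∧ ∀ x ∈ S.domain, ‖x‖ ≤ b := by
  refine ⟨1 + ∑ i, S.rOut i, ?_, ?_⟩
  · have : 0 ≤ ∑ i, S.rOut i :=
      Finset.sum_nonneg fun i _ => ((S.rIn_pos i).trans (S.rIn_lt_rOut i)).le
    linarith
  · intro x hx
    obtain ⟨i, hi⟩ := Set.mem_iUnion.mp hx
    have : S.rOut i ≤ ∑ i, S.rOut i :=
      Finset.single_le_sum (f := S.rOut)
        (fun i _ => ((S.rIn_pos i).trans (S.rIn_lt_rOut i)).le) (Finset.mem_univ i)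
    linarith [hi.2]

theorem volume_domain_lt_top (S : NestedShells N) : volume S.domain < ⊤ := by
  obtain ⟨b, -, hb⟩ := S.exists_radius_bound
  refine (measure_mono (t := Metric.closedBall 0 b) ?_).trans_lt measure_closedBall_lt_top
  intro x hx
  simpa using hb x hx

instance isFiniteMeasure_restrict_domain (S : NestedShells N) :
    IsFiniteMeasure (volume.restrict S.domain) :=
  ⟨by simpa using S.volume_domain_lt_top⟩

theorem restrict_domain_restrict (S : NestedShells N) {s : Set Space3} (hm : MeasurableSet s)
    (hs : s ⊆ S.domain) : (volume.restrict S.domain).restrict s = volume.restrict s := by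
  rw [Measure.restrict_restrict hm, Set.inter_eq_left.mpr hs]

theorem sum_integral_shell (S : NestedShells N) {F : Space3 → ℂ}
    (hF : Integrable F (volume.restrict S.domain)) :
    ∑ i, ∫ x in S.shell i, F x = ∫ x in S.domain, F x := by
  rw [domain, integral_iUnion_fintype S.measurableSet_shell S.pairwise_disjoint_shell]
  intro i
  exact hF.mono_measure (Measure.restrict_mono (S.shell_subset_domain i) le_rfl)

/-! ### Integrals over subsets of `D` as bounded functionals -/

/-- The functional `p ↦ ∫_{s ∩ D} u` for `p = (u, g)`. -/
def setIntegralCLM (S : NestedShells N) (s : Set Space3) (hs : MeasurableSet s) :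
    S.Pairs →L[ℂ] ℂ :=
  (innerSL ℂ (indicatorConstLp 2 hs
    (measure_ne_top (volume.restrict S.domain) s) (1 : ℂ))).comp (WithLp.fstL 2 ℂ _ _)

theorem setIntegralCLM_apply (S : NestedShells N) {s : Set Space3} (hs : MeasurableSet s)
    (hsD : s ⊆ S.domain) (p : S.Pairs) : S.setIntegralCLM s hs p = ∫ x in s, p.fst x := by
  have : S.setIntegralCLM s hs p = inner ℂ (indicatorConstLp 2 hs
    (measure_ne_top (volume.restrict S.domain) s) (1 : ℂ)) p.fst := rfl
  rw [this, L2.inner_indicatorConstLp_one, S.restrict_domain_restrict hs hsD]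

theorem integrable_fst (S : NestedShells N) (p : S.Pairs) :
    Integrable p.fst (volume.restrict S.domain) :=
  (Lp.memLp p.fst).integrable (by norm_num)

end NestedShells

end

noncomputable section

namespace NestedShells

variable {N : ℕ}

/-! ### Completeness of `H¹(D)` and of its radial subspace -/

/-- The integral is the `L²` inner product with the fixed function `ψ`. Both sides of the weak
gradient identity are of this kind, which makes `H¹(D)` closed. -/
theorem continuous_integral_smul {μ : Measure Space3} {ψ : Space3 → ℝ} (hψ : MemLp ψ 2 μ) :
    Continuous fun u : Lp ℂ 2 μ => ∫ x, ψ x • u x ∂μ := by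
  have hψ' : MemLp (fun x => (ψ x : ℂ)) 2 μ := hψ.ofReal
  have h : (fun u : Lp ℂ 2 μ => ∫ x, ψ x • u x ∂μ) = fun u => inner ℂ (hψ'.toLp _) u := by
    funext u
    rw [L2.inner_def]
    refine integral_congr_ae ?_
    filter_upwards [hψ'.coeFn_toLp] with x hx
    rw [hx]
    simp [mul_comm]
  rw [h]
  exact continuous_const.inner continuous_id

theorem isClosed_H1 (S : NestedShells N) : IsClosed (S.H1 : Set S.Pairs) := by
  have h : (S.H1 : Set S.Pairs) = {p | S.IsWeakGradient p} := rfl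
  rw [h]
  simp only [IsWeakGradient, Set.ofPred_forall]
  refine isClosed_iInter fun φ => isClosed_iInter fun hφ => isClosed_iInter fun hc =>
    isClosed_iInter fun _ => isClosed_iInter fun l => isClosed_eq ?_ ?_
  · exact (continuous_integral_smul ((continuous_partial hφ l).memLp_of_hasCompactSupport
      (hasCompactSupport_partial hc l))).comp (WithLp.fstL 2 ℂ _ _).continuous
  · have h1 := (continuous_integral_smul (μ := volume.restrict S.domain)
      (hφ.continuous.memLp_of_hasCompactSupport hc)).comp
      (((EuclideanSpace.proj (𝕜 := ℂ) l).compLpL 2 (volume.restrict S.domain)).continuous.comp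
        (WithLp.sndL 2 ℂ (Lp ℂ 2 (volume.restrict S.domain)) _).continuous)
    refine h1.neg.congr fun p => ?_
    refine congrArg Neg.neg (integral_congr_ae ?_)
    filter_upwards [(EuclideanSpace.proj (𝕜 := ℂ) l).coeFn_compLp p.snd] with x hx
    change φ x • ((EuclideanSpace.proj (𝕜 := ℂ) l).compLp p.snd) x = _
    rw [hx]
    rfl

/-- An `L²` limit is an almost everywhere limit along a subsequence, and a pointwise limit of
functions of `|x|` is again a function of `|x|`. -/
theorem isClosed_H1rad (S : NestedShells N) : IsClosed (S.H1rad : Set S.Pairs) := by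
  refine IsSeqClosed.isClosed fun p q hp hpq => ?_
  refine ⟨S.isClosed_H1.mem_of_tendsto hpq (Eventually.of_forall fun n => (hp n).1), ?_⟩
  choose g hg using fun n => (hp n).2
  have h1 : Tendsto (fun n => (p n).fst) atTop (𝓝 q.fst) :=
    ((WithLp.fstL 2 ℂ _ _).continuous.tendsto q).comp hpq
  obtain ⟨ns, -, hns⟩ := (tendstoInMeasure_of_tendsto_Lp h1).exists_seq_tendsto_ae
  -- Radii at which the profiles do not converge get an arbitrary value; they are met only on a null
  -- set of points.
  refine ⟨fun r => limUnder atTop fun n => g (ns n) r, ?_⟩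
  filter_upwards [hns, ae_all_iff.mpr hg] with x hx hgx
  refine (Tendsto.limUnder_eq ?_).symm
  simpa only [hgx] using hx

end NestedShells

end

noncomputable section

/-! ### Solutions of `u'' + k² u = 0`, uniformly in `k` near `0` -/

/-- The coefficients of the entire function `Φ` with `z Φ(z²) = sin z`. -/
def sincCoeff (n : ℕ) : ℂ := (-1) ^ n / (2 * n + 1).factorial

/-- The entire function `Φ` with `z Φ(z²) = sin z`. -/
def sincSqrt : ℂ → ℂ := (FormalMultilinearSeries.ofScalars ℂ sincCoeff).sum

theorem norm_sincCoeff_le (n : ℕ) : ‖sincCoeff n‖ ≤ 1 / n.factorial := by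
  rw [sincCoeff, norm_div, norm_pow, norm_neg, norm_one, one_pow, Complex.norm_natCast]
  gcongr
  omega

theorem radius_sincCoeff : (FormalMultilinearSeries.ofScalars ℂ sincCoeff).radius = ⊤ := by
  refine FormalMultilinearSeries.radius_eq_top_of_summable_norm _ fun r => ?_
  refine Summable.of_nonneg_of_le (fun n => by positivity) (fun n => ?_)
    (Real.summable_pow_div_factorial r)
  rw [FormalMultilinearSeries.ofScalars_norm, div_eq_mul_one_div, mul_comm]
  gcongr
  exact norm_sincCoeff_le n

theorem hasFPowerSeriesOnBall_sincSqrt : HasFPowerSeriesOnBall sincSqrt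
    (FormalMultilinearSeries.ofScalars ℂ sincCoeff) 0 ⊤ := by
  have := (FormalMultilinearSeries.ofScalars ℂ sincCoeff).hasFPowerSeriesOnBall
    (by rw [radius_sincCoeff]; simp)
  rwa [radius_sincCoeff] at this

theorem analyticAt_sincSqrt (z : ℂ) : AnalyticAt ℂ sincSqrt z :=
  hasFPowerSeriesOnBall_sincSqrt.analyticAt_of_mem (by simp)

theorem contDiff_sincSqrt : ContDiff ℝ 2 sincSqrt :=
  contDiff_iff_contDiffAt.mpr fun z => ((analyticAt_sincSqrt z).contDiffAt).restrict_scalars ℝ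

theorem sincSqrt_eq_tsum (z : ℂ) : sincSqrt z = ∑' n, sincCoeff n * z ^ n :=
  FormalMultilinearSeries.ofScalars_sum_eq sincCoeff z

theorem sincSqrt_zero : sincSqrt 0 = 1 := by
  rw [sincSqrt_eq_tsum, tsum_eq_single 0 (fun n hn => by simp [hn])]
  simp [sincCoeff]

/-- The coefficient of order one. It is what makes `sin (k|x|) / (k|x|)` satisfy the Helmholtz
equation at the origin, where polar coordinates fail. -/
theorem hasDerivAt_sincSqrt_zero : HasDerivAt sincSqrt (-(1 / 6)) 0 := by
  have h := hasFPowerSeriesOnBall_sincSqrt.hasFPowerSeriesAt.hasDerivAt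
  refine h.congr_deriv ?_
  rw [FormalMultilinearSeries.ofScalars_apply_eq]
  norm_num [sincCoeff, Nat.factorial]

theorem mul_sincSqrt_sq (z : ℂ) : z * sincSqrt (z ^ 2) = Complex.sin z := by
  rw [sincSqrt_eq_tsum, ← tsum_mul_left, ← (Complex.hasSum_sin z).tsum_eq]
  refine tsum_congr fun n => ?_
  rw [sincCoeff]
  ring

/-- `sin (k t) / k`, extended by `t` to `k = 0`: the solution of `u'' + k² u = 0` with `u(0) = 0`
and `u'(0) = 1`. -/
def sinDiv (k : ℂ) (t : ℝ) : ℂ := t * sincSqrt (k ^ 2 * (t : ℂ) ^ 2)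

theorem mul_sinDiv (k : ℂ) (t : ℝ) : k * sinDiv k t = Complex.sin (k * t) := by
  rw [← mul_sincSqrt_sq, sinDiv, mul_pow]
  ring

@[simp]
theorem sinDiv_zero_left (t : ℝ) : sinDiv 0 t = t := by
  simp [sinDiv, sincSqrt_zero]

@[simp]
theorem sinDiv_zero_right (k : ℂ) : sinDiv k 0 = 0 := by
  simp [sinDiv]

theorem sinDiv_eq_div {k : ℂ} (hk : k ≠ 0) (t : ℝ) : sinDiv k t = Complex.sin (k * t) / k := by
  rw [← mul_sinDiv, mul_div_cancel_left₀ _ hk]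

theorem hasDerivAt_sinDiv (k : ℂ) (t : ℝ) :
    HasDerivAt (sinDiv k) (Complex.cos (k * t)) t := by
  rcases eq_or_ne k 0 with rfl | hk
  · have h : sinDiv 0 = fun t : ℝ => (t : ℂ) := funext sinDiv_zero_left
    rw [h]
    refine (hasDerivAt_id (t : ℂ)).comp_ofReal.congr_deriv ?_
    simp
  · have h : sinDiv k = fun t : ℝ => Complex.sin (k * t) / k := funext (sinDiv_eq_div hk)
    rw [h]
    refine ((((hasDerivAt_id (t : ℂ)).const_mul k).csin).div_const k).comp_ofReal.congr_deriv ?_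
    simp [hk]

theorem hasDerivAt_cos_mul (k : ℂ) (t : ℝ) :
    HasDerivAt (fun t : ℝ => Complex.cos (k * t)) (-(k ^ 2 * sinDiv k t)) t := by
  refine (((hasDerivAt_id (t : ℂ)).const_mul k).ccos).comp_ofReal.congr_deriv ?_
  simp only [id_eq, mul_one, ← mul_sinDiv]
  ring

theorem sinDiv_sub (k : ℂ) (s t : ℝ) :
    sinDiv k (s - t) = sinDiv k s * Complex.cos (k * t) - Complex.cos (k * s) * sinDiv k t := by
  rcases eq_or_ne k 0 with rfl | hk
  · simp
  · rw [sinDiv_eq_div hk, sinDiv_eq_div hk, sinDiv_eq_div hk, Complex.ofReal_sub, mul_sub,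
      Complex.sin_sub]
    field_simp

theorem cos_sq_add_sinDiv_sq (k : ℂ) (t : ℝ) :
    Complex.cos (k * t) ^ 2 + k ^ 2 * sinDiv k t ^ 2 = 1 := by
  rw [← mul_pow, mul_sinDiv, add_comm, Complex.sin_sq_add_cos_sq]

theorem continuous_sinDiv_left (t : ℝ) : Continuous fun k => sinDiv k t :=
  continuous_const.mul (contDiff_sincSqrt.continuous.comp (by fun_prop))

theorem contDiff_sinDiv (k : ℂ) : ContDiff ℝ 2 (sinDiv k) :=
  (Complex.ofRealCLM.contDiff).mul (contDiff_sincSqrt.comp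
    (contDiff_const.mul (Complex.ofRealCLM.contDiff.pow 2)))

/-- At `k = 0` the value is `t`. For a gap of width `t` this says that `k²` near `0` is no Dirichlet
eigenvalue of the gap. -/
theorem eventually_sinDiv_ne_zero {t : ℝ} (ht : t ≠ 0) : ∀ᶠ k in 𝓝 (0 : ℂ), sinDiv k t ≠ 0 :=
  (continuous_sinDiv_left t).continuousAt.eventually_ne (by simpa using ht)

theorem ContDiffAt.differentiableAt_deriv {u : ℝ → ℂ} {r : ℝ} (hu : ContDiffAt ℝ 2 u r) :
    DifferentiableAt ℝ (deriv u) r := by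
  have h : ContDiffAt ℝ 1 (fun y => fderiv ℝ u y 1) r :=
    (hu.fderiv_right (m := 1) (by norm_num)).clm_apply contDiffAt_const
  exact h.differentiableAt (by norm_num)

/-- A solution of `u'' + k² u = 0` on `(a, b)`, continuous on `[a, b]`, in terms of its values at
the end points. -/
theorem sinDiv_mul_eq_of_ode {k : ℂ} {a b : ℝ} (hab : a < b) {u : ℝ → ℂ}
    (hc : ContinuousOn u (Set.Icc a b)) (hu : ∀ r ∈ Set.Ioo a b, ContDiffAt ℝ 2 u r)
    (hode : ∀ r ∈ Set.Ioo a b, deriv (deriv u) r = -(k ^ 2 * u r)) {r : ℝ}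
    (hr : r ∈ Set.Icc a b) :
    sinDiv k (b - a) * u r = u a * sinDiv k (b - r) + u b * sinDiv k (r - a) := by
  set c : ℝ → ℂ := fun r => Complex.cos (k * (r - a : ℝ)) with hcdef
  set s : ℝ → ℂ := fun r => sinDiv k (r - a) with hsdef
  have hs' : ∀ r, HasDerivAt s (c r) r := fun r =>
    (hasDerivAt_sinDiv k (r - a)).comp_sub_const r a
  have hc' : ∀ r, HasDerivAt c (-(k ^ 2 * s r)) r := fun r =>
    (hasDerivAt_cos_mul k (r - a)).comp_sub_const r a
  have hu1 : ∀ r ∈ Set.Ioo a b, HasDerivAt u (deriv u r) r := fun r hr =>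
    ((hu r hr).differentiableAt (by norm_num)).hasDerivAt
  have hu2 : ∀ r ∈ Set.Ioo a b, HasDerivAt (deriv u) (-(k ^ 2 * u r)) r := fun r hr => by
    rw [← hode r hr]
    exact (hu r hr).differentiableAt_deriv.hasDerivAt
  have hconst : ∀ f : ℝ → ℂ, (∀ r ∈ Set.Ioo a b, HasDerivAt f 0 r) →
      ∃ C, ∀ r ∈ Set.Ioo a b, f r = C := by
    intro f hf
    refine ⟨f ((a + b) / 2), fun r hr => ?_⟩
    exact isOpen_Ioo.is_const_of_deriv_eq_zero isPreconnected_Ioo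
      (fun x hx => (hf x hx).differentiableAt.differentiableWithinAt)
      (fun x hx => (hf x hx).deriv) hr ⟨by linarith, by linarith⟩
  -- The Wronskians of `u` with the fundamental solutions `c` and `s` are constant; they are the
  -- coefficients of `u` in this basis.
  obtain ⟨B, hB⟩ := hconst (fun r => deriv u r * c r + u r * (k ^ 2 * s r)) fun r hr => by
    refine (((hu2 r hr).mul (hc' r)).add ((hu1 r hr).mul ((hs' r).const_mul (k ^ 2)))).congr_deriv ?_
    ring
  obtain ⟨A, hA⟩ := hconst (fun r => u r * c r - deriv u r * s r) fun r hr => by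
    refine (((hu1 r hr).mul (hc' r)).sub ((hu2 r hr).mul (hs' r))).congr_deriv ?_
    ring
  have hioo : ∀ r ∈ Set.Ioo a b, u r = A * c r + B * s r := fun r hr => by
    have h1 := hA r hr
    have h2 := hB r hr
    have h3 : c r ^ 2 + k ^ 2 * s r ^ 2 = 1 := cos_sq_add_sinDiv_sq k (r - a)
    linear_combination c r * h1 + s r * h2 - u r * h3
  -- The equation holds only in the open interval; continuity carries the formula to the end points,
  -- where the boundary values are read off.
  have hicc : Set.EqOn u (fun r => A * c r + B * s r) (Set.Icc a b) := by
    refine Set.EqOn.of_subset_closure (s := Set.Ioo a b) hioo hc ?_ Set.Ioo_subset_Icc_self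
      (by rw [closure_Ioo hab.ne])
    exact Continuous.continuousOn (((continuous_iff_continuousAt.mpr fun r =>
      (hc' r).continuousAt).const_mul _).add ((continuous_iff_continuousAt.mpr fun r =>
      (hs' r).continuousAt).const_mul _))
  have ha := hicc (Set.left_mem_Icc.mpr hab.le)
  have hb := hicc (Set.right_mem_Icc.mpr hab.le)
  have hr' := hicc hr
  have h4 : sinDiv k (b - r) = s b * c r - c b * s r := by
    have := sinDiv_sub k (b - a) (r - a)
    rw [show b - a - (r - a) = b - r by ring] at this
    exact this
  have hca : c a = 1 := by simp [hcdef]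
  have hsa : s a = 0 := by simp [hsdef]
  change s b * u r = u a * sinDiv k (b - r) + u b * s r
  simp only [hca, hsa] at ha
  rw [h4, ha, hb, hr']
  ring

end

noncomputable section

/-! ### The Laplacian of radial functions -/

theorem ContDiffAt.eventually_differentiableAt {u : ℝ → ℂ} {r : ℝ} (hu : ContDiffAt ℝ 2 u r) :
    ∀ᶠ t in 𝓝 r, DifferentiableAt ℝ u t := by
  filter_upwards [hu.eventually (by simp)] with t ht
  exact ht.differentiableAt (by norm_num)

/-- The Hessian of `G(|y|²)` is `4 G'' x ⊗ x + 2 G' I`, and its trace in dimension three is the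
right side. Using `|y|²` in place of `|y|` keeps the formula valid at the origin. -/
theorem laplacian_comp_norm_sq {G : ℝ → ℂ} {x : Space3} (hG : ContDiffAt ℝ 2 G (‖x‖ ^ 2)) :
    Laplacian.laplacian (fun y : Space3 => G (‖y‖ ^ 2)) x =
      4 * ‖x‖ ^ 2 * deriv (deriv G) (‖x‖ ^ 2) + 6 * deriv G (‖x‖ ^ 2) := by
  have hN : ∀ y : Space3, HasFDerivAt (fun y : Space3 => ‖y‖ ^ 2) (2 • innerSL ℝ y) y := fun y => by
    simpa using (hasFDerivAt_id y).norm_sq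
  have hcont : ContinuousAt (fun y : Space3 => ‖y‖ ^ 2) x := (hN x).continuousAt
  have h1 : fderiv ℝ (fun y : Space3 => G (‖y‖ ^ 2)) =ᶠ[𝓝 x]
      fun y => (2 • innerSL ℝ y).smulRight (deriv G (‖y‖ ^ 2)) := by
    filter_upwards [hcont.eventually hG.eventually_differentiableAt] with y hy
    have := (hy.hasDerivAt.hasFDerivAt.comp y (hN y)).fderiv
    refine this.trans ?_
    ext v
    simp [mul_assoc]
  have h2 : HasFDerivAt (fun y : Space3 => deriv G (‖y‖ ^ 2))
      ((2 • innerSL ℝ x).smulRight (deriv (deriv G) (‖x‖ ^ 2))) x := by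
    have := hG.differentiableAt_deriv.hasDerivAt.hasFDerivAt.comp x (hN x)
    refine this.congr_fderiv ?_
    ext v
    simp [mul_assoc]
  have h3 : ∀ v : Space3, fderiv ℝ (fderiv ℝ (fun y : Space3 => G (‖y‖ ^ 2))) x v v =
      4 * (inner ℝ x v : ℝ) ^ 2 * deriv (deriv G) (‖x‖ ^ 2)
        + 2 * (‖v‖ ^ 2 : ℝ) * deriv G (‖x‖ ^ 2) := by
    intro v
    rw [h1.fderiv_eq]
    have h4 : HasFDerivAt (fun y : Space3 => (2 • innerSL ℝ y : Space3 →L[ℝ] ℝ))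
        (2 • (innerSL ℝ : Space3 →L[ℝ] Space3 →L[ℝ] ℝ)) x :=
      (2 • (innerSL ℝ : Space3 →L[ℝ] Space3 →L[ℝ] ℝ)).hasFDerivAt
    have h5 := ((ContinuousLinearMap.smulRightL ℝ Space3 ℂ).isBoundedBilinearMap.hasFDerivAt
      ((2 • innerSL ℝ x : Space3 →L[ℝ] ℝ), deriv G (‖x‖ ^ 2))).comp x (h4.prodMk h2)
    have h6 := h5.fderiv
    have h7 : fderiv ℝ (fun y : Space3 => (2 • innerSL ℝ y).smulRight (deriv G (‖y‖ ^ 2))) x = _ :=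
      h6
    rw [h7]
    have h8 : innerSL ℝ v v = ‖v‖ ^ 2 := real_inner_self_eq_norm_sq v
    simp [h8]
    ring
  rw [InnerProductSpace.laplacian_eq_iteratedFDeriv_orthonormalBasis _
    (EuclideanSpace.basisFun (Fin 3) ℝ)]
  simp only [iteratedFDeriv_two_apply, Matrix.cons_val_zero, Matrix.cons_val_one]
  simp only [h3]
  have h8 : ((‖x‖ : ℂ)) ^ 2 = (x 0 : ℂ) ^ 2 + (x 1 : ℂ) ^ 2 + (x 2 : ℂ) ^ 2 := by
    have := EuclideanSpace.real_norm_sq_eq x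
    rw [Fin.sum_univ_three] at this
    exact_mod_cast this
  rw [Fin.sum_univ_three, h8]
  simp [EuclideanSpace.inner_single_right]
  ring

/-- The bracket is the expression of `laplacian_comp_norm_sq`: multiplying by the radius turns the
radial Laplacian into a plain second derivative. -/
theorem deriv_deriv_mul_comp_sq {G : ℝ → ℂ} {r : ℝ} (hG : ContDiffAt ℝ 2 G (r ^ 2)) :
    deriv (deriv fun t : ℝ => (t : ℂ) * G (t ^ 2)) r =
      r * (4 * r ^ 2 * deriv (deriv G) (r ^ 2) + 6 * deriv G (r ^ 2)) := by
  have hsq : ∀ t : ℝ, HasDerivAt (fun t : ℝ => t ^ 2) (2 * t) t := fun t => by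
    simpa using hasDerivAt_pow 2 t
  have hid : ∀ t : ℝ, HasDerivAt (fun t : ℝ => (t : ℂ)) 1 t := fun t =>
    (hasDerivAt_id (t : ℂ)).comp_ofReal
  have hcont : ContinuousAt (fun t : ℝ => t ^ 2) r := (hsq r).continuousAt
  have h1 : deriv (fun t : ℝ => (t : ℂ) * G (t ^ 2)) =ᶠ[𝓝 r]
      fun t => G (t ^ 2) + 2 * (t : ℂ) ^ 2 * deriv G (t ^ 2) := by
    filter_upwards [hcont.eventually hG.eventually_differentiableAt] with t ht
    have h2 : HasDerivAt (fun t : ℝ => G (t ^ 2)) ((2 * t) • deriv G (t ^ 2)) t :=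
      HasDerivAt.scomp t ht.hasDerivAt (hsq t)
    refine ((hid t).mul h2).deriv.trans ?_
    simp
    ring
  rw [h1.deriv_eq]
  have h2 : HasDerivAt (fun t : ℝ => G (t ^ 2)) ((2 * r) • deriv G (r ^ 2)) r :=
    HasDerivAt.scomp r (hG.differentiableAt (by norm_num)).hasDerivAt (hsq r)
  have h3 : HasDerivAt (fun t : ℝ => deriv G (t ^ 2)) ((2 * r) • deriv (deriv G) (r ^ 2)) r :=
    HasDerivAt.scomp (g₁ := deriv G) (h := fun t : ℝ => t ^ 2) r hG.differentiableAt_deriv.hasDerivAt (hsq r)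
  refine (h2.add ((((hid r).pow 2).const_mul 2).mul h3)).deriv.trans ?_
  simp
  ring

/-- The Laplacian of `u(|x|) / |x|` is `u''(|x|) / |x|`. -/
theorem laplacian_radial {u : ℝ → ℂ} {w : Space3 → ℂ} {x : Space3} (hx : x ≠ 0)
    (hu : ContDiffAt ℝ 2 u ‖x‖) (hw : w =ᶠ[𝓝 x] fun y => u ‖y‖ / ‖y‖) :
    Laplacian.laplacian w x = deriv (deriv u) ‖x‖ / ‖x‖ := by
  have hx0 : 0 < ‖x‖ := norm_pos_iff.mpr hx
  set G : ℝ → ℂ := fun t => u (Real.sqrt t) / (Real.sqrt t : ℝ) with hGdef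
  have hsqrt : Real.sqrt (‖x‖ ^ 2) = ‖x‖ := Real.sqrt_sq hx0.le
  have hG : ContDiffAt ℝ 2 G (‖x‖ ^ 2) := by
    have h1 : ContDiffAt ℝ 2 Real.sqrt (‖x‖ ^ 2) := Real.contDiffAt_sqrt (by positivity)
    have h2 : ContDiffAt ℝ 2 (fun t => u (Real.sqrt t)) (‖x‖ ^ 2) :=
      ContDiffAt.comp (g := u) _ (by rw [hsqrt]; exact hu) h1
    simp only [hGdef, div_eq_mul_inv]
    refine h2.mul (ContDiffAt.inv (Complex.ofRealCLM.contDiff.contDiffAt.comp _ h1) ?_)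
    change ((Real.sqrt (‖x‖ ^ 2) : ℝ) : ℂ) ≠ 0
    rw [hsqrt]
    exact_mod_cast hx0.ne'
  have hw' : w =ᶠ[𝓝 x] fun y => G (‖y‖ ^ 2) := by
    filter_upwards [hw] with y hy
    rw [hy]
    simp only [hGdef, Real.sqrt_sq (norm_nonneg y)]
  rw [(InnerProductSpace.laplacian_congr_nhds hw').self_of_nhds, laplacian_comp_norm_sq hG]
  have hu' : u =ᶠ[𝓝 ‖x‖] fun t : ℝ => (t : ℂ) * G (t ^ 2) := by
    filter_upwards [lt_mem_nhds hx0] with t ht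
    have : (t : ℂ) ≠ 0 := by exact_mod_cast ht.ne'
    simp only [hGdef, Real.sqrt_sq ht.le]
    field_simp
  rw [hu'.deriv.deriv_eq, deriv_deriv_mul_comp_sq hG]
  have : (‖x‖ : ℂ) ≠ 0 := by exact_mod_cast hx0.ne'
  field_simp

end

noncomputable section

/-! ### Radial Helmholtz solutions -/

theorem contDiffAt_radial {u : ℝ → ℂ} (hu : ContDiff ℝ 2 u) {x : Space3} (hx : x ≠ 0) :
    ContDiffAt ℝ 2 (fun y : Space3 => u ‖y‖ / ‖y‖) x := by
  have h1 : ContDiffAt ℝ 2 (fun y : Space3 => ‖y‖) x := contDiffAt_norm ℝ hx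
  simp only [div_eq_mul_inv]
  refine (hu.contDiffAt.comp x h1).mul
    (ContDiffAt.inv (Complex.ofRealCLM.contDiff.contDiffAt.comp x h1) ?_)
  change ((‖x‖ : ℝ) : ℂ) ≠ 0
  exact_mod_cast norm_ne_zero_iff.mpr hx

theorem helmholtz_radial {k : ℂ} {u : ℝ → ℂ} (hu : ContDiff ℝ 2 u)
    (hode : ∀ r, deriv (deriv u) r = -(k ^ 2 * u r)) {x : Space3} (hx : x ≠ 0) {w : Space3 → ℂ}
    (hw : w =ᶠ[𝓝 x] fun y => u ‖y‖ / ‖y‖) :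
    Laplacian.laplacian w x + k ^ 2 * w x = 0 := by
  rw [laplacian_radial hx hu.contDiffAt hw, hode, hw.self_of_nhds]
  ring

/-- The solution of `u'' + k² u = 0` with the values `A s` at `a` and `B s` at `b`, where
`s = sin (k (b - a)) / k`. -/
def gapProfile (k : ℂ) (a b : ℝ) (A B : ℂ) (r : ℝ) : ℂ :=
  A * sinDiv k (b - r) + B * sinDiv k (r - a)

theorem hasDerivAt_gapProfile (k : ℂ) (a b : ℝ) (A B : ℂ) (r : ℝ) :
    HasDerivAt (gapProfile k a b A B)
      (-(A * Complex.cos (k * (b - r : ℝ))) + B * Complex.cos (k * (r - a : ℝ))) r := by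
  have h1 : HasDerivAt (fun r => sinDiv k (b - r)) (-Complex.cos (k * (b - r : ℝ))) r :=
    (hasDerivAt_sinDiv k (b - r)).comp_const_sub b r
  have h2 : HasDerivAt (fun r => sinDiv k (r - a)) (Complex.cos (k * (r - a : ℝ))) r :=
    (hasDerivAt_sinDiv k (r - a)).comp_sub_const r a
  refine ((h1.const_mul A).add (h2.const_mul B)).congr_deriv ?_
  ring

theorem deriv_deriv_gapProfile (k : ℂ) (a b : ℝ) (A B : ℂ) (r : ℝ) :
    deriv (deriv (gapProfile k a b A B)) r = -(k ^ 2 * gapProfile k a b A B r) := by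
  have h : deriv (gapProfile k a b A B) = fun r : ℝ =>
      -(A * Complex.cos (k * (b - r : ℝ))) + B * Complex.cos (k * (r - a : ℝ)) :=
    funext fun r => (hasDerivAt_gapProfile k a b A B r).deriv
  rw [h]
  have h1 : HasDerivAt (fun r : ℝ => Complex.cos (k * (b - r : ℝ)))
      (-(-(k ^ 2 * sinDiv k (b - r)))) r :=
    (hasDerivAt_cos_mul k (b - r)).comp_const_sub b r
  have h2 : HasDerivAt (fun r : ℝ => Complex.cos (k * (r - a : ℝ)))
      (-(k ^ 2 * sinDiv k (r - a))) r :=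
    (hasDerivAt_cos_mul k (r - a)).comp_sub_const r a
  refine ((h1.const_mul A).neg.add (h2.const_mul B)).deriv.trans ?_
  rw [gapProfile]
  ring

theorem contDiff_gapProfile (k : ℂ) (a b : ℝ) (A B : ℂ) : ContDiff ℝ 2 (gapProfile k a b A B) :=
  (contDiff_const.mul ((contDiff_sinDiv k).comp (contDiff_const.sub contDiff_id))).add
    (contDiff_const.mul ((contDiff_sinDiv k).comp (contDiff_id.sub contDiff_const)))

theorem hasDerivAt_cexp_mul (c k : ℂ) (r : ℝ) :
    HasDerivAt (fun r : ℝ => c * Complex.exp (Complex.I * k * r))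
      (c * (Complex.I * k) * Complex.exp (Complex.I * k * r)) r := by
  refine ((((hasDerivAt_id (r : ℂ)).const_mul (Complex.I * k)).cexp).const_mul
    c).comp_ofReal.congr_deriv ?_
  simp only [id_eq]
  ring

theorem deriv_deriv_cexp_mul (c k : ℂ) (r : ℝ) :
    deriv (deriv fun r : ℝ => c * Complex.exp (Complex.I * k * r)) r =
      -(k ^ 2 * (c * Complex.exp (Complex.I * k * r))) := by
  have h : (deriv fun r : ℝ => c * Complex.exp (Complex.I * k * r)) = fun r : ℝ =>
      c * (Complex.I * k) * Complex.exp (Complex.I * k * r) :=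
    funext fun r => (hasDerivAt_cexp_mul c k r).deriv
  rw [h]
  refine (hasDerivAt_cexp_mul (c * (Complex.I * k)) k r).deriv.trans ?_
  linear_combination c * k ^ 2 * Complex.exp (Complex.I * k * r) * Complex.I_sq

theorem contDiff_cexp_mul (c k : ℂ) :
    ContDiff ℝ 2 fun r : ℝ => c * Complex.exp (Complex.I * k * r) :=
  contDiff_const.mul ((contDiff_const.mul Complex.ofRealCLM.contDiff).cexp)

/-- In the ball inside the innermost shell the regular solutions are the multiples of `sin (kr) /
(kr)`; as an entire function of `r²` this is smooth through the origin. -/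
theorem contDiff_core (k C : ℂ) :
    ContDiff ℝ 2 fun x : Space3 => C * sincSqrt (k ^ 2 * (‖x‖ ^ 2 : ℝ)) :=
  contDiff_const.mul (contDiff_sincSqrt.comp
    (contDiff_const.mul (Complex.ofRealCLM.contDiff.comp (contDiff_norm_sq ℝ))))

theorem helmholtz_core (k C : ℂ) (x : Space3) :
    Laplacian.laplacian (fun x : Space3 => C * sincSqrt (k ^ 2 * (‖x‖ ^ 2 : ℝ))) x
      + k ^ 2 * (C * sincSqrt (k ^ 2 * (‖x‖ ^ 2 : ℝ))) = 0 := by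
  rcases eq_or_ne x 0 with rfl | hx
  · have hG : ContDiff ℝ 2 fun t : ℝ => C * sincSqrt (k ^ 2 * (t : ℂ)) :=
      contDiff_const.mul (contDiff_sincSqrt.comp
        (contDiff_const.mul Complex.ofRealCLM.contDiff))
    have h1 := laplacian_comp_norm_sq (x := 0) hG.contDiffAt
    have h2 : HasDerivAt (fun t : ℝ => C * sincSqrt (k ^ 2 * (t : ℂ))) (C * (-(1 / 6) * k ^ 2))
        0 := by
      have h3 : HasDerivAt (fun z : ℂ => k ^ 2 * z) (k ^ 2) ((0 : ℝ) : ℂ) := by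
        simpa using (hasDerivAt_id ((0 : ℝ) : ℂ)).const_mul (k ^ 2)
      have h4 : HasDerivAt sincSqrt (-(1 / 6)) (k ^ 2 * ((0 : ℝ) : ℂ)) := by
        simpa using hasDerivAt_sincSqrt_zero
      exact ((h4.comp _ h3).const_mul C).comp_ofReal
    rw [h1]
    simp only [norm_zero, ne_eq, OfNat.ofNat_ne_zero, not_false_eq_true, zero_pow,
      Complex.ofReal_zero, h2.deriv, mul_zero, sincSqrt_zero]
    ring
  -- With these parameters `gapProfile` is `C * sinDiv k r`, which is `r` times the core solution.
  · refine helmholtz_radial (u := gapProfile k 0 0 0 C) (contDiff_gapProfile k 0 0 0 C)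
      (deriv_deriv_gapProfile k 0 0 0 C) hx
      (w := fun x : Space3 => C * sincSqrt (k ^ 2 * (‖x‖ ^ 2 : ℝ))) ?_
    filter_upwards [isOpen_ne.mem_nhds hx] with y hy
    have : (‖y‖ : ℂ) ≠ 0 := by exact_mod_cast norm_ne_zero_iff.mpr hy
    simp only [gapProfile, sinDiv, sub_zero]
    push_cast
    field_simp
    ring

theorem norm_smul_unitVec (r : ℝ) (l : Fin 3) : ‖r • unitVec l‖ = |r| := by
  simp [norm_smul, unitVec]

end

noncomputable section

namespace NestedShells

variable {N : ℕ}

/-! ### The components of the host medium -/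

/-- The inner radius of the component of the host medium right inside the shell `i`; it is `0` for
the core. -/
def gapLow (S : NestedShells N) (i : Fin N) : ℝ :=
  if h : (i : ℕ) + 1 < N then S.rOut ⟨i + 1, h⟩ else 0

/-- The boundary datum at the inner radius of the component right inside the shell `i`. -/
def gapVal (f : Fin N → Side → ℂ) (i : Fin N) : ℂ :=
  if h : (i : ℕ) + 1 < N then f ⟨i + 1, h⟩ Side.outer else 0

theorem rOut_pos (S : NestedShells N) (i : Fin N) : 0 < S.rOut i :=
  (S.rIn_pos i).trans (S.rIn_lt_rOut i)

theorem rOut_le (S : NestedShells N) {i j : Fin N} (h : i ≤ j) : S.rOut j ≤ S.rOut i := by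
  rcases h.eq_or_lt with rfl | h
  · exact le_rfl
  · exact ((S.nested i j h).trans (S.rIn_lt_rOut i)).le

theorem gapLow_nonneg (S : NestedShells N) (i : Fin N) : 0 ≤ S.gapLow i := by
  rw [gapLow]
  split_ifs with h
  · exact (S.rOut_pos _).le
  · exact le_rfl

theorem gapLow_lt (S : NestedShells N) (i : Fin N) : S.gapLow i < S.rIn i := by
  rw [gapLow]
  split_ifs with h
  · exact S.nested _ _ (Fin.lt_def.mpr (Nat.lt_succ_self _))
  · exact S.rIn_pos i

theorem rOut_le_gapLow (S : NestedShells N) {i j : Fin N} (h : i < j) :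
    S.rOut j ≤ S.gapLow i := by
  have h1 : (i : ℕ) + 1 < N := by have := Fin.lt_def.mp h; omega
  rw [gapLow, dif_pos h1]
  exact S.rOut_le (Fin.le_def.mpr (by have := Fin.lt_def.mp h; simp; omega))

/-- The component of the host medium right inside the shell `i`. -/
def gap (S : NestedShells N) (i : Fin N) : Set Space3 :=
  {x | ‖x‖ < S.rIn i ∧ ∀ j, i < j → S.rOut j < ‖x‖}

/-- The closure of the component of the host medium right inside the shell `i`. -/
def closedGap (S : NestedShells N) (i : Fin N) : Set Space3 :=
  {x | ‖x‖ ≤ S.rIn i ∧ ∀ j, i < j → S.rOut j ≤ ‖x‖}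

/-- The unbounded component of the host medium with its boundary. -/
def closedExterior (S : NestedShells N) : Set Space3 := {x | ∀ j, S.rOut j ≤ ‖x‖}

theorem isOpen_gap (S : NestedShells N) (i : Fin N) : IsOpen (S.gap i) := by
  simp only [gap, Set.ofPred_and, Set.ofPred_forall]
  exact (isOpen_lt continuous_norm continuous_const).inter
    (isOpen_iInter_of_finite fun j => isOpen_iInter_of_finite fun _ =>
      isOpen_lt continuous_const continuous_norm)

theorem isClosed_closedGap (S : NestedShells N) (i : Fin N) : IsClosed (S.closedGap i) := by
  simp only [closedGap, Set.ofPred_and, Set.ofPred_forall]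
  exact (isClosed_le continuous_norm continuous_const).inter
    (isClosed_iInter fun j => isClosed_iInter fun _ =>
      isClosed_le continuous_const continuous_norm)

theorem isClosed_closedExterior (S : NestedShells N) : IsClosed S.closedExterior := by
  simp only [closedExterior, Set.ofPred_forall]
  exact isClosed_iInter fun j => isClosed_le continuous_const continuous_norm

theorem isOpen_host (S : NestedShells N) : IsOpen S.host := by
  simp only [host, Set.ofPred_forall, Set.ofPred_or]
  exact isOpen_iInter_of_finite fun i => (isOpen_lt continuous_norm continuous_const).union
    (isOpen_lt continuous_const continuous_norm)

theorem gap_subset_closedGap (S : NestedShells N) (i : Fin N) : S.gap i ⊆ S.closedGap i :=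
  fun _ hx => ⟨hx.1.le, fun j hj => (hx.2 j hj).le⟩

theorem host_subset (S : NestedShells N) {x : Space3} (hx : x ∈ S.host) :
    (∃ i, x ∈ S.gap i) ∨ ∀ j, S.rOut j < ‖x‖ := by
  by_cases h : ∃ i, ‖x‖ < S.rIn i
  · left
    -- Indices increase inwards, so the maximal index is the innermost shell whose inner sphere
    -- still encloses `x`.
    obtain ⟨i, hi, hmax⟩ := Set.Finite.exists_maximal
      (Set.toFinite {i | ‖x‖ < S.rIn i}) h
    refine ⟨i, hi, fun j hj => (hx j).resolve_left fun hj' => ?_⟩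
    exact absurd (hmax hj' hj.le) (not_le.mpr hj)
  · right
    push Not at h
    exact fun j => (hx j).resolve_left (not_lt.mpr (h j))

theorem closedHost_eq (S : NestedShells N) :
    S.closedHost = (⋃ i, S.closedGap i) ∪ S.closedExterior := by
  ext x
  constructor
  · intro hx
    by_cases h : ∃ i, ‖x‖ ≤ S.rIn i
    · left
      obtain ⟨i, hi, hmax⟩ := Set.Finite.exists_maximal
        (Set.toFinite {i | ‖x‖ ≤ S.rIn i}) h
      refine Set.mem_iUnion.mpr ⟨i, hi, fun j hj => (hx j).resolve_left fun hj' => ?_⟩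
      exact absurd (hmax hj' hj.le) (not_le.mpr hj)
    · right
      push Not at h
      exact fun j => (hx j).resolve_left (not_le.mpr (h j))
  · rintro (h | h)
    · obtain ⟨i, hi⟩ := Set.mem_iUnion.mp h
      intro j
      rcases lt_trichotomy i j with hj | rfl | hj
      · exact Or.inr (hi.2 j hj)
      · exact Or.inl hi.1
      · refine Or.inl (hi.1.trans ?_)
        exact ((S.rIn_lt_rOut i).trans (S.nested j i hj)).le
    · exact fun j => Or.inr (h j)

/-- Shells have positive thickness, so even the closed components are disjoint and functions given
on each of them can be glued. -/
theorem closedGap_index_unique (S : NestedShells N) {i j : Fin N} {x : Space3}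
    (hi : x ∈ S.closedGap i) (hj : x ∈ S.closedGap j) : i = j := by
  rcases lt_trichotomy i j with h | h | h
  · linarith [hi.2 j h, hj.1, S.rIn_lt_rOut j]
  · exact h
  · linarith [hj.2 i h, hi.1, S.rIn_lt_rOut i]

theorem not_mem_closedGap (S : NestedShells N) {x : Space3} (hx : x ∈ S.closedExterior)
    (i : Fin N) : x ∉ S.closedGap i := fun hi => by
  linarith [hx i, hi.1, S.rIn_lt_rOut i]

theorem mem_closedGap_of_norm (S : NestedShells N) {i : Fin N} {x : Space3}
    (h1 : S.gapLow i ≤ ‖x‖) (h2 : ‖x‖ ≤ S.rIn i) : x ∈ S.closedGap i :=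
  ⟨h2, fun _ hj => (S.rOut_le_gapLow hj).trans h1⟩

theorem mem_gap_of_norm (S : NestedShells N) {i : Fin N} {x : Space3}
    (h1 : S.gapLow i < ‖x‖) (h2 : ‖x‖ < S.rIn i) : x ∈ S.gap i :=
  ⟨h2, fun _ hj => (S.rOut_le_gapLow hj).trans_lt h1⟩

theorem gap_subset_host (S : NestedShells N) (i : Fin N) : S.gap i ⊆ S.host := by
  intro x hx j
  rcases lt_trichotomy i j with hj | rfl | hj
  · exact Or.inr (hx.2 j hj)
  · exact Or.inl hx.1
  · exact Or.inl (hx.1.trans ((S.rIn_lt_rOut i).trans (S.nested j i hj)))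

theorem closedGap_subset_closedHost (S : NestedShells N) (i : Fin N) :
    S.closedGap i ⊆ S.closedHost := by
  rw [closedHost_eq]
  exact (Set.subset_iUnion _ i).trans Set.subset_union_left

/-! ### Existence for the exterior Dirichlet problem -/

/-- Between two spheres the solution is `gapProfile` divided by `r`; in the core it is the regular
solution. The inner sphere is quantified as an index `j = i + 1`, so that for the core the last
condition is empty. -/
theorem exists_gap_solution (S : NestedShells N) {k : ℂ} (i : Fin N)
    (hk : sinDiv k (S.rIn i - S.gapLow i) ≠ 0) (f : Fin N → Side → ℂ) :
    ∃ w : Space3 → ℂ, (∀ x y, ‖x‖ = ‖y‖ → w x = w y) ∧ (∀ x ∈ S.gap i, ContDiffAt ℝ 2 w x) ∧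
      (∀ x ∈ S.gap i, Laplacian.laplacian w x + k ^ 2 * w x = 0) ∧
      ContinuousOn w (S.closedGap i) ∧ (∀ x, ‖x‖ = S.rIn i → w x = f i Side.inner) ∧
      ∀ (j : Fin N) x, (j : ℕ) = i + 1 → ‖x‖ = S.rOut j → w x = f j Side.outer := by
  have hb := S.rIn_pos i
  have hb' : ((S.rIn i : ℝ) : ℂ) ≠ 0 := by exact_mod_cast hb.ne'
  by_cases h : (i : ℕ) + 1 < N
  · set j : Fin N := ⟨i + 1, h⟩ with hj
    have hij : i < j := Fin.lt_def.mpr (Nat.lt_succ_self _)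
    have hlow : S.gapLow i = S.rOut j := by rw [gapLow, dif_pos h]
    rw [hlow] at hk
    have ha := S.rOut_pos j
    have ha' : ((S.rOut j : ℝ) : ℂ) ≠ 0 := by exact_mod_cast ha.ne'
    set L := sinDiv k (S.rIn i - S.rOut j) with hL
    set u := gapProfile k (S.rOut j) (S.rIn i) (S.rOut j * f j Side.outer / L)
      (S.rIn i * f i Side.inner / L) with hu
    have hu2 : ContDiff ℝ 2 u := contDiff_gapProfile _ _ _ _ _
    have hne : ∀ x ∈ S.closedGap i, x ≠ 0 := fun x hx =>
      norm_pos_iff.mp (ha.trans_le (hx.2 j hij))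
    refine ⟨fun x => u ‖x‖ / ‖x‖, fun x y hxy => by simp only [hxy], fun x hx =>
      contDiffAt_radial hu2 (hne x (S.gap_subset_closedGap i hx)), fun x hx =>
      helmholtz_radial hu2 (deriv_deriv_gapProfile _ _ _ _ _)
        (hne x (S.gap_subset_closedGap i hx)) (w := fun x => u ‖x‖ / ‖x‖) EventuallyEq.rfl,
      fun x hx => (contDiffAt_radial hu2 (hne x hx)).continuousAt.continuousWithinAt, ?_, ?_⟩
    · intro x hx
      simp only [hx, hu, gapProfile, sub_self, sinDiv_zero_right, mul_zero, zero_add, ← hL]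
      field_simp
    · intro j' x hj' hx
      obtain rfl : j' = j := Fin.ext hj'
      simp only [hx, hu, gapProfile, sub_self, sinDiv_zero_right, mul_zero, add_zero, ← hL]
      field_simp
  · have hlow : S.gapLow i = 0 := by rw [gapLow, dif_neg h]
    rw [hlow, sub_zero] at hk
    set C := S.rIn i * f i Side.inner / sinDiv k (S.rIn i) with hC
    refine ⟨fun x => C * sincSqrt (k ^ 2 * (‖x‖ ^ 2 : ℝ)), fun x y hxy => by simp only [hxy],
      fun x _ => (contDiff_core k C).contDiffAt, fun x _ => helmholtz_core k C x,
      (contDiff_core k C).continuous.continuousOn, ?_, ?_⟩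
    · intro x hx
      have : sinDiv k (S.rIn i) = S.rIn i * sincSqrt (k ^ 2 * (‖x‖ ^ 2 : ℝ)) := by
        rw [hx, sinDiv]
        push_cast
        rfl
      rw [this] at hk hC
      rw [hC]
      have h2 := right_ne_zero_of_mul hk
      field_simp
    · intro j x hj
      have := j.2
      omega

open Classical in
-- The solutions in the gaps and the outgoing wave are glued; their closed domains are disjoint and
-- finite in number, so continuity and the equation are local questions. The index `i₀` only records
-- that there is a shell.
theorem exists_exteriorSolution (S : NestedShells N) (i₀ : Fin N) {k : ℂ}
    (hk : ∀ i, sinDiv k (S.rIn i - S.gapLow i) ≠ 0) (f : Fin N → Side → ℂ) :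
    ∃ w, S.IsExteriorSolution k f w := by
  have hN : 0 < N := i₀.pos
  set z : Fin N := ⟨0, hN⟩ with hz
  have hzle : ∀ j : Fin N, z ≤ j := fun j => Fin.le_def.mpr (Nat.zero_le _)
  choose g hrad hsm hhelm hcont hin hout using fun i => S.exists_gap_solution i (hk i) f
  have ha' : ((S.rOut z : ℝ) : ℂ) ≠ 0 := by exact_mod_cast (S.rOut_pos z).ne'
  -- The amplitude for which `c e^{ikr} / r` takes the prescribed value at the outermost sphere.
  set c := f z Side.outer * S.rOut z / Complex.exp (Complex.I * k * S.rOut z) with hc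
  set u : ℝ → ℂ := fun r => c * Complex.exp (Complex.I * k * r) with hu
  set w : Space3 → ℂ := fun x => if h : ∃ i, x ∈ S.closedGap i then g h.choose x
    else u ‖x‖ / ‖x‖ with hw
  have hwgap : ∀ i, ∀ x ∈ S.closedGap i, w x = g i x := by
    intro i x hx
    have h : ∃ i, x ∈ S.closedGap i := ⟨i, hx⟩
    rw [hw]
    simp only [dif_pos h, S.closedGap_index_unique h.choose_spec hx]
  have hwext : ∀ x ∈ S.closedExterior, w x = u ‖x‖ / ‖x‖ := by
    intro x hx
    have h : ¬ ∃ i, x ∈ S.closedGap i := fun ⟨i, hi⟩ => S.not_mem_closedGap hx i hi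
    rw [hw]
    simp only [dif_neg h]
  have hne : ∀ x ∈ S.closedExterior, x ≠ 0 := fun x hx =>
    norm_pos_iff.mp ((S.rOut_pos z).trans_le (hx z))
  have hloc : ∀ x ∈ S.host, (∃ i, x ∈ S.gap i ∧ w =ᶠ[𝓝 x] g i) ∨
      (x ≠ 0 ∧ w =ᶠ[𝓝 x] fun y => u ‖y‖ / ‖y‖) := by
    intro x hx
    rcases S.host_subset hx with ⟨i, hi⟩ | h
    · left
      refine ⟨i, hi, ?_⟩
      filter_upwards [(S.isOpen_gap i).mem_nhds hi] with y hy
      exact hwgap i y (S.gap_subset_closedGap i hy)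
    · right
      refine ⟨hne x fun j => (h j).le, ?_⟩
      filter_upwards [(isOpen_lt continuous_const continuous_norm).mem_nhds (h z)] with y hy
      exact hwext y fun j => (S.rOut_le (hzle j)).trans (le_of_lt hy)
  refine ⟨w, ?_, ?_, ?_, ?_, ?_, ?_⟩
  · intro x hx y hy hxy
    rw [closedHost_eq] at hx
    rcases hx with hx | hx
    · obtain ⟨i, hi⟩ := Set.mem_iUnion.mp hx
      have hi' : y ∈ S.closedGap i := ⟨hxy ▸ hi.1, fun j hj => hxy ▸ hi.2 j hj⟩
      rw [hwgap i x hi, hwgap i y hi', hrad i x y hxy]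
    · have hx' : y ∈ S.closedExterior := fun j => hxy ▸ hx j
      rw [hwext x hx, hwext y hx', hxy]
  · intro x hx
    refine ContDiffAt.contDiffWithinAt ?_
    rcases hloc x hx with ⟨i, hi, he⟩ | ⟨h0, he⟩
    · exact (hsm i x hi).congr_of_eventuallyEq he
    · exact (contDiffAt_radial (contDiff_cexp_mul c k) h0).congr_of_eventuallyEq he
  · intro x hx
    rcases hloc x hx with ⟨i, hi, he⟩ | ⟨h0, he⟩
    · rw [(InnerProductSpace.laplacian_congr_nhds he).self_of_nhds, he.self_of_nhds,
        hhelm i x hi]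
    · exact helmholtz_radial (contDiff_cexp_mul c k) (deriv_deriv_cexp_mul c k) h0 he
  · rw [closedHost_eq]
    refine ContinuousOn.union_of_isClosed ?_ ?_ (isClosed_iUnion_of_finite S.isClosed_closedGap)
      S.isClosed_closedExterior
    · exact (locallyFinite_of_finite _).continuousOn_iUnion S.isClosed_closedGap fun i =>
        (hcont i).congr (hwgap i)
    · refine ContinuousOn.congr (fun x hx => ?_) hwext
      exact (contDiffAt_radial (contDiff_cexp_mul c k)
        (hne x hx)).continuousAt.continuousWithinAt
  · rintro i (_ | _) x hx
    · change ‖x‖ = S.rOut i at hx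
      rcases Nat.eq_zero_or_pos (i : ℕ) with h0 | hpos
      · obtain rfl : i = z := Fin.ext h0
        rw [hwext x fun j => by rw [hx]; exact S.rOut_le (hzle j), hx]
        simp only [hu, hc]
        have := Complex.exp_ne_zero (Complex.I * k * S.rOut z)
        field_simp
      -- The outer sphere of a shell other than the outermost bounds the gap that belongs to the
      -- preceding index.
      · obtain ⟨j, hj⟩ : ∃ j : Fin N, (i : ℕ) = j + 1 := ⟨⟨i - 1, by omega⟩, by simp; omega⟩
        have hji : j < i := Fin.lt_def.mpr (by omega)
        have hmem : x ∈ S.closedGap j := by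
          refine ⟨hx ▸ (S.nested j i hji).le, fun l hl => hx ▸ S.rOut_le ?_⟩
          have := Fin.lt_def.mp hl
          exact Fin.le_def.mpr (by omega)
        rw [hwgap j x hmem, hout j i x hj hx]
    · change ‖x‖ = S.rIn i at hx
      have hmem : x ∈ S.closedGap i := S.mem_closedGap_of_norm
        (hx ▸ (S.gapLow_lt i).le) hx.le
      rw [hwgap i x hmem, hin i x hx]
  · refine ⟨c, fun x hx => ?_⟩
    rw [hwext x hx, mul_div_assoc]

end NestedShells

end

noncomputable section

namespace NestedShells

variable {N : ℕ}

/-! ### Uniqueness for the exterior Dirichlet problem and the Dirichlet-to-Neumann map -/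

/-- Along the ray through `unitVec 0`, `r w` solves the one-dimensional equation, whose solutions
are determined by their end values. The factor `sinDiv` stays on the left, so no condition on `k` is
needed here. -/
theorem IsExteriorSolution.gap_formula {S : NestedShells N} {k : ℂ} {f : Fin N → Side → ℂ}
    {w : Space3 → ℂ} (hw : S.IsExteriorSolution k f w) (i : Fin N) {r : ℝ}
    (hr : r ∈ Set.Icc (S.gapLow i) (S.rIn i)) :
    sinDiv k (S.rIn i - S.gapLow i) * (r * w (r • unitVec 0)) =
      gapProfile k (S.gapLow i) (S.rIn i) (S.gapLow i * gapVal f i)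
        (S.rIn i * f i Side.inner) r := by
  set u : ℝ → ℂ := fun r => r * w (r • unitVec 0) with hu
  have hnorm : ∀ r : ℝ, 0 ≤ r → ‖r • unitVec 0‖ = r := fun r hr => by
    rw [norm_smul_unitVec, abs_of_nonneg hr]
  have hmem : ∀ r ∈ Set.Icc (S.gapLow i) (S.rIn i), r • unitVec 0 ∈ S.closedHost := by
    intro r hr
    have h := hnorm r ((S.gapLow_nonneg i).trans hr.1)
    exact S.closedGap_subset_closedHost i
      (S.mem_closedGap_of_norm (by rw [h]; exact hr.1) (by rw [h]; exact hr.2))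
  have hmemgap : ∀ r ∈ Set.Ioo (S.gapLow i) (S.rIn i), r • unitVec 0 ∈ S.gap i := by
    intro r hr
    have h := hnorm r ((S.gapLow_nonneg i).trans hr.1.le)
    exact S.mem_gap_of_norm (by rw [h]; exact hr.1) (by rw [h]; exact hr.2)
  have hline : ContDiff ℝ 2 fun r : ℝ => r • unitVec 0 := contDiff_id.smul contDiff_const
  have hcont : ContinuousOn u (Set.Icc (S.gapLow i) (S.rIn i)) :=
    Complex.continuous_ofReal.continuousOn.mul
      (hw.continuousOn.comp hline.continuous.continuousOn hmem)
  have hC2 : ∀ r ∈ Set.Ioo (S.gapLow i) (S.rIn i), ContDiffAt ℝ 2 u r := by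
    intro r hr
    have h1 : ContDiffAt ℝ 2 w (r • unitVec 0) := hw.contDiffOn.contDiffAt
      (S.isOpen_host.mem_nhds (S.gap_subset_host i (hmemgap r hr)))
    exact Complex.ofRealCLM.contDiff.contDiffAt.mul (h1.comp r hline.contDiffAt)
  have hode : ∀ r ∈ Set.Ioo (S.gapLow i) (S.rIn i), deriv (deriv u) r = -(k ^ 2 * u r) := by
    intro r hr
    have hr0 : 0 < r := (S.gapLow_nonneg i).trans_lt hr.1
    have hr0' : (r : ℂ) ≠ 0 := by exact_mod_cast hr0.ne'
    have hn := hnorm r hr0.le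
    have hx : r • unitVec 0 ≠ 0 := norm_pos_iff.mp (by rw [hn]; exact hr0)
    have hloc : w =ᶠ[𝓝 (r • unitVec 0)] fun y => u ‖y‖ / ‖y‖ := by
      filter_upwards [(S.isOpen_gap i).mem_nhds (hmemgap r hr), isOpen_ne.mem_nhds hx]
        with y hy hy0
      have hy0' : (‖y‖ : ℂ) ≠ 0 := by exact_mod_cast norm_ne_zero_iff.mpr hy0
      have hny := hnorm ‖y‖ (norm_nonneg y)
      have hyc := S.closedGap_subset_closedHost i (S.gap_subset_closedGap i hy)
      have hyc' : ‖y‖ • unitVec 0 ∈ S.closedHost := fun j => by rw [hny]; exact hyc j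
      rw [hw.radial y hyc _ hyc' hny.symm, hu]
      field_simp
    have h1 := laplacian_radial hx (by rw [hn]; exact hC2 r hr) hloc
    have h2 := hw.helmholtz _ (S.gap_subset_host i (hmemgap r hr))
    rw [h1, hn, div_add' _ _ _ hr0', div_eq_zero_iff, or_iff_left hr0'] at h2
    rw [eq_neg_iff_add_eq_zero, ← h2, hu]
    ring
  have h := sinDiv_mul_eq_of_ode (S.gapLow_lt i) hcont hC2 hode hr
  have hub : u (S.rIn i) = S.rIn i * f i Side.inner := by
    rw [hu]
    simp only
    rw [hw.dirichlet i Side.inner (S.rIn i • unitVec 0) (hnorm _ (S.rIn_pos i).le)]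
  -- In the core the lower end is `0`, and the factor `r` makes `u` vanish there whatever `w 0` is.
  -- This plays the part of a boundary condition, and the default value `0` of `gapVal` agrees with
  -- it.
  have hua : u (S.gapLow i) = S.gapLow i * gapVal f i := by
    simp only [hu, gapLow, gapVal]
    split_ifs with hi
    · rw [hw.dirichlet ⟨i + 1, hi⟩ Side.outer (S.rOut ⟨i + 1, hi⟩ • unitVec 0)
        (hnorm _ (S.rOut_pos _).le)]
    · simp
  rw [hub, hua] at h
  exact h

theorem hasDerivAt_gapProfile_div (k : ℂ) (a b : ℝ) (A B L : ℂ) {r : ℝ} (hr : r ≠ 0) :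
    HasDerivAt (fun r : ℝ => gapProfile k a b A B r / (L * r))
      (((-(A * Complex.cos (k * (b - r : ℝ))) + B * Complex.cos (k * (r - a : ℝ))) * r
        - gapProfile k a b A B r) / (L * r ^ 2)) r := by
  have hr' : (r : ℂ) ≠ 0 := by exact_mod_cast hr
  rcases eq_or_ne L 0 with rfl | hL
  -- For `L = 0` both quotients are `0` by the convention on division.
  · simpa using hasDerivAt_const r (0 : ℂ)
  have h1 : HasDerivAt (fun r : ℝ => L * (r : ℂ)) L r := by
    simpa using ((hasDerivAt_id (r : ℂ)).const_mul L).comp_ofReal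
  refine ((hasDerivAt_gapProfile k a b A B r).div h1 (mul_ne_zero hL hr')).congr_deriv ?_
  field_simp

theorem IsExteriorSolution.ray_eq {S : NestedShells N} {k : ℂ} {f : Fin N → Side → ℂ}
    {w : Space3 → ℂ} (hw : S.IsExteriorSolution k f w) {i : Fin N}
    (hk : sinDiv k (S.rIn i - S.gapLow i) ≠ 0) {r : ℝ}
    (hr : r ∈ Set.Icc (S.gapLow i) (S.rIn i)) (hr0 : 0 < r) :
    w (r • unitVec 0) = gapProfile k (S.gapLow i) (S.rIn i) (S.gapLow i * gapVal f i)
        (S.rIn i * f i Side.inner) r / (sinDiv k (S.rIn i - S.gapLow i) * r) := by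
  have hr' : (r : ℂ) ≠ 0 := by exact_mod_cast hr0.ne'
  rw [eq_div_iff (mul_ne_zero hk hr'), ← hw.gap_formula i hr]
  ring

/-- The formula holds for every exterior solution, so the solution picked by choice in `dtn` does
not matter. The term `-1 / r` comes from differentiating the factor `1 / r`. -/
theorem IsExteriorSolution.normalDeriv_inner {S : NestedShells N} {k : ℂ}
    {f : Fin N → Side → ℂ} {w : Space3 → ℂ} (hw : S.IsExteriorSolution k f w) (i : Fin N)
    (hk : sinDiv k (S.rIn i - S.gapLow i) ≠ 0) :
    S.normalDeriv w i Side.inner =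
      (Complex.cos (k * (S.rIn i - S.gapLow i : ℝ)) / sinDiv k (S.rIn i - S.gapLow i)
        - 1 / S.rIn i) * f i Side.inner
      - S.gapLow i / (S.rIn i * sinDiv k (S.rIn i - S.gapLow i)) * gapVal f i := by
  have hb := S.rIn_pos i
  have hb' : ((S.rIn i : ℝ) : ℂ) ≠ 0 := by exact_mod_cast hb.ne'
  have hd := (hasDerivAt_gapProfile_div k (S.gapLow i) (S.rIn i) (S.gapLow i * gapVal f i)
    (S.rIn i * f i Side.inner) (sinDiv k (S.rIn i - S.gapLow i)) hb.ne').hasDerivWithinAt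
    (s := Set.Iic (S.rIn i))
  have he : (fun r : ℝ => w (r • unitVec 0)) =ᶠ[𝓝[Set.Iic (S.rIn i)] (S.rIn i)]
      fun r : ℝ => gapProfile k (S.gapLow i) (S.rIn i) (S.gapLow i * gapVal f i)
        (S.rIn i * f i Side.inner) r / (sinDiv k (S.rIn i - S.gapLow i) * r) := by
    filter_upwards [self_mem_nhdsWithin, nhdsWithin_le_nhds (lt_mem_nhds (S.gapLow_lt i))]
      with r h1 h2
    exact hw.ray_eq hk ⟨h2.le, h1⟩ ((S.gapLow_nonneg i).trans_lt h2)
  have h := (hd.congr_of_eventuallyEq he (he.self_of_nhdsWithin Set.self_mem_Iic)).derivWithin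
    (uniqueDiffWithinAt_Iic _)
  rw [normalDeriv, h]
  simp only [gapProfile, sub_self, Complex.ofReal_zero, mul_zero, Complex.cos_zero,
    sinDiv_zero_right, mul_one]
  field_simp
  ring

theorem IsExteriorSolution.normalDeriv_outer {S : NestedShells N} {k : ℂ}
    {f : Fin N → Side → ℂ} {w : Space3 → ℂ} (hw : S.IsExteriorSolution k f w) {i j : Fin N}
    (hij : (j : ℕ) = i + 1) (hk : sinDiv k (S.rIn i - S.gapLow i) ≠ 0) :
    S.normalDeriv w j Side.outer =
      -(Complex.cos (k * (S.rIn i - S.gapLow i : ℝ)) / sinDiv k (S.rIn i - S.gapLow i)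
        + 1 / S.rOut j) * f j Side.outer
      + S.rIn i / (S.rOut j * sinDiv k (S.rIn i - S.gapLow i)) * f i Side.inner := by
  have hN : (i : ℕ) + 1 < N := hij ▸ j.2
  obtain rfl : j = ⟨i + 1, hN⟩ := Fin.ext hij
  set j : Fin N := ⟨i + 1, hN⟩
  have hlow : S.gapLow i = S.rOut j := by rw [gapLow, dif_pos hN]
  have hval : gapVal f i = f j Side.outer := by rw [gapVal, dif_pos hN]
  have ha := S.rOut_pos j
  have ha' : ((S.rOut j : ℝ) : ℂ) ≠ 0 := by exact_mod_cast ha.ne'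
  have hlt := S.gapLow_lt i
  have hray : ∀ r ∈ Set.Icc (S.gapLow i) (S.rIn i), 0 < r → _ := fun r hr hr0 =>
    hw.ray_eq hk hr hr0
  simp only [hlow, hval] at hray hk hlt ⊢
  have hd := (hasDerivAt_gapProfile_div k (S.rOut j) (S.rIn i) (S.rOut j * f j Side.outer)
    (S.rIn i * f i Side.inner) (sinDiv k (S.rIn i - S.rOut j)) ha.ne').hasDerivWithinAt
    (s := Set.Ici (S.rOut j))
  have he : (fun r : ℝ => w (r • unitVec 0)) =ᶠ[𝓝[Set.Ici (S.rOut j)] (S.rOut j)]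
      fun r : ℝ => gapProfile k (S.rOut j) (S.rIn i) (S.rOut j * f j Side.outer)
        (S.rIn i * f i Side.inner) r / (sinDiv k (S.rIn i - S.rOut j) * r) := by
    filter_upwards [self_mem_nhdsWithin, nhdsWithin_le_nhds (gt_mem_nhds hlt)] with r h1 h2
    exact hray r ⟨h1, h2.le⟩ (ha.trans_le h1)
  have h := (hd.congr_of_eventuallyEq he (he.self_of_nhdsWithin Set.self_mem_Ici)).derivWithin
    (uniqueDiffWithinAt_Ici _)
  rw [normalDeriv, h]
  simp only [gapProfile, sub_self, Complex.ofReal_zero, mul_zero, Complex.cos_zero,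
    sinDiv_zero_right, mul_one]
  field_simp
  ring

theorem IsExteriorSolution.normalDeriv_outermost {S : NestedShells N} {k : ℂ}
    {f : Fin N → Side → ℂ} {w : Space3 → ℂ} (hw : S.IsExteriorSolution k f w) {i : Fin N}
    (hi : (i : ℕ) = 0) :
    S.normalDeriv w i Side.outer = (Complex.I * k - 1 / S.rOut i) * f i Side.outer := by
  have ha := S.rOut_pos i
  have ha' : ((S.rOut i : ℝ) : ℂ) ≠ 0 := by exact_mod_cast ha.ne'
  obtain ⟨c, hc⟩ := hw.outgoing
  have hray : ∀ r, S.rOut i ≤ r →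
      w (r • unitVec 0) = c * Complex.exp (Complex.I * k * r) / r := by
    intro r hr
    have hn : ‖r • unitVec 0‖ = r := by
      rw [norm_smul_unitVec, abs_of_nonneg (ha.le.trans hr)]
    rw [hc _ fun j => ?_, hn, mul_div_assoc]
    rw [hn]
    exact (S.rOut_le (Fin.le_def.mpr (by omega))).trans hr
  have hd : HasDerivAt (fun r : ℝ => c * Complex.exp (Complex.I * k * r) / r)
      ((c * (Complex.I * k) * Complex.exp (Complex.I * k * S.rOut i) * S.rOut i
        - c * Complex.exp (Complex.I * k * S.rOut i) * 1) / (S.rOut i : ℂ) ^ 2) (S.rOut i) :=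
    (hasDerivAt_cexp_mul c k (S.rOut i)).div ((hasDerivAt_id (S.rOut i : ℂ)).comp_ofReal) ha'
  have h := (hd.hasDerivWithinAt.congr (s := Set.Ici (S.rOut i)) hray
    (hray _ le_rfl)).derivWithin (uniqueDiffWithinAt_Ici _)
  have hf : c * Complex.exp (Complex.I * k * S.rOut i) / S.rOut i = f i Side.outer := by
    rw [← hray _ le_rfl]
    exact hw.dirichlet i Side.outer _ (by rw [norm_smul_unitVec, abs_of_pos ha]; rfl)
  rw [normalDeriv, h, ← hf]
  field_simp

/-- For `k` near `0` the Dirichlet-to-Neumann map is linear and couples only the two spheres that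
bound a component of the host medium, with coefficients continuous in `k`. -/
theorem exists_dtn_coefficients (S : NestedShells N) (i : Fin N) (s : Side) :
    ∃ (j : Fin N) (t : Side) (α β : ℂ → ℂ), ContinuousAt α 0 ∧ ContinuousAt β 0 ∧
      ∀ᶠ k in 𝓝 (0 : ℂ), ∀ f : Fin N → Side → ℂ,
        S.dtn k f i s = α k * f i s + β k * f j t := by
  have hne : ∀ i, S.rIn i - S.gapLow i ≠ 0 := fun i => (sub_pos.mpr (S.gapLow_lt i)).ne'
  have hk : ∀ᶠ k in 𝓝 (0 : ℂ), ∀ i, sinDiv k (S.rIn i - S.gapLow i) ≠ 0 :=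
    eventually_all.mpr fun i => eventually_sinDiv_ne_zero (hne i)
  have hdtn : ∀ k, (∀ i, sinDiv k (S.rIn i - S.gapLow i) ≠ 0) → ∀ f : Fin N → Side → ℂ,
      ∃ w, S.IsExteriorSolution k f w ∧ S.dtn k f = S.normalDeriv w := by
    intro k hk f
    have h := S.exists_exteriorSolution i hk f
    exact ⟨h.choose, h.choose_spec, by rw [dtn, dif_pos h]⟩
  have hsc : ∀ i, ContinuousAt (fun k => sinDiv k (S.rIn i - S.gapLow i)) 0 := fun i =>
    (continuous_sinDiv_left _).continuousAt
  have hs0 : ∀ i, sinDiv 0 (S.rIn i - S.gapLow i) ≠ 0 := fun i => by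
    rw [sinDiv_zero_left]
    exact_mod_cast hne i
  have hcc : ∀ L : ℝ, ContinuousAt (fun k : ℂ => Complex.cos (k * L)) 0 := fun L =>
    (Complex.continuous_cos.comp (continuous_id.mul continuous_const)).continuousAt
  have hin0 : ∀ i, ((S.rIn i : ℝ) : ℂ) ≠ 0 := fun i => by exact_mod_cast (S.rIn_pos i).ne'
  have hout0 : ∀ i, ((S.rOut i : ℝ) : ℂ) ≠ 0 := fun i => by exact_mod_cast (S.rOut_pos i).ne'
  cases s with
  | inner =>
    have hα : ContinuousAt (fun k => Complex.cos (k * (S.rIn i - S.gapLow i : ℝ)) /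
        sinDiv k (S.rIn i - S.gapLow i) - 1 / S.rIn i) 0 :=
      ((hcc _).div (hsc i) (hs0 i)).sub continuousAt_const
    by_cases h : (i : ℕ) + 1 < N
    · refine ⟨⟨i + 1, h⟩, Side.outer, _,
        fun k => -(S.gapLow i / (S.rIn i * sinDiv k (S.rIn i - S.gapLow i))), hα,
        (continuousAt_const.div (continuousAt_const.mul (hsc i))
          (mul_ne_zero (hin0 i) (hs0 i))).neg, ?_⟩
      filter_upwards [hk] with k hk f
      obtain ⟨w, hw, he⟩ := hdtn k hk f
      rw [he, hw.normalDeriv_inner i (hk i), gapVal, dif_pos h]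
      ring
    -- The core is bounded by a single sphere: the coupling coefficient is `0` and its partner
    -- sphere is a dummy. The same happens below for the outermost sphere.
    · refine ⟨i, Side.inner, _, fun _ => 0, hα, continuousAt_const, ?_⟩
      filter_upwards [hk] with k hk f
      obtain ⟨w, hw, he⟩ := hdtn k hk f
      rw [he, hw.normalDeriv_inner i (hk i), gapVal, dif_neg h]
      ring
  | outer =>
    rcases Nat.eq_zero_or_pos (i : ℕ) with h0 | hpos
    · refine ⟨i, Side.outer, fun k => Complex.I * k - 1 / S.rOut i, fun _ => 0, ?_,
        continuousAt_const, ?_⟩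
      · exact ((continuous_const.mul continuous_id).sub continuous_const).continuousAt
      · filter_upwards [hk] with k hk f
        obtain ⟨w, hw, he⟩ := hdtn k hk f
        rw [he, hw.normalDeriv_outermost h0]
        ring
    · obtain ⟨j, hj⟩ : ∃ j : Fin N, (i : ℕ) = j + 1 := ⟨⟨i - 1, by omega⟩, by simp; omega⟩
      refine ⟨j, Side.inner, fun k => -(Complex.cos (k * (S.rIn j - S.gapLow j : ℝ)) /
        sinDiv k (S.rIn j - S.gapLow j) + 1 / S.rOut i),
        fun k => S.rIn j / (S.rOut i * sinDiv k (S.rIn j - S.gapLow j)),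
        (((hcc _).div (hsc j) (hs0 j)).add continuousAt_const).neg,
        continuousAt_const.div (continuousAt_const.mul (hsc j))
          (mul_ne_zero (hout0 i) (hs0 j)), ?_⟩
      filter_upwards [hk] with k hk f
      obtain ⟨w, hw, he⟩ := hdtn k hk f
      rw [he, hw.normalDeriv_outer hj (hk j)]

end NestedShells

end

noncomputable section

/-! ### Weakly differentiable functions of one variable -/

theorem IsCompact.exists_subset_Icc {K : Set ℝ} (hK : IsCompact K) {a b : ℝ}
    (h : K ⊆ Set.Ioo a b) : ∃ ε > 0, K ⊆ Set.Icc (a + ε) (b - ε) := by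
  obtain ⟨ε, hε, hle⟩ := hK.exists_forall_le' (f := fun x => min (x - a) (b - x)) (a := 0)
    (by fun_prop) (fun x hx => lt_min (sub_pos.mpr (h hx).1) (sub_pos.mpr (h hx).2))
  refine ⟨ε, hε, fun x hx => ?_⟩
  have := le_min_iff.mp (hle x hx)
  constructor <;> linarith [this.1, this.2]

/-- A smooth function with compact support in `(a, b)` and vanishing integral is the derivative of
such a function. -/
theorem exists_primitive_of_integral_eq_zero {a b : ℝ} {η : ℝ → ℝ}
    (hη : ContDiff ℝ ((⊤ : ℕ∞) : WithTop ℕ∞) η) (hc : HasCompactSupport η)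
    (hs : tsupport η ⊆ Set.Ioo a b) (h0 : ∫ x, η x = 0) :
    ∃ φ : ℝ → ℝ, ContDiff ℝ ((⊤ : ℕ∞) : WithTop ℕ∞) φ ∧ HasCompactSupport φ ∧
      tsupport φ ⊆ Set.Ioo a b ∧ deriv φ = η := by
  obtain ⟨ε, hε, hK⟩ := hc.isCompact.exists_subset_Icc hs
  have hsupp : ∀ x, x ∉ Set.Icc (a + ε) (b - ε) → η x = 0 := fun x hx =>
    image_eq_zero_of_notMem_tsupport fun h => hx (hK h)
  have hint : Integrable η := hη.continuous.integrable_of_hasCompactSupport hc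
  set φ : ℝ → ℝ := fun x => ∫ t in a..x, η t with hφ
  have hd : ∀ x, HasDerivAt φ (η x) x := fun x =>
    intervalIntegral.integral_hasDerivAt_right (hη.continuous.intervalIntegrable _ _)
      hη.continuous.stronglyMeasurable.stronglyMeasurableAtFilter hη.continuous.continuousAt
  have hderiv : deriv φ = η := funext fun x => (hd x).deriv
  -- Left of the support nothing has been integrated yet; right of it the primitive equals the total
  -- integral, which is zero.
  have hzero : ∀ x, x ∉ Set.Icc (a + ε) (b - ε) → φ x = 0 := by
    intro x hx
    have h1 : x < a + ε ∨ b - ε < x := by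
      by_contra hcon
      push Not at hcon
      exact hx hcon
    rcases h1 with h1 | h1
    · refine (intervalIntegral.integral_congr fun t ht => hsupp t fun ht' => ?_).trans
        intervalIntegral.integral_zero
      have h2 := ht.2
      rcases max_cases a x with h | h <;> rw [h.1] at h2 <;> linarith [ht'.1]
    · rcases le_total a x with hax | hax
      · rw [hφ]
        simp only
        rw [intervalIntegral.integral_of_le hax,
          setIntegral_eq_integral_of_forall_compl_eq_zero, h0]
        intro t ht
        refine hsupp t fun ht' => ht ⟨by linarith [ht'.1], by linarith [ht'.2]⟩
      · refine (intervalIntegral.integral_congr fun t ht => hsupp t fun ht' => ?_).trans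
          intervalIntegral.integral_zero
        have h2 := ht.2
        rcases max_cases a x with h | h <;> rw [h.1] at h2 <;> linarith [ht'.1]
  have hcs : tsupport φ ⊆ Set.Icc (a + ε) (b - ε) :=
    closure_minimal (fun x hx => by_contra fun h => hx (hzero x h)) isClosed_Icc
  refine ⟨φ, ?_, HasCompactSupport.of_support_subset_isCompact isCompact_Icc
    ((subset_tsupport φ).trans hcs), hcs.trans fun x hx => ⟨by linarith [hx.1], by linarith [hx.2]⟩,
    hderiv⟩
  refine contDiff_infty_iff_deriv.mpr ⟨fun x => (hd x).differentiableAt, ?_⟩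
  rw [hderiv]
  exact hη

/-- The du Bois-Reymond lemma. With a fixed bump `χ` of integral one, `g - (∫ g) χ` has integral
zero and is therefore a derivative of a test function. So `D` minus the constant `∫ χ D` is
orthogonal to every test function `g`. -/
theorem ae_eq_const_of_integral_deriv_smul_eq_zero {a b : ℝ} (hab : a < b) {D : ℝ → ℂ}
    (hD : IntegrableOn D (Set.Ioo a b))
    (h : ∀ φ : ℝ → ℝ, ContDiff ℝ ((⊤ : ℕ∞) : WithTop ℕ∞) φ → HasCompactSupport φ →
      tsupport φ ⊆ Set.Ioo a b → ∫ r in Set.Ioo a b, deriv φ r • D r = 0) :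
    ∃ c : ℂ, ∀ᵐ r ∂volume.restrict (Set.Ioo a b), D r = c := by
  obtain ⟨χ, hχ, hχc, hχs, hχ1⟩ : ∃ χ : ℝ → ℝ, ContDiff ℝ ((⊤ : ℕ∞) : WithTop ℕ∞) χ ∧
      HasCompactSupport χ ∧ tsupport χ ⊆ Set.Ioo a b ∧ ∫ x, χ x = 1 := by
    let B : ContDiffBump ((a + b) / 2) := ⟨(b - a) / 8, (b - a) / 4, by linarith, by linarith⟩
    refine ⟨B.normed volume, B.contDiff_normed, B.hasCompactSupport_normed, ?_, B.integral_normed⟩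
    rw [B.tsupport_normed_eq, Real.closedBall_eq_Icc]
    intro x hx
    simp only [B] at hx
    constructor <;> linarith [hx.1, hx.2]
  set c := ∫ r in Set.Ioo a b, χ r • D r with hc
  refine ⟨c, ?_⟩
  have hint : ∀ g : ℝ → ℝ, Continuous g → HasCompactSupport g →
      IntegrableOn (fun r => g r • D r) (Set.Ioo a b) := fun g hg hgc => by
    obtain ⟨C, hC⟩ := hgc.exists_bound_of_continuous hg
    exact hD.bdd_smul C hg.aestronglyMeasurable (ae_of_all _ hC)
  have key : ∀ᵐ r, r ∈ Set.Ioo a b → D r - c = 0 := by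
    refine isOpen_Ioo.ae_eq_zero_of_integral_contDiff_smul_eq_zero
      (hD.sub (integrableOn_const (by simp))).locallyIntegrableOn fun g hg hgc hgs => ?_
    have h0 : ∀ r, r ∉ Set.Ioo a b → g r = 0 := fun r hr =>
      image_eq_zero_of_notMem_tsupport fun h => hr (hgs h)
    rw [← setIntegral_eq_integral_of_forall_compl_eq_zero (s := Set.Ioo a b)
      (fun r hr => by rw [h0 r hr, zero_smul])]
    set m := ∫ x, g x with hm
    have hη : ContDiff ℝ ((⊤ : ℕ∞) : WithTop ℕ∞) fun r => g r - m * χ r :=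
      hg.sub (contDiff_const.mul hχ)
    have hηc : HasCompactSupport fun r => g r - m * χ r := hgc.sub hχc.mul_left
    have hηs : tsupport (fun r => g r - m * χ r) ⊆ Set.Ioo a b :=
      (tsupport_sub _ _).trans (Set.union_subset hgs ((closure_mono
        (Function.support_mul_subset_right _ _)).trans hχs))
    have hη0 : ∫ r, (g r - m * χ r) = 0 := by
      rw [integral_sub (hg.continuous.integrable_of_hasCompactSupport hgc)
        ((hχ.continuous.integrable_of_hasCompactSupport hχc).const_mul m),
        integral_const_mul, hχ1, mul_one, sub_self]
    obtain ⟨φ, h1, h2, h3, h4⟩ := exists_primitive_of_integral_eq_zero hη hηc hηs hη0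
    have h5 := h φ h1 h2 h3
    rw [h4] at h5
    simp only [sub_smul, mul_smul] at h5
    have h6 : IntegrableOn (fun r => m • χ r • D r) (Set.Ioo a b) :=
      (hint χ hχ.continuous hχc).smul m
    rw [integral_sub (hint g hg.continuous hgc) h6, integral_smul, ← hc] at h5
    simp only [smul_sub]
    rw [integral_sub (hint g hg.continuous hgc)
      ((hg.continuous.integrable_of_hasCompactSupport hgc).integrableOn.smul_const c),
      integral_smul_const, setIntegral_eq_integral_of_forall_compl_eq_zero h0]
    exact h5
  rw [ae_restrict_iff' measurableSet_Ioo]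
  filter_upwards [key] with r hr hr'
  exact sub_eq_zero.mp (hr hr')

/-- Fubini on the triangle `t < r`: the inner integral of `φ'` over `(t, b)` is `-φ t`, as `φ b =
0`. Thus integration by parts needs no differentiability of the primitive. -/
theorem integral_deriv_smul_primitive {a b : ℝ} {Γ : ℝ → ℂ}
    (hΓ : IntegrableOn Γ (Set.Ioo a b)) {φ : ℝ → ℝ}
    (hφ : ContDiff ℝ ((⊤ : ℕ∞) : WithTop ℕ∞) φ) (hs : tsupport φ ⊆ Set.Ioo a b) :
    ∫ r in Set.Ioo a b, deriv φ r • ∫ t in a..r, Γ t = -∫ r in Set.Ioo a b, φ r • Γ r := by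
  have hdc : Continuous (deriv φ) := hφ.continuous_deriv (by simp)
  have hb0 : φ b = 0 := image_eq_zero_of_notMem_tsupport fun h => lt_irrefl _ (hs h).2
  have hdi : IntegrableOn (deriv φ) (Set.Ioo a b) :=
    (hdc.integrableOn_Icc (a := a) (b := b)).mono_set Set.Ioo_subset_Icc_self
  have hprod : Integrable (fun p : ℝ × ℝ => deriv φ p.1 • Γ p.2)
      ((volume.restrict (Set.Ioo a b)).prod (volume.restrict (Set.Ioo a b))) :=
    Integrable.smul_prod hdi hΓ
  have hmeas : MeasurableSet {p : ℝ × ℝ | p.2 < p.1} := measurableSet_lt measurable_snd measurable_fst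
  have hind := hprod.indicator hmeas
  have hswap := integral_integral_swap (f := fun r t =>
    {p : ℝ × ℝ | p.2 < p.1}.indicator (fun p : ℝ × ℝ => deriv φ p.1 • Γ p.2) (r, t)) hind
  have hleft : ∀ r ∈ Set.Ioo a b, ∫ t in Set.Ioo a b,
      {p : ℝ × ℝ | p.2 < p.1}.indicator (fun p : ℝ × ℝ => deriv φ p.1 • Γ p.2) (r, t) =
      deriv φ r • ∫ t in a..r, Γ t := by
    intro r hr
    have h1 : (fun t => {p : ℝ × ℝ | p.2 < p.1}.indicator
        (fun p : ℝ × ℝ => deriv φ p.1 • Γ p.2) (r, t)) =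
        (Set.Iio r).indicator fun t => deriv φ r • Γ t := by
      funext t
      simp [Set.indicator]
    rw [h1, setIntegral_indicator measurableSet_Iio, integral_smul,
      intervalIntegral.integral_of_le hr.1.le, integral_Ioc_eq_integral_Ioo]
    congr 3
    ext t
    constructor
    · exact fun h => ⟨h.1.1, h.2⟩
    · exact fun h => ⟨⟨h.1, h.2.trans hr.2⟩, h.2⟩
  have hright : ∀ t ∈ Set.Ioo a b, ∫ r in Set.Ioo a b,
      {p : ℝ × ℝ | p.2 < p.1}.indicator (fun p : ℝ × ℝ => deriv φ p.1 • Γ p.2) (r, t) =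
      -(φ t • Γ t) := by
    intro t ht
    have h1 : (fun r => {p : ℝ × ℝ | p.2 < p.1}.indicator
        (fun p : ℝ × ℝ => deriv φ p.1 • Γ p.2) (r, t)) =
        (Set.Ioi t).indicator fun r => deriv φ r • Γ t := by
      funext r
      simp [Set.indicator]
    have h2 : Set.Ioo a b ∩ Set.Ioi t = Set.Ioo t b := by
      ext r
      constructor
      · exact fun h => ⟨h.2, h.1.2⟩
      · exact fun h => ⟨⟨ht.1.trans h.1, h.2⟩, h.1⟩
    rw [h1, setIntegral_indicator measurableSet_Ioi, h2, integral_smul_const,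
      ← integral_Ioc_eq_integral_Ioo, ← intervalIntegral.integral_of_le ht.2.le,
      intervalIntegral.integral_deriv_eq_sub (fun x _ => (hφ.differentiable (by simp)) x)
        (hdc.intervalIntegrable _ _), hb0, zero_sub, neg_smul]
  rw [setIntegral_congr_fun measurableSet_Ioo hleft,
    setIntegral_congr_fun measurableSet_Ioo hright, integral_neg] at hswap
  exact hswap

/-- A function with integrable weak derivative `Γ` on `(a, b)` is a primitive of `Γ`. -/
theorem ae_eq_primitive_of_weakDeriv {a b : ℝ} (hab : a < b) {M Γ : ℝ → ℂ}
    (hM : IntegrableOn M (Set.Ioo a b)) (hΓ : IntegrableOn Γ (Set.Ioo a b))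
    (h : ∀ φ : ℝ → ℝ, ContDiff ℝ ((⊤ : ℕ∞) : WithTop ℕ∞) φ → HasCompactSupport φ →
      tsupport φ ⊆ Set.Ioo a b →
      ∫ r in Set.Ioo a b, deriv φ r • M r = -∫ r in Set.Ioo a b, φ r • Γ r) :
    ∃ c : ℂ, ∀ᵐ r ∂volume.restrict (Set.Ioo a b), M r = c + ∫ t in a..r, Γ t := by
  have hcont : ContinuousOn (fun r => ∫ t in a..r, Γ t) (Set.Icc a b) :=
    intervalIntegral.continuousOn_primitive_interval
      (by rwa [Set.uIcc_of_le hab.le, integrableOn_Icc_iff_integrableOn_Ioo])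
      |>.mono (by rw [Set.uIcc_of_le hab.le])
  have hN : IntegrableOn (fun r => ∫ t in a..r, Γ t) (Set.Ioo a b) :=
    (hcont.integrableOn_Icc).mono_set Set.Ioo_subset_Icc_self
  obtain ⟨c, hc⟩ := ae_eq_const_of_integral_deriv_smul_eq_zero hab (hM.sub hN)
    fun φ h1 h2 h3 => by
      obtain ⟨C, hC⟩ := h2.deriv.exists_bound_of_continuous (h1.continuous_deriv (by simp))
      have hdm : AEStronglyMeasurable (deriv φ) (volume.restrict (Set.Ioo a b)) :=
        (h1.continuous_deriv (by simp)).aestronglyMeasurable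
      have e1 : IntegrableOn (fun r => deriv φ r • M r) (Set.Ioo a b) :=
        hM.bdd_smul C hdm (ae_of_all _ hC)
      have e2 : IntegrableOn (fun r => deriv φ r • ∫ t in a..r, Γ t) (Set.Ioo a b) :=
        hN.bdd_smul C hdm (ae_of_all _ hC)
      simp only [Pi.sub_apply, smul_sub]
      rw [integral_sub e1 e2,
        h φ h1 h2 h3, integral_deriv_smul_primitive hΓ h1 h3, sub_self]
  refine ⟨c, ?_⟩
  filter_upwards [hc] with r hr
  rw [← hr]
  simp

end

noncomputable section

open scoped Quaternion

/-! ### Rotations of `ℝ³` by unit quaternions -/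

/-- The compact group of unit quaternions. -/
abbrev UnitQuaternion : Type := Metric.sphere (0 : ℍ[ℝ]) 1

instance : MeasurableSpace UnitQuaternion := borel UnitQuaternion

instance : BorelSpace UnitQuaternion := ⟨rfl⟩

instance : CompactSpace UnitQuaternion := isCompact_iff_compactSpace.mp (isCompact_sphere 0 1)

/-- A vector as a purely imaginary quaternion. -/
def toQuat : Space3 →ₗ[ℝ] ℍ[ℝ] where
  toFun x := ⟨0, x 0, x 1, x 2⟩
  map_add' _ _ := Quaternion.ext _ _ (add_zero (0 : ℝ)).symm rfl rfl rfl
  map_smul' c _ := Quaternion.ext _ _ (mul_zero c).symm rfl rfl rfl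

/-- The imaginary part of a quaternion, as a vector. -/
def quatVec : ℍ[ℝ] →ₗ[ℝ] Space3 where
  toFun q := !₂[q.imI, q.imJ, q.imK]
  map_add' p q := by ext i; fin_cases i <;> simp
  map_smul' c q := by ext i; fin_cases i <;> simp

@[simp] theorem toQuat_re (x : Space3) : (toQuat x).re = 0 := rfl
@[simp] theorem toQuat_imI (x : Space3) : (toQuat x).imI = x 0 := rfl
@[simp] theorem toQuat_imJ (x : Space3) : (toQuat x).imJ = x 1 := rfl
@[simp] theorem toQuat_imK (x : Space3) : (toQuat x).imK = x 2 := rfl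
@[simp] theorem quatVec_zero (q : ℍ[ℝ]) : quatVec q 0 = q.imI := rfl
@[simp] theorem quatVec_one (q : ℍ[ℝ]) : quatVec q 1 = q.imJ := rfl
@[simp] theorem quatVec_two (q : ℍ[ℝ]) : quatVec q 2 = q.imK := rfl

theorem toQuat_quatVec {q : ℍ[ℝ]} (hq : q.re = 0) : toQuat (quatVec q) = q := by
  ext <;> simp [hq]

theorem quatVec_toQuat (x : Space3) : quatVec (toQuat x) = x := by
  ext i; fin_cases i <;> simp

theorem norm_toQuat (x : Space3) : ‖toQuat x‖ = ‖x‖ := by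
  have h : ‖toQuat x‖ ^ 2 = ‖x‖ ^ 2 := by
    rw [pow_two, ← Quaternion.normSq_eq_norm_mul_self, Quaternion.normSq_def',
      EuclideanSpace.real_norm_sq_eq, Fin.sum_univ_three]
    simp
  exact (pow_left_inj₀ (norm_nonneg _) (norm_nonneg _) two_ne_zero).mp h

theorem star_toQuat (x : Space3) : star (toQuat x) = -toQuat x := by
  ext <;> simp

theorem re_eq_zero_of_star_eq_neg {q : ℍ[ℝ]} (h : star q = -q) : q.re = 0 := by
  have := congrArg QuaternionAlgebra.re h
  simp at this
  linarith

theorem norm_star_quat (q : ℍ[ℝ]) : ‖star q‖ = ‖q‖ := norm_star q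

/-- The rotation `x ↦ q x q⁻¹` of `ℝ³`, as a linear map in `x`. -/
def rotLin (q : ℍ[ℝ]) : Space3 →ₗ[ℝ] Space3 where
  toFun x := quatVec (q * toQuat x * star q)
  map_add' x y := by simp only [map_add, mul_add, add_mul]
  map_smul' c x := by simp only [map_smul, mul_smul_comm, smul_mul_assoc, RingHom.id_apply]

theorem re_conj_toQuat (q : ℍ[ℝ]) (x : Space3) : (q * toQuat x * star q).re = 0 := by
  refine re_eq_zero_of_star_eq_neg ?_
  rw [StarMul.star_mul, StarMul.star_mul, star_star, star_toQuat]
  simp [mul_assoc]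

theorem toQuat_rotLin (q : ℍ[ℝ]) (x : Space3) : toQuat (rotLin q x) = q * toQuat x * star q :=
  toQuat_quatVec (re_conj_toQuat q x)

theorem rotLin_mul (p q : ℍ[ℝ]) (x : Space3) : rotLin (p * q) x = rotLin p (rotLin q x) := by
  have h : toQuat (rotLin (p * q) x) = toQuat (rotLin p (rotLin q x)) := by
    rw [toQuat_rotLin, toQuat_rotLin, toQuat_rotLin, StarMul.star_mul]
    simp only [mul_assoc]
  rw [← quatVec_toQuat (rotLin (p * q) x), h, quatVec_toQuat]

theorem rotLin_one (x : Space3) : rotLin 1 x = x := by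
  have h : toQuat (rotLin 1 x) = toQuat x := by rw [toQuat_rotLin]; simp
  rw [← quatVec_toQuat (rotLin 1 x), h, quatVec_toQuat]

theorem norm_rotLin {q : ℍ[ℝ]} (hq : ‖q‖ = 1) (x : Space3) : ‖rotLin q x‖ = ‖x‖ := by
  rw [← norm_toQuat, toQuat_rotLin, norm_mul, norm_mul, norm_star_quat, hq, norm_toQuat]
  ring

/-- The rotation of `ℝ³` by a unit quaternion. -/
def rot (q : UnitQuaternion) : Space3 ≃ₗᵢ[ℝ] Space3 :=
  (⟨rotLin q, norm_rotLin (by simp)⟩ : Space3 →ₗᵢ[ℝ] Space3).toLinearIsometryEquiv rfl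

theorem rot_apply (q : UnitQuaternion) (x : Space3) : rot q x = rotLin q x := rfl

theorem rot_mul (p q : UnitQuaternion) (x : Space3) : rot (p * q) x = rot p (rot q x) :=
  rotLin_mul _ _ x

theorem rot_one (x : Space3) : rot 1 x = x := rotLin_one x

theorem rot_inv_rot (q : UnitQuaternion) (x : Space3) : rot q⁻¹ (rot q x) = x := by
  rw [← rot_mul, inv_mul_cancel, rot_one]

theorem continuous_toQuat : Continuous toQuat := toQuat.continuous_of_finiteDimensional

theorem continuous_quatVec : Continuous quatVec := quatVec.continuous_of_finiteDimensional

theorem continuous_rot : Continuous fun p : UnitQuaternion × Space3 => rot p.1 p.2 := by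
  have h : (fun p : UnitQuaternion × Space3 => rot p.1 p.2) =
      fun p => quatVec ((p.1 : ℍ[ℝ]) * toQuat p.2 * star (p.1 : ℍ[ℝ])) := rfl
  rw [h]
  have h1 : Continuous fun p : UnitQuaternion × Space3 => (p.1 : ℍ[ℝ]) :=
    continuous_subtype_val.comp continuous_fst
  exact continuous_quatVec.comp ((h1.mul (continuous_toQuat.comp continuous_snd)).mul
    (continuous_star.comp h1))

theorem toQuat_mul_self (x : Space3) : toQuat x * toQuat x = -((‖x‖ ^ 2 : ℝ) : ℍ[ℝ]) := by
  have h := EuclideanSpace.real_norm_sq_eq x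
  rw [Fin.sum_univ_three] at h
  refine Quaternion.ext _ _ ?_ ?_ ?_ ?_ <;>
    simp only [Quaternion.re_mul, Quaternion.imI_mul, Quaternion.imJ_mul, Quaternion.imK_mul,
      toQuat_re, toQuat_imI, toQuat_imJ, toQuat_imK, Quaternion.re_neg, Quaternion.imI_neg,
      Quaternion.imJ_neg, Quaternion.imK_neg, Quaternion.re_coe, Quaternion.imI_coe,
      Quaternion.imJ_coe, Quaternion.imK_coe, h] <;> ring

/-- Since `x² = y² = -|x|²` as quaternions, `s = |x|² - y x` satisfies `s x = y s`. It vanishes only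
for `y = -x`, so otherwise its normalisation conjugates `x` into `y`. -/
theorem exists_rot_eq_of_ne_neg {x y : Space3} (hxy : ‖x‖ = ‖y‖) (hne : y ≠ -x) (hx : x ≠ 0) :
    ∃ q, rot q x = y := by
  set s : ℍ[ℝ] := ((‖x‖ ^ 2 : ℝ) : ℍ[ℝ]) - toQuat y * toQuat x with hs
  have hcomm : s * toQuat x = toQuat y * s := by
    have h1 := toQuat_mul_self x
    have h2 := toQuat_mul_self y
    rw [← hxy] at h2
    rw [hs, sub_mul, mul_sub, mul_assoc, h1, ← mul_assoc, h2, mul_neg, neg_mul,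
      Quaternion.coe_commutes]
    abel
  have hs0 : s ≠ 0 := by
    intro h0
    apply hne
    have h3 : toQuat y * toQuat x = ((‖x‖ ^ 2 : ℝ) : ℍ[ℝ]) := (sub_eq_zero.mp h0).symm
    have h4 : toQuat y * (toQuat x * toQuat x) = ((‖x‖ ^ 2 : ℝ) : ℍ[ℝ]) * toQuat x := by
      rw [← mul_assoc, h3]
    rw [toQuat_mul_self, mul_neg, ← Quaternion.coe_commutes, ← mul_neg] at h4
    have h5 : ((‖x‖ ^ 2 : ℝ) : ℍ[ℝ]) ≠ 0 := by
      have : (‖x‖ ^ 2 : ℝ) ≠ 0 := pow_ne_zero 2 (norm_ne_zero_iff.mpr hx)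
      exact fun h => this (Quaternion.coe_injective h)
    have h6 := mul_left_cancel₀ h5 h4
    rw [← quatVec_toQuat x, ← h6, map_neg, quatVec_toQuat, neg_neg]
  have hns : ‖s‖ ≠ 0 := norm_ne_zero_iff.mpr hs0
  refine ⟨⟨‖s‖⁻¹ • s, by simp [norm_smul, hns]⟩, ?_⟩
  have h7 : toQuat (rotLin (‖s‖⁻¹ • s) x) = toQuat y := by
    rw [toQuat_rotLin, Quaternion.star_smul, smul_mul_assoc, smul_mul_assoc, mul_smul_comm, hcomm, mul_assoc,
      Quaternion.self_mul_star, Quaternion.normSq_eq_norm_mul_self, smul_smul]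
    ext <;> simp <;> field_simp
  rw [rot_apply, ← quatVec_toQuat (rotLin _ x), h7, quatVec_toQuat]

theorem exists_rot_eq {x y : Space3} (hxy : ‖x‖ = ‖y‖) : ∃ q, rot q x = y := by
  rcases eq_or_ne x 0 with rfl | hx
  · refine ⟨1, ?_⟩
    rw [norm_zero, eq_comm, norm_eq_zero] at hxy
    rw [hxy, map_zero]
  by_cases hne : y = -x
  -- The antipode is reached in two rotations through a third point of the same sphere. If there
  -- were none, the multiples of two different unit vectors would both be `x` or `-x`.
  · obtain ⟨z, hz, hz1, hz2⟩ : ∃ z : Space3, ‖z‖ = ‖x‖ ∧ z ≠ -x ∧ z ≠ x := by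
      by_contra hcon
      push Not at hcon
      have h0 := hcon (‖x‖ • unitVec 0) (by simp [norm_smul, unitVec])
      have h1 := hcon (‖x‖ • unitVec 1) (by simp [norm_smul, unitVec])
      have hpos : ‖x‖ ≠ 0 := norm_ne_zero_iff.mpr hx
      have e0 : x 1 = 0 := by
        by_cases h : ‖x‖ • unitVec 0 = -x
        · have := congrArg (fun v : Space3 => v 1) h
          simpa [unitVec] using this
        · have := congrArg (fun v : Space3 => v 1) (h0 h)
          simpa [unitVec] using this.symm
      by_cases h : ‖x‖ • unitVec 1 = -x
      · have := congrArg (fun v : Space3 => v 1) h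
        simp [unitVec, e0, hx] at this
      · have := congrArg (fun v : Space3 => v 1) (h1 h)
        simp [unitVec, e0, hx] at this
    obtain ⟨p, hp⟩ := exists_rot_eq_of_ne_neg hz.symm hz1 hx
    have hz0 : z ≠ 0 := norm_ne_zero_iff.mp (by rw [hz]; exact norm_ne_zero_iff.mpr hx)
    obtain ⟨q, hq⟩ := exists_rot_eq_of_ne_neg (hz.trans hxy) (x := z) (y := y)
      (by rw [hne]; exact fun h => hz2 (neg_injective h).symm) hz0
    exact ⟨q * p, by rw [rot_mul, hp, hq]⟩
  · exact exists_rot_eq_of_ne_neg hxy hne hx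

end

noncomputable section

open scoped Quaternion

/-! ### Averages over rotations -/

/-- The invariant probability measure on the unit quaternions. -/
def quatHaar : Measure UnitQuaternion :=
  Measure.haarMeasure (⊤ : TopologicalSpace.PositiveCompacts UnitQuaternion)

instance : quatHaar.IsMulLeftInvariant :=
  inferInstanceAs (Measure.haarMeasure _).IsMulLeftInvariant

instance : IsProbabilityMeasure quatHaar := ⟨by
  have := Measure.haarMeasure_self (K₀ := (⊤ : TopologicalSpace.PositiveCompacts UnitQuaternion))
  rwa [TopologicalSpace.PositiveCompacts.coe_top] at this⟩

variable {E : Type*} [NormedAddCommGroup E] [NormedSpace ℝ E]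

/-- The average of a function over all rotations. -/
def rotAvg (u : Space3 → E) (x : Space3) : E := ∫ q, u (rot q⁻¹ x) ∂quatHaar

/-- Rotations act transitively on spheres, and the inverse in `rotAvg` turns a rotation of the
argument into a left translation of `q`, under which the Haar measure is invariant. -/
theorem rotAvg_eq_of_norm_eq (u : Space3 → E) {x y : Space3} (h : ‖x‖ = ‖y‖) :
    rotAvg u x = rotAvg u y := by
  obtain ⟨p, rfl⟩ := exists_rot_eq h
  have h1 := integral_mul_left_eq_self (μ := quatHaar) (fun q => u (rot q⁻¹ (rot p x))) p
  rw [rotAvg, rotAvg, ← h1]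
  refine integral_congr_ae (ae_of_all _ fun q => ?_)
  simp only [mul_inv_rev, rot_mul, rot_inv_rot]

theorem rotAvg_radial_smul (h : ℝ → ℝ) (u : Space3 → E) (x : Space3) :
    rotAvg (fun y => h ‖y‖ • u y) x = h ‖x‖ • rotAvg u x := by
  simp only [rotAvg, LinearIsometryEquiv.norm_map, integral_smul]

variable {μ : Measure Space3}

theorem integral_comp_rot (hμ : ∀ q, MeasurePreserving (rot q) μ μ) (u : Space3 → E)
    (q : UnitQuaternion) : ∫ x, u (rot q x) ∂μ = ∫ x, u x ∂μ :=
  (hμ q).integral_comp (rot q).toHomeomorph.measurableEmbedding u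

variable [SFinite μ]

/-- The joint map in `(q, x)` is needed to have `u (rot q⁻¹ x)` integrable on the product, the
hypothesis of every use of Fubini for averages. -/
theorem measurePreserving_rot_prod (hμ : ∀ q, MeasurePreserving (rot q) μ μ) :
    MeasurePreserving (fun p : UnitQuaternion × Space3 => (p.1, rot p.1⁻¹ p.2))
      (quatHaar.prod μ) (quatHaar.prod μ) := by
  refine (MeasurePreserving.id quatHaar).skew_product (g := fun q x => rot q⁻¹ x) ?_
    (ae_of_all _ fun q => (hμ q⁻¹).map_eq)
  exact (continuous_rot.comp (continuous_fst.inv.prodMk continuous_snd)).measurable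

theorem integrable_comp_rot_prod {E : Type*} [NormedAddCommGroup E]
    (hμ : ∀ q, MeasurePreserving (rot q) μ μ) {u : Space3 → E}
    (hu : Integrable u μ) :
    Integrable (fun p : UnitQuaternion × Space3 => u (rot p.1⁻¹ p.2)) (quatHaar.prod μ) :=
  (measurePreserving_rot_prod hμ).integrable_comp_of_integrable (hu.comp_snd quatHaar)

theorem integrable_rotAvg (hμ : ∀ q, MeasurePreserving (rot q) μ μ) {u : Space3 → E}
    (hu : Integrable u μ) : Integrable (rotAvg u) μ :=
  (integrable_comp_rot_prod hμ hu).integral_prod_right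

theorem integral_rotAvg [CompleteSpace E] (hμ : ∀ q, MeasurePreserving (rot q) μ μ) {u : Space3 → E}
    (hu : Integrable u μ) : ∫ x, rotAvg u x ∂μ = ∫ x, u x ∂μ := by
  have h := integral_integral_swap (f := fun q x => u (rot q⁻¹ x))
    (integrable_comp_rot_prod hμ hu)
  simp only [rotAvg]
  rw [← h]
  simp [integral_comp_rot hμ]

theorem integral_norm_rotAvg_le (hμ : ∀ q, MeasurePreserving (rot q) μ μ) {u : Space3 → E}
    (hu : Integrable u μ) : ∫ x, ‖rotAvg u x‖ ∂μ ≤ ∫ x, ‖u x‖ ∂μ := by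
  rw [← integral_rotAvg hμ hu.norm]
  exact integral_mono (integrable_rotAvg hμ hu).norm (integrable_rotAvg hμ hu.norm)
    fun x => norm_integral_le_integral_norm _

/-- If `u` changes little under every rotation, when tested against `φ`, then `u` is close to its
average. -/
theorem norm_integral_smul_sub_rotAvg_le [CompleteSpace E] (hμ : ∀ q, MeasurePreserving (rot q) μ μ)
    {u : Space3 → E} (hu : Integrable u μ) {φ : Space3 → ℝ} (hφ : Continuous φ)
    (hc : HasCompactSupport φ) {K : ℝ}
    (hK : ∀ q, ‖∫ x, (φ (rot q x) - φ x) • u x ∂μ‖ ≤ K) :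
    ‖∫ x, φ x • (rotAvg u x - u x) ∂μ‖ ≤ K := by
  obtain ⟨C, hC⟩ := hc.exists_bound_of_continuous hφ
  have hint : ∀ {v : Space3 → E} {ψ : Space3 → ℝ}, Integrable v μ → Continuous ψ →
      (∀ x, ‖ψ x‖ ≤ C) → Integrable (fun x => ψ x • v x) μ := fun hv hψ hC =>
    hv.bdd_smul C hψ.aestronglyMeasurable (ae_of_all _ hC)
  have h1 : Integrable (fun p : UnitQuaternion × Space3 => φ p.2 • u (rot p.1⁻¹ p.2))
      (quatHaar.prod μ) :=
    (integrable_comp_rot_prod hμ hu).bdd_smul C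
      (hφ.comp continuous_snd).aestronglyMeasurable (ae_of_all _ fun p => hC p.2)
  have h2 := integral_integral_swap (f := fun q x => φ x • u (rot q⁻¹ x)) h1
  have h3 : ∀ q, ∫ x, φ x • u (rot q⁻¹ x) ∂μ = ∫ x, φ (rot q x) • u x ∂μ := fun q => by
    rw [← integral_comp_rot hμ _ q]
    refine integral_congr_ae (ae_of_all _ fun x => ?_)
    simp only [rot_inv_rot]
  have h4 : ∫ x, φ x • (rotAvg u x - u x) ∂μ =
      ∫ q, (∫ x, (φ (rot q x) - φ x) • u x ∂μ) ∂quatHaar := by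
    have h5 : ∀ q, ∫ x, (φ (rot q x) - φ x) • u x ∂μ =
        (∫ x, φ x • u (rot q⁻¹ x) ∂μ) - ∫ x, φ x • u x ∂μ := fun q => by
      rw [h3]
      simp only [sub_smul]
      exact integral_sub (hint hu (hφ.comp (rot q).continuous) fun x => hC _) (hint hu hφ hC)
    simp only [h5]
    rw [integral_sub h1.integral_prod_left (integrable_const _), h2]
    simp only [smul_sub, integral_const, probReal_univ, one_smul]
    rw [integral_sub (hint (integrable_rotAvg hμ hu) hφ hC) (hint hu hφ hC)]
    simp only [rotAvg, integral_smul]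
  rw [h4]
  refine (norm_integral_le_of_norm_le_const (ae_of_all _ hK)).trans ?_
  simp

namespace NestedShells

variable {N : ℕ}

theorem rot_mem_domain (S : NestedShells N) (q : UnitQuaternion) (x : Space3) :
    rot q x ∈ S.domain ↔ x ∈ S.domain := by
  simp only [domain, shell, Set.mem_iUnion, Set.mem_ofPred_eq, LinearIsometryEquiv.norm_map]

theorem measurePreserving_rot (S : NestedShells N) (q : UnitQuaternion) :
    MeasurePreserving (rot q) (volume.restrict S.domain) (volume.restrict S.domain) := by
  have h := (rot q).measurePreserving.restrict_preimage S.measurableSet_domain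
  have h2 : rot q ⁻¹' S.domain = S.domain := Set.ext fun x => S.rot_mem_domain q x
  rwa [h2] at h

end NestedShells

end

noncomputable section

open scoped Quaternion

/-! ### Bounds in `L²` by duality with test functions -/

theorem integral_norm_mul_norm_le {X F F' : Type*} [MeasurableSpace X] {μ : Measure X}
    [NormedAddCommGroup F] [NormedAddCommGroup F'] {f : X → F} {g : X → F'}
    (hf : MemLp f 2 μ) (hg : MemLp g 2 μ) :
    ∫ x, ‖f x‖ * ‖g x‖ ∂μ ≤ (eLpNorm f 2 μ).toReal * (eLpNorm g 2 μ).toReal := by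
  have h1 : ∫ x, ‖f x‖ * ‖g x‖ ∂μ = inner ℝ (hg.norm.toLp _) (hf.norm.toLp _) := by
    rw [L2.inner_def]
    refine integral_congr_ae ?_
    filter_upwards [hf.norm.coeFn_toLp, hg.norm.coeFn_toLp] with x h1 h2
    rw [h1, h2]
    simp
  rw [h1]
  refine (real_inner_le_norm _ _).trans_eq ?_
  rw [Lp.norm_toLp, Lp.norm_toLp, eLpNorm_norm, eLpNorm_norm, mul_comm]

/-- The smooth functions with compact support in `U`, as elements of `L²(μ)`. -/
def testFunctions (μ : Measure Space3) (U : Set Space3) : Submodule ℝ (Lp ℝ 2 μ) where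
  carrier := {f | ∃ φ : Space3 → ℝ, ContDiff ℝ ((⊤ : ℕ∞) : WithTop ℕ∞) φ ∧
    HasCompactSupport φ ∧ tsupport φ ⊆ U ∧ f =ᵐ[μ] φ}
  zero_mem' := ⟨0, contDiff_const, HasCompactSupport.zero, by simp, Lp.coeFn_zero _ _ _⟩
  add_mem' := by
    rintro f g ⟨φ, h1, h2, h3, h4⟩ ⟨ψ, k1, k2, k3, k4⟩
    exact ⟨φ + ψ, h1.add k1, h2.add k2, (tsupport_add _ _).trans (Set.union_subset h3 k3),
      (Lp.coeFn_add f g).trans (h4.add k4)⟩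
  smul_mem' := by
    rintro c f ⟨φ, h1, h2, h3, h4⟩
    exact ⟨c • φ, contDiff_const.smul h1, h2.smul_left, (closure_mono
      (Function.support_const_smul_subset c φ)).trans h3, (Lp.coeFn_smul c f).trans (h4.const_smul c)⟩

/-- A function orthogonal to all test functions vanishes almost everywhere by the fundamental lemma
of the calculus of variations. -/
theorem topologicalClosure_testFunctions {U : Set Space3} (hU : IsOpen U)
    [IsFiniteMeasure (volume.restrict U)] :
    (testFunctions (volume.restrict U) U).topologicalClosure = ⊤ := by
  rw [Submodule.topologicalClosure_eq_top_iff, Submodule.eq_bot_iff]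
  intro f hf
  have hloc : LocallyIntegrableOn f U volume :=
    IntegrableOn.locallyIntegrableOn ((Lp.memLp f).integrable (by norm_num))
  have key := hU.ae_eq_zero_of_integral_contDiff_smul_eq_zero hloc fun φ h1 h2 h3 => by
    have hm : MemLp φ 2 (volume.restrict U) := h1.continuous.memLp_of_hasCompactSupport h2
    have h4 := (Submodule.mem_orthogonal _ _).mp hf (hm.toLp φ) ⟨φ, h1, h2, h3, hm.coeFn_toLp⟩
    rw [L2.inner_def] at h4
    have h0 : ∀ x, x ∉ U → φ x • f x = 0 := fun x hx => by
      rw [image_eq_zero_of_notMem_tsupport fun h => hx (h3 h), zero_smul]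
    rw [← setIntegral_eq_integral_of_forall_compl_eq_zero h0, ← h4]
    refine integral_congr_ae ?_
    filter_upwards [hm.coeFn_toLp] with x hx
    rw [hx]
    simp [mul_comm]
  refine Lp.ext ?_
  refine EventuallyEq.trans ?_ (Lp.coeFn_zero _ _ _).symm
  rw [EventuallyEq, ae_restrict_iff' hU.measurableSet]
  exact key

/-- The inequality `|⟨d, g⟩| ≤ K ‖g‖` is a closed condition on `g`, so it passes from test functions
to all of `L²`; the choice `g = d` then gives the bound. -/
theorem eLpNorm_real_le_of_test {U : Set Space3} (hU : IsOpen U)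
    [IsFiniteMeasure (volume.restrict U)] {d : Space3 → ℝ}
    (hd : MemLp d 2 (volume.restrict U)) {K : ℝ} (hK : 0 ≤ K)
    (h : ∀ φ : Space3 → ℝ, ContDiff ℝ ((⊤ : ℕ∞) : WithTop ℕ∞) φ → HasCompactSupport φ →
      tsupport φ ⊆ U →
      |∫ x in U, φ x * d x| ≤ K * (eLpNorm φ 2 (volume.restrict U)).toReal) :
    (eLpNorm d 2 (volume.restrict U)).toReal ≤ K := by
  set f := hd.toLp d with hf
  have hclosed : IsClosed {g : Lp ℝ 2 (volume.restrict U) | |inner ℝ f g| ≤ K * ‖g‖} :=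
    isClosed_le (continuous_const.inner continuous_id).abs (continuous_const.mul continuous_norm)
  have hsub : (testFunctions (volume.restrict U) U : Set (Lp ℝ 2 (volume.restrict U))) ⊆
      {g | |inner ℝ f g| ≤ K * ‖g‖} := by
    rintro g ⟨φ, h1, h2, h3, h4⟩
    have h5 := h φ h1 h2 h3
    have h6 : inner ℝ f g = ∫ x in U, φ x * d x := by
      rw [L2.inner_def]
      refine integral_congr_ae ?_
      filter_upwards [hd.coeFn_toLp, h4] with x e1 e2
      rw [e1, e2]
      simp
    have h7 : ‖g‖ = (eLpNorm φ 2 (volume.restrict U)).toReal := by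
      rw [Lp.norm_def, eLpNorm_congr_ae h4]
    change |inner ℝ f g| ≤ K * ‖g‖
    rwa [h6, h7]
  have hall : f ∈ (testFunctions (volume.restrict U) U).topologicalClosure := by
    rw [topologicalClosure_testFunctions hU]
    trivial
  have h8 : |inner ℝ f f| ≤ K * ‖f‖ := closure_minimal hsub hclosed hall
  have h9 : ‖f‖ = (eLpNorm d 2 (volume.restrict U)).toReal := Lp.norm_toLp d hd
  rw [← h9]
  rw [real_inner_self_eq_norm_sq, abs_of_nonneg (by positivity), pow_two] at h8
  rcases (norm_nonneg f).eq_or_lt with h0 | h0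
  · rwa [← h0]
  · exact le_of_mul_le_mul_right h8 h0

theorem eLpNorm_le_of_test {U : Set Space3} (hU : IsOpen U)
    [IsFiniteMeasure (volume.restrict U)] {d : Space3 → ℂ}
    (hd : MemLp d 2 (volume.restrict U)) {K : ℝ} (hK : 0 ≤ K)
    (h : ∀ φ : Space3 → ℝ, ContDiff ℝ ((⊤ : ℕ∞) : WithTop ℕ∞) φ → HasCompactSupport φ →
      tsupport φ ⊆ U →
      ‖∫ x in U, φ x • d x‖ ≤ K * (eLpNorm φ 2 (volume.restrict U)).toReal) :
    (eLpNorm d 2 (volume.restrict U)).toReal ≤ 2 * K := by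
  have hre : MemLp (fun x => (d x).re) 2 (volume.restrict U) := hd.re
  have him : MemLp (fun x => (d x).im) 2 (volume.restrict U) := hd.im
  have hint : ∀ φ : Space3 → ℝ, ContDiff ℝ ((⊤ : ℕ∞) : WithTop ℕ∞) φ → HasCompactSupport φ →
      Integrable (fun x => φ x • d x) (volume.restrict U) := fun φ h1 h2 =>
    NestedShells.integrable_test_smul h1.continuous h2 hd
  have h1 := eLpNorm_real_le_of_test hU hre hK fun φ k1 k2 k3 => by
    refine le_trans ?_ (h φ k1 k2 k3)
    have := integral_re (hint φ k1 k2)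
    have e : ∫ x in U, φ x * (d x).re = (∫ x in U, φ x • d x).re := by
      simpa using this
    rw [e]
    exact Complex.abs_re_le_norm _
  have h2 := eLpNorm_real_le_of_test hU him hK fun φ k1 k2 k3 => by
    refine le_trans ?_ (h φ k1 k2 k3)
    have := integral_im (hint φ k1 k2)
    have e : ∫ x in U, φ x * (d x).im = (∫ x in U, φ x • d x).im := by
      simpa using this
    rw [e]
    exact Complex.abs_im_le_norm _
  -- Real and imaginary part each contribute `K`, whence the factor two.
  have h3 : eLpNorm d 2 (volume.restrict U) ≤ eLpNorm (fun x => (d x).re) 2 (volume.restrict U) +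
      eLpNorm (fun x => (d x).im) 2 (volume.restrict U) := by
    rw [← eLpNorm_norm (fun x => (d x).re), ← eLpNorm_norm (fun x => (d x).im)]
    refine le_trans ?_ (eLpNorm_add_le hre.norm.1 him.norm.1 (by norm_num))
    refine eLpNorm_mono_real fun x => ?_
    exact Complex.norm_le_abs_re_add_abs_im _
  have h4 := ENNReal.toReal_mono (ENNReal.add_ne_top.mpr ⟨hre.2.ne, him.2.ne⟩) h3
  rw [ENNReal.toReal_add hre.2.ne him.2.ne] at h4
  linarith

end

noncomputable section

open scoped Quaternion

/-! ### One-parameter groups of rotations -/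

/-- The point `cos t + n sin t` of the circle of unit quaternions through `1` and `n`. -/
def circleQuat (n : Space3) (t : ℝ) : ℍ[ℝ] := ((Real.cos t : ℝ) : ℍ[ℝ]) + Real.sin t • toQuat n

theorem norm_circleQuat {n : Space3} (hn : ‖n‖ = 1) (t : ℝ) : ‖circleQuat n t‖ = 1 := by
  have h : ‖circleQuat n t‖ ^ 2 = 1 := by
    have h1 := EuclideanSpace.real_norm_sq_eq n
    rw [hn, Fin.sum_univ_three] at h1
    rw [pow_two, ← Quaternion.normSq_eq_norm_mul_self, Quaternion.normSq_def']
    simp only [circleQuat, Quaternion.re_add, Quaternion.imI_add, Quaternion.imJ_add,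
      Quaternion.imK_add, Quaternion.re_coe, Quaternion.imI_coe, Quaternion.imJ_coe,
      Quaternion.imK_coe, Quaternion.re_smul, Quaternion.imI_smul, Quaternion.imJ_smul,
      Quaternion.imK_smul, toQuat_re, toQuat_imI, toQuat_imJ, toQuat_imK, smul_eq_mul]
    have h2 := Real.sin_sq_add_cos_sq t
    linear_combination h2 - (Real.sin t) ^ 2 * h1
  exact (pow_eq_one_iff_of_nonneg (norm_nonneg _) two_ne_zero).mp h

theorem circleQuat_zero (n : Space3) : circleQuat n 0 = 1 := by simp [circleQuat]

/-- The unit quaternion `cos t + n sin t`. -/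
def circleUnit {n : Space3} (hn : ‖n‖ = 1) (t : ℝ) : UnitQuaternion :=
  ⟨circleQuat n t, by simp [norm_circleQuat hn]⟩

/-- The polar form, with `t` the arccosine of the real part. It joins `1` to any rotation by a
one-parameter group run for a time at most `π`, a bound uniform in `q`. -/
theorem exists_eq_circleUnit (q : UnitQuaternion) :
    ∃ (n : Space3) (hn : ‖n‖ = 1) (t : ℝ), 0 ≤ t ∧ t ≤ Real.pi ∧ q = circleUnit hn t := by
  obtain ⟨q, hq⟩ := q
  have hq1 : ‖q‖ = 1 := by simpa using hq
  have hsq : q.re ^ 2 + ‖quatVec q‖ ^ 2 = 1 := by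
    rw [EuclideanSpace.real_norm_sq_eq, Fin.sum_univ_three]
    have := Quaternion.normSq_def' (a := q)
    rw [Quaternion.normSq_eq_norm_mul_self, hq1] at this
    simp only [quatVec_zero, quatVec_one, quatVec_two]
    linarith
  have hre : q.re ∈ Set.Icc (-1 : ℝ) 1 := by
    constructor <;> nlinarith [sq_nonneg ‖quatVec q‖]
  have hsin : Real.sin (Real.arccos q.re) = ‖quatVec q‖ := by
    rw [Real.sin_arccos, show 1 - q.re ^ 2 = ‖quatVec q‖ ^ 2 by linarith,
      Real.sqrt_sq (norm_nonneg _)]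
  have hcos := Real.cos_arccos hre.1 hre.2
  obtain ⟨n, hn, hn2⟩ : ∃ n : Space3, ‖n‖ = 1 ∧ ‖quatVec q‖ • n = quatVec q := by
    rcases eq_or_ne (quatVec q) 0 with h | h
    · exact ⟨unitVec 0, by simp [unitVec], by simp [h]⟩
    · have h0 : ‖quatVec q‖ ≠ 0 := norm_ne_zero_iff.mpr h
      exact ⟨‖quatVec q‖⁻¹ • quatVec q, by simp [norm_smul, h0], by simp [smul_smul, h0]⟩
  refine ⟨n, hn, Real.arccos q.re, Real.arccos_nonneg _, Real.arccos_le_pi _, Subtype.ext ?_⟩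
  change q = circleQuat n _
  rw [circleQuat, hcos, hsin, ← map_smul, hn2]
  ext <;> simp

/-- The velocity field `x ↦ n x - x n` of the rotations about the axis `n`. -/
def rotField (n : Space3) : Space3 →ₗ[ℝ] Space3 where
  toFun x := quatVec (toQuat n * toQuat x - toQuat x * toQuat n)
  map_add' x y := by rw [← map_add]; congr 1; simp only [map_add, mul_add, add_mul]; abel
  map_smul' c x := by
    simp only [map_smul, mul_smul_comm, smul_mul_assoc, RingHom.id_apply, ← smul_sub]

theorem toQuat_rotField (n x : Space3) :
    toQuat (rotField n x) = toQuat n * toQuat x - toQuat x * toQuat n := by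
  refine toQuat_quatVec (re_eq_zero_of_star_eq_neg ?_)
  rw [star_sub, StarMul.star_mul, StarMul.star_mul, star_toQuat, star_toQuat]
  simp

theorem norm_rotField_le {n : Space3} (hn : ‖n‖ = 1) (x : Space3) : ‖rotField n x‖ ≤ 2 * ‖x‖ := by
  rw [← norm_toQuat, toQuat_rotField]
  refine (norm_sub_le _ _).trans_eq ?_
  rw [norm_mul, norm_mul, norm_toQuat, norm_toQuat, hn]
  ring

/-- The diagonal entries of the linear field vanish, so it is divergence-free. -/
theorem rotField_unitVec_apply (n : Space3) (l : Fin 3) : rotField n (unitVec l) l = 0 := by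
  change quatVec (toQuat n * toQuat (unitVec l) - toQuat (unitVec l) * toQuat n) l = 0
  fin_cases l <;> simp [unitVec]

theorem hasDerivAt_circleQuat {n : Space3} (hn : ‖n‖ = 1) (t : ℝ) :
    HasDerivAt (circleQuat n) (circleQuat n t * toQuat n) t := by
  have h1 : HasDerivAt (fun t : ℝ => (Real.cos t) • (1 : ℍ[ℝ]) + Real.sin t • toQuat n)
      ((-Real.sin t) • (1 : ℍ[ℝ]) + Real.cos t • toQuat n) t :=
    ((Real.hasDerivAt_cos t).smul_const _).add ((Real.hasDerivAt_sin t).smul_const _)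
  have h2 : (fun t : ℝ => (Real.cos t) • (1 : ℍ[ℝ]) + Real.sin t • toQuat n) = circleQuat n := by
    funext t
    simp only [circleQuat]
    congr 1
    ext <;> simp
  rw [h2] at h1
  convert h1 using 1
  rw [← h2, add_mul, smul_mul_assoc, smul_mul_assoc, toQuat_mul_self, hn]
  ext <;> simp

/-- The field is applied before the rotation, so the time derivative of `φ ∘ R_t` is its own
derivative along the fixed field `rotField n`. -/
theorem hasDerivAt_rotLin {n : Space3} (hn : ‖n‖ = 1) (x : Space3) (t : ℝ) :
    HasDerivAt (fun t => rotLin (circleQuat n t) x)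
      (rotLin (circleQuat n t) (rotField n x)) t := by
  have h := hasDerivAt_circleQuat hn t
  let starLin : ℍ[ℝ] →ₗ[ℝ] ℍ[ℝ] :=
    { toFun := star, map_add' := star_add, map_smul' := fun c q => Quaternion.star_smul c q }
  have hs : HasDerivAt (fun t => star (circleQuat n t)) (star (circleQuat n t * toQuat n)) t :=
    (LinearMap.toContinuousLinearMap starLin).hasFDerivAt.comp_hasDerivAt t h
  have h2 := (h.mul_const (toQuat x)).mul hs
  have h3 := (LinearMap.toContinuousLinearMap quatVec).hasFDerivAt.comp_hasDerivAt t h2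
  refine h3.congr_deriv ?_
  change quatVec _ = quatVec (circleQuat n t * toQuat (rotField n x) * star (circleQuat n t))
  rw [toQuat_rotField, StarMul.star_mul, star_toQuat]
  congr 1
  noncomm_ring

namespace NestedShells

variable {N : ℕ}

/-- The defining identity of the weak gradient, tested against a vector field. -/
theorem integral_div_smul_eq (S : NestedShells N) {p : S.Pairs} (hp : p ∈ S.H1)
    {Φ : Fin 3 → Space3 → ℝ} (h1 : ∀ l, ContDiff ℝ ((⊤ : ℕ∞) : WithTop ℕ∞) (Φ l))
    (h2 : ∀ l, HasCompactSupport (Φ l)) (h3 : ∀ l, tsupport (Φ l) ⊆ S.domain) :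
    ∫ x in S.domain, (∑ l, fderiv ℝ (Φ l) x (unitVec l)) • p.fst x =
      -∫ x in S.domain, ∑ l, Φ l x • (p.snd x) l := by
  simp only [Finset.sum_smul]
  rw [integral_finsetSum _ fun l _ => integrable_test_smul (continuous_partial (h1 l) l)
      (hasCompactSupport_partial (h2 l) l) (Lp.memLp p.fst),
    integral_finsetSum _ fun l _ => integrable_test_smul (h1 l).continuous (h2 l)
      (memLp_coord (Lp.memLp p.snd) l), ← Finset.sum_neg_distrib]
  exact Finset.sum_congr rfl fun l _ => hp (Φ l) (h1 l) (h2 l) (h3 l) l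

theorem norm_sum_smul_le (a : Space3) (g : EuclideanSpace ℂ (Fin 3)) :
    ‖∑ l, a l • g l‖ ≤ 3 * (‖a‖ * ‖g‖) := by
  refine (norm_sum_le _ _).trans ?_
  refine (Finset.sum_le_card_nsmul _ _ (‖a‖ * ‖g‖) fun l _ => ?_).trans_eq (by simp)
  rw [norm_smul]
  exact mul_le_mul (PiLp.norm_apply_le a l) (PiLp.norm_apply_le g l) (norm_nonneg _) (norm_nonneg _)

/-- As the field is divergence-free, the derivative of `ψ` along it is the divergence of `ψ` times
the field, and the weak gradient identity moves the derivative onto `p`. In `6 * b`, the field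
contributes `2 b` and the crude bound of the sum over coordinates contributes `3`. -/
theorem norm_integral_rotField_le (S : NestedShells N) {b : ℝ} (hb0 : 0 ≤ b) (hb : ∀ x ∈ S.domain, ‖x‖ ≤ b)
    {p : S.Pairs} (hp : p ∈ S.H1) {n : Space3} (hn : ‖n‖ = 1) {ψ : Space3 → ℝ}
    (h1 : ContDiff ℝ ((⊤ : ℕ∞) : WithTop ℕ∞) ψ) (h2 : HasCompactSupport ψ)
    (h3 : tsupport ψ ⊆ S.domain) :
    ‖∫ x in S.domain, fderiv ℝ ψ x (rotField n x) • p.fst x‖ ≤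
      6 * b * ((eLpNorm ψ 2 (volume.restrict S.domain)).toReal * ‖p.snd‖) := by
  have hG : ContDiff ℝ ((⊤ : ℕ∞) : WithTop ℕ∞) (rotField n) :=
    (LinearMap.toContinuousLinearMap (rotField n)).contDiff
  have hGl : ∀ l, ContDiff ℝ ((⊤ : ℕ∞) : WithTop ℕ∞) (fun x => rotField n x l) := fun l =>
    (EuclideanSpace.proj (𝕜 := ℝ) l).contDiff.comp hG
  have hdG : ∀ x l, fderiv ℝ (fun x => rotField n x l) x (unitVec l) = 0 := fun x l => by
    have h := ((EuclideanSpace.proj (𝕜 := ℝ) l).comp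
      (LinearMap.toContinuousLinearMap (rotField n))).fderiv (x := x)
    have h' : fderiv ℝ (fun x => rotField n x l) x = (EuclideanSpace.proj (𝕜 := ℝ) l).comp
      (LinearMap.toContinuousLinearMap (rotField n)) := h
    rw [h']
    exact rotField_unitVec_apply n l
  have hdiv : ∀ x, ∑ l, fderiv ℝ (fun x => rotField n x l * ψ x) x (unitVec l) =
      fderiv ℝ ψ x (rotField n x) := fun x => by
    have hx : rotField n x = ∑ l, rotField n x l • unitVec l := by
      ext i
      fin_cases i <;> simp [Fin.sum_univ_three, unitVec]
    conv_rhs => rw [hx, map_sum]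
    refine Finset.sum_congr rfl fun l _ => ?_
    rw [fderiv_fun_mul ((hGl l).differentiable (by simp) x) (h1.differentiable (by simp) x)]
    simp [hdG x l]
  have key := S.integral_div_smul_eq hp (Φ := fun l x => rotField n x l * ψ x)
    (fun l => (hGl l).mul h1) (fun l => h2.mul_left)
    (fun l => (closure_mono (Function.support_mul_subset_right _ _)).trans h3)
  simp only [hdiv] at key
  rw [key, norm_neg]
  have hψ : MemLp ψ 2 (volume.restrict S.domain) := h1.continuous.memLp_of_hasCompactSupport h2
  have hg := Lp.memLp p.snd
  have hint : Integrable (fun x => ‖ψ x‖ * ‖p.snd x‖) (volume.restrict S.domain) :=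
    hψ.norm.integrable_mul hg.norm
  calc ‖∫ x in S.domain, ∑ l, (rotField n x l * ψ x) • (p.snd x) l‖
      ≤ ∫ x in S.domain, 6 * b * (‖ψ x‖ * ‖p.snd x‖) := by
        refine norm_integral_le_of_norm_le (hint.const_mul _) ?_
        filter_upwards [ae_restrict_mem S.measurableSet_domain] with x hx
        have e : ∑ l, (rotField n x l * ψ x) • (p.snd x) l =
            ψ x • ∑ l, rotField n x l • (p.snd x) l := by
          rw [Finset.smul_sum]
          refine Finset.sum_congr rfl fun l _ => ?_
          rw [smul_smul, mul_comm]
        rw [e, norm_smul]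
        have h4 := norm_sum_smul_le (rotField n x) (p.snd x)
        have h5 : ‖rotField n x‖ ≤ 2 * b := (norm_rotField_le hn x).trans (by linarith [hb x hx])
        calc ‖ψ x‖ * ‖∑ l, rotField n x l • (p.snd x) l‖
            ≤ ‖ψ x‖ * (3 * (2 * b * ‖p.snd x‖)) := by
              refine mul_le_mul_of_nonneg_left (h4.trans ?_) (norm_nonneg _)
              gcongr
          _ = _ := by ring
    _ ≤ _ := by
        rw [integral_const_mul]
        refine mul_le_mul_of_nonneg_left ?_ (by positivity)
        exact (integral_norm_mul_norm_le hψ hg).trans_eq (by rw [Lp.norm_def])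

/-- Differentiate `∫ φ(R_t x) u` along the circle from `1` to `q`. Each derivative is bounded by
`norm_integral_rotField_le` for `φ ∘ R_t`, which has the same `L²` norm as `φ`; the mean value
inequality over a time at most `π` concludes. Only the `L²` norm of `φ` enters, which is what the
duality argument requires. -/
theorem norm_integral_comp_rot_sub_le (S : NestedShells N) {b : ℝ} (hb0 : 0 ≤ b)
    (hb : ∀ x ∈ S.domain, ‖x‖ ≤ b)
    {p : S.Pairs} (hp : p ∈ S.H1) {φ : Space3 → ℝ}
    (h1 : ContDiff ℝ ((⊤ : ℕ∞) : WithTop ℕ∞) φ) (h2 : HasCompactSupport φ)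
    (h3 : tsupport φ ⊆ S.domain) (q : UnitQuaternion) :
    ‖∫ x in S.domain, (φ (rot q x) - φ x) • p.fst x‖ ≤
      6 * b * ((eLpNorm φ 2 (volume.restrict S.domain)).toReal * ‖p.snd‖) * Real.pi := by
  obtain ⟨n, hn, T, hT0, hT1, rfl⟩ := exists_eq_circleUnit q
  set R : ℝ → Space3 ≃ₗᵢ[ℝ] Space3 := fun t => rot (circleUnit hn t) with hR
  obtain ⟨C, hC⟩ := (h2.fderiv (𝕜 := ℝ)).exists_bound_of_continuous
    (h1.continuous_fderiv (by simp))
  have hC0 : 0 ≤ C := (norm_nonneg _).trans (hC 0)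
  have hint : ∀ t, Integrable (fun x => φ (R t x) • p.fst x) (volume.restrict S.domain) := fun t =>
    integrable_test_smul (h1.continuous.comp (R t).continuous)
      (h2.comp_homeomorph (R t).toHomeomorph) (Lp.memLp p.fst)
  have hderiv : ∀ t, HasDerivAt (fun t => ∫ x in S.domain, φ (R t x) • p.fst x)
      (∫ x in S.domain, fderiv ℝ (fun y => φ (R t y)) x (rotField n x) • p.fst x) t := by
    intro t
    have hfd : ∀ t x, fderiv ℝ (fun y => φ (R t y)) x (rotField n x) =
        fderiv ℝ φ (R t x) (R t (rotField n x)) := fun t x => by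
      have hL : HasFDerivAt (fun y => R t y)
          ((R t).toContinuousLinearEquiv : Space3 →L[ℝ] Space3) x :=
        (R t).toContinuousLinearEquiv.hasFDerivAt
      have e := ((h1.differentiable (by simp) (R t x)).hasFDerivAt.comp x hL).fderiv
      change fderiv ℝ (fun y => φ (R t y)) x = _ at e
      rw [e]
      rfl
    refine (hasDerivAt_integral_of_dominated_loc_of_deriv_le
      (F' := fun t x => fderiv ℝ (fun y => φ (R t y)) x (rotField n x) • p.fst x)
      (bound := fun x => C * (2 * b) * ‖p.fst x‖) univ_mem
      (Eventually.of_forall fun s => (hint s).aestronglyMeasurable) (hint t) ?_ ?_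
      ((S.integrable_fst p).norm.const_mul _) ?_).2
    · simp only [hfd]
      refine Continuous.aestronglyMeasurable (f := fun x =>
        fderiv ℝ φ (R t x) (R t (rotField n x))) ?_ |>.smul (Lp.aestronglyMeasurable p.fst)
      exact ((h1.continuous_fderiv (by simp)).comp (R t).continuous).clm_apply
        ((R t).continuous.comp (rotField n).continuous_of_finiteDimensional)
    · filter_upwards [ae_restrict_mem S.measurableSet_domain] with x hx s _
      rw [hfd, norm_smul]
      refine mul_le_mul_of_nonneg_right ?_ (norm_nonneg _)
      refine (ContinuousLinearMap.le_opNorm _ _).trans ?_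
      refine mul_le_mul (hC _) ?_ (norm_nonneg _) hC0
      rw [LinearIsometryEquiv.norm_map]
      exact (norm_rotField_le hn x).trans (by linarith [hb x hx])
    · refine ae_of_all _ fun x s _ => ?_
      rw [hfd]
      exact (((h1.differentiable (by simp) (rotLin (circleQuat n s) x)).hasFDerivAt).comp_hasDerivAt s
        (hasDerivAt_rotLin hn x s)).smul_const _
  have hbound : ∀ t, ‖∫ x in S.domain, fderiv ℝ (fun y => φ (R t y)) x (rotField n x) • p.fst x‖ ≤
      6 * b * ((eLpNorm φ 2 (volume.restrict S.domain)).toReal * ‖p.snd‖) := by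
    intro t
    have h4 : eLpNorm (fun y => φ (R t y)) 2 (volume.restrict S.domain) =
        eLpNorm φ 2 (volume.restrict S.domain) :=
      eLpNorm_comp_measurePreserving h1.continuous.aestronglyMeasurable
        (S.measurePreserving_rot (circleUnit hn t))
    rw [← h4]
    refine S.norm_integral_rotField_le hb0 hb hp hn
      (h1.comp (R t).toContinuousLinearEquiv.contDiff)
      (h2.comp_homeomorph (R t).toHomeomorph) ?_
    intro x hx
    have : R t x ∈ tsupport φ := (tsupport_comp_subset_preimage φ (R t).continuous) hx
    exact (S.rot_mem_domain _ x).mp (h3 this)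
  have hmv := (convex_univ (𝕜 := ℝ) (E := ℝ)).norm_image_sub_le_of_norm_hasDerivWithin_le
    (fun t _ => (hderiv t).hasDerivWithinAt) (fun t _ => hbound t) (Set.mem_univ 0)
    (Set.mem_univ T)
  have hR0 : ∀ x, R 0 x = x := fun x => by
    change rotLin (circleQuat n 0) x = x
    rw [circleQuat_zero, rotLin_one]
  have e : ∫ x in S.domain, (φ (R T x) - φ x) • p.fst x =
      (∫ x in S.domain, φ (R T x) • p.fst x) - ∫ x in S.domain, φ (R 0 x) • p.fst x := by
    rw [← integral_sub (hint T) (hint 0)]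
    simp only [hR0, sub_smul]
  rw [e]
  refine hmv.trans (mul_le_mul_of_nonneg_left ?_ ((norm_nonneg _).trans (hbound 0)))
  rw [sub_zero, Real.norm_of_nonneg hT0]
  exact hT1

end NestedShells

end

noncomputable section

open scoped Quaternion

/-! ### Integrals of radial functions over spherical shells -/

/-- The set of points whose distance to the origin lies in `s`. -/
def radialSet (s : Set ℝ) : Set Space3 := {x | ‖x‖ ∈ s}

theorem measurableSet_radialSet {s : Set ℝ} (hs : MeasurableSet s) :
    MeasurableSet (radialSet s) := measurable_norm hs

/-- The area of the unit sphere, as it appears in polar coordinates. -/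
def sphereArea : ℝ := 3 * volume.real (Metric.ball (0 : Space3) 1)

theorem sphereArea_pos : 0 < sphereArea := by
  have : 0 < volume.real (Metric.ball (0 : Space3) 1) :=
    ENNReal.toReal_pos (Metric.measure_ball_pos _ _ one_pos).ne' measure_ball_lt_top.ne
  unfold sphereArea
  positivity

variable {E : Type*} [NormedAddCommGroup E] [NormedSpace ℝ E]

theorem integral_radialSet {s : Set ℝ} (hs : MeasurableSet s) (hs0 : s ⊆ Set.Ioi 0) (f : ℝ → E) :
    ∫ x in radialSet s, f ‖x‖ = sphereArea • ∫ r in s, r ^ 2 • f r := by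
  have h1 : (radialSet s).indicator (fun x => f ‖x‖) = fun x => s.indicator f ‖x‖ := rfl
  have h2 : ∀ r, r ^ 2 • s.indicator f r = s.indicator (fun r => r ^ 2 • f r) r := fun r =>
    (Set.indicator_smul_apply s (fun r : ℝ => r ^ 2) f r).symm
  rw [← integral_indicator (measurableSet_radialSet hs), h1, integral_fun_norm_addHaar]
  simp only [finrank_euclideanSpace, Fintype.card_fin, Nat.add_one_sub_one, h2]
  rw [setIntegral_indicator hs, Set.inter_eq_right.mpr hs0, sphereArea, mul_smul,
    ← Nat.cast_smul_eq_nsmul ℝ]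
  norm_num

theorem integrableOn_radialSet {s : Set ℝ} (hs : MeasurableSet s) (hs0 : s ⊆ Set.Ioi 0)
    {f : ℝ → E} : IntegrableOn (fun x : Space3 => f ‖x‖) (radialSet s) ↔
      IntegrableOn (fun r => r ^ 2 • f r) s := by
  have h1 : (radialSet s).indicator (fun x => f ‖x‖) = fun x => s.indicator f ‖x‖ := rfl
  have h2 : ∀ r, r ^ 2 • s.indicator f r = s.indicator (fun r => r ^ 2 • f r) r := fun r =>
    (Set.indicator_smul_apply s (fun r : ℝ => r ^ 2) f r).symm
  rw [← integrable_indicator_iff (measurableSet_radialSet hs), h1, integrable_fun_norm_addHaar]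
  simp only [finrank_euclideanSpace, Fintype.card_fin, Nat.add_one_sub_one, h2]
  rw [IntegrableOn, integrable_indicator_iff hs, IntegrableOn, Measure.restrict_restrict hs,
    Set.inter_eq_left.mpr hs0, IntegrableOn]

/-- A null set of radii gives a null set of points: polar coordinates applied to the constant
function one. -/
theorem ae_radialSet {s : Set ℝ} (hs : MeasurableSet s) (hs0 : s ⊆ Set.Ioi 0)
    {P : ℝ → Prop} (h : ∀ᵐ r ∂volume.restrict s, P r) :
    ∀ᵐ x ∂(volume.restrict (radialSet s) : Measure Space3), P ‖x‖ := by
  obtain ⟨t, ht1, ht2, ht3⟩ := exists_measurable_superset_of_null h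
  rw [Measure.restrict_apply ht2] at ht3
  have hst : MeasurableSet (t ∩ s) := ht2.inter hs
  have hsub : t ∩ s ⊆ Set.Ioi 0 := Set.inter_subset_right.trans hs0
  have h0 : IntegrableOn (fun _ : Space3 => (1 : ℝ)) (radialSet (t ∩ s)) :=
    (integrableOn_radialSet hst hsub (f := fun _ => (1 : ℝ))).mpr
      (by rw [IntegrableOn, Measure.restrict_eq_zero.mpr ht3]; exact integrable_zero_measure)
  have h1 := integral_radialSet hst hsub (fun _ => (1 : ℝ))
  rw [Measure.restrict_eq_zero.mpr ht3, integral_zero_measure, smul_zero, setIntegral_const,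
    smul_eq_mul, mul_one] at h1
  have h2 : volume (radialSet (t ∩ s)) = 0 := by
    -- The real-valued measure is also zero on sets of infinite measure, so finiteness is drawn from
    -- the integrability of the constant one.
    refine (measureReal_eq_zero_iff ?_).mp h1
    exact ((integrableOn_const_iff (by simp)).mp h0).resolve_left (by simp) |>.ne
  rw [ae_restrict_iff' (measurableSet_radialSet hs)]
  refine measure_mono_null (fun x hx => ?_) h2
  simp only [Set.mem_compl_iff, Set.mem_ofPred_eq, Classical.not_imp] at hx
  exact ⟨ht1 hx.2, hx.1⟩

/-- Rotation-invariance of the measure on a radial set. -/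
theorem measurePreserving_rot_radialSet {s : Set ℝ} (hs : MeasurableSet s) (q : UnitQuaternion) :
    MeasurePreserving (rot q) (volume.restrict (radialSet s)) (volume.restrict (radialSet s)) := by
  have h := (rot q).measurePreserving.restrict_preimage (measurableSet_radialSet hs)
  have h2 : rot q ⁻¹' radialSet s = radialSet s := Set.ext fun x => by
    simp only [radialSet, Set.mem_preimage, Set.mem_ofPred_eq, LinearIsometryEquiv.norm_map]
  rwa [h2] at h

/-- The mean of a function over the sphere of radius `r`. -/
def sphereMean (u : Space3 → E) (r : ℝ) : E := rotAvg u (r • unitVec 0)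

theorem rotAvg_eq_sphereMean (u : Space3 → E) (x : Space3) : rotAvg u x = sphereMean u ‖x‖ :=
  rotAvg_eq_of_norm_eq u (by simp [norm_smul, unitVec])

theorem integrableOn_sphereMean {s : Set ℝ} (hs : MeasurableSet s) (hs0 : s ⊆ Set.Ioi 0)
    {u : Space3 → E} (hu : IntegrableOn u (radialSet s)) :
    IntegrableOn (fun r => r ^ 2 • sphereMean u r) s := by
  rw [← integrableOn_radialSet hs hs0]
  have := integrable_rotAvg (measurePreserving_rot_radialSet hs) hu
  simpa only [IntegrableOn, funext (rotAvg_eq_sphereMean u)] using this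

/-- Integration in polar coordinates against a radial weight. -/
theorem integral_radial_smul [CompleteSpace E] {s : Set ℝ} (hs : MeasurableSet s)
    (hs0 : s ⊆ Set.Ioi 0) {u : Space3 → E} {h : ℝ → ℝ}
    (hu : IntegrableOn (fun x => h ‖x‖ • u x) (radialSet s)) :
    ∫ x in radialSet s, h ‖x‖ • u x = sphereArea • ∫ r in s, r ^ 2 • h r • sphereMean u r := by
  rw [← integral_rotAvg (measurePreserving_rot_radialSet hs) hu, ← integral_radialSet hs hs0]
  simp only [rotAvg_radial_smul]
  simp only [rotAvg_eq_sphereMean]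

theorem integral_eq_integral_sphereMean [CompleteSpace E] {s : Set ℝ} (hs : MeasurableSet s)
    (hs0 : s ⊆ Set.Ioi 0) {u : Space3 → E} (hu : IntegrableOn u (radialSet s)) :
    ∫ x in radialSet s, u x = sphereArea • ∫ r in s, r ^ 2 • sphereMean u r := by
  simpa using integral_radial_smul hs hs0 (h := fun _ => 1) (by simpa using hu)

end

noncomputable section

open scoped Quaternion

/-! ### Radial test fields -/

/-- The support of `φ` stays away from radius zero, so the singular denominator does no harm near
the origin. -/
theorem contDiff_radial_div {a b : ℝ} (ha : 0 < a) {φ : ℝ → ℝ}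
    (h1 : ContDiff ℝ ((⊤ : ℕ∞) : WithTop ℕ∞) φ) (h3 : tsupport φ ⊆ Set.Ioo a b) :
    ContDiff ℝ ((⊤ : ℕ∞) : WithTop ℕ∞) fun x : Space3 => φ ‖x‖ / ‖x‖ ^ 3 := by
  refine contDiff_iff_contDiffAt.mpr fun x => ?_
  rcases eq_or_ne x 0 with rfl | hx
  · refine (contDiffAt_const (c := (0 : ℝ))).congr_of_eventuallyEq ?_
    filter_upwards [Metric.ball_mem_nhds (0 : Space3) ha] with y hy
    have hy' : ‖y‖ < a := by simpa using hy
    rw [image_eq_zero_of_notMem_tsupport fun h => absurd (h3 h).1 hy'.le.not_gt, zero_div]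
  · have hn : ContDiffAt ℝ ((⊤ : ℕ∞) : WithTop ℕ∞) (fun x : Space3 => ‖x‖) x := contDiffAt_norm ℝ hx
    exact (h1.contDiffAt.comp x hn).div (hn.pow 3) (pow_ne_zero 3 (norm_ne_zero_iff.mpr hx))

theorem tsupport_radial_div_subset {a b : ℝ} {φ : ℝ → ℝ} (h3 : tsupport φ ⊆ Set.Ioo a b) :
    tsupport (fun x : Space3 => φ ‖x‖ / ‖x‖ ^ 3) ⊆ radialSet (Set.Ioo a b) := by
  have h : tsupport (fun x : Space3 => φ ‖x‖ / ‖x‖ ^ 3) ⊆ (fun x : Space3 => ‖x‖) ⁻¹' tsupport φ := by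
    refine closure_minimal (fun x hx => subset_tsupport _ fun h0 => hx ?_)
      ((isClosed_tsupport φ).preimage continuous_norm)
    change φ ‖x‖ / ‖x‖ ^ 3 = 0
    rw [h0, zero_div]
  exact fun x hx => h3 (h hx)

theorem hasCompactSupport_radial_div {a b : ℝ} {φ : ℝ → ℝ} (h3 : tsupport φ ⊆ Set.Ioo a b) :
    HasCompactSupport (fun x : Space3 => φ ‖x‖ / ‖x‖ ^ 3) := by
  refine HasCompactSupport.of_support_subset_isCompact (isCompact_closedBall (0 : Space3) b) ?_
  intro x hx
  have := tsupport_radial_div_subset h3 (subset_tsupport _ hx)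
  simpa using this.2.le

/-- The field `φ(|x|) x / |x|³` has divergence `φ'(|x|) / |x|²`. -/
theorem div_radial_field {a b : ℝ} (ha : 0 < a) {φ : ℝ → ℝ}
    (h1 : ContDiff ℝ ((⊤ : ℕ∞) : WithTop ℕ∞) φ) (h3 : tsupport φ ⊆ Set.Ioo a b) {x : Space3}
    (hx : x ≠ 0) :
    ∑ l, fderiv ℝ (fun x : Space3 => φ ‖x‖ / ‖x‖ ^ 3 * x l) x (unitVec l) =
      deriv φ ‖x‖ / ‖x‖ ^ 2 := by
  have hr : ‖x‖ ≠ 0 := norm_ne_zero_iff.mpr hx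
  have hψ := contDiff_radial_div ha h1 h3
  have hd : DifferentiableAt ℝ (fun x : Space3 => φ ‖x‖ / ‖x‖ ^ 3) x :=
    hψ.differentiable (by simp) x
  have hproj : ∀ l, HasFDerivAt (fun x : Space3 => x l) (EuclideanSpace.proj (𝕜 := ℝ) l) x :=
    fun l => (EuclideanSpace.proj (𝕜 := ℝ) l).hasFDerivAt
  have hl : ∀ l, fderiv ℝ (fun x : Space3 => φ ‖x‖ / ‖x‖ ^ 3 * x l) x (unitVec l) =
      φ ‖x‖ / ‖x‖ ^ 3 +
        fderiv ℝ (fun x : Space3 => φ ‖x‖ / ‖x‖ ^ 3) x (x l • unitVec l) := fun l => by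
    have := (hd.hasFDerivAt.mul (hproj l)).fderiv
    change fderiv ℝ (fun x : Space3 => φ ‖x‖ / ‖x‖ ^ 3 * x l) x = _ at this
    rw [this]
    simp [unitVec]
  have hsum : ∑ l, x l • unitVec l = x := by
    ext i
    fin_cases i <;> simp [Fin.sum_univ_three, unitVec]
  simp only [hl]
  rw [Finset.sum_add_distrib, ← map_sum, hsum]
  -- The derivative of the radial factor in direction `x` is computed along the ray `t ↦ t x` at `t
  -- = 1`, by uniqueness of the derivative.
  have hline : HasDerivAt (fun t : ℝ => t • x) x 1 := by
    simpa using (hasDerivAt_id (1 : ℝ)).smul_const x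
  have e1 : HasDerivAt (fun t : ℝ => φ ‖t • x‖ / ‖t • x‖ ^ 3)
      (fderiv ℝ (fun x : Space3 => φ ‖x‖ / ‖x‖ ^ 3) x x) 1 := by
    have hd' : HasFDerivAt (fun x : Space3 => φ ‖x‖ / ‖x‖ ^ 3)
      (fderiv ℝ (fun x : Space3 => φ ‖x‖ / ‖x‖ ^ 3) x) ((1 : ℝ) • x) := by
      rw [one_smul]; exact hd.hasFDerivAt
    exact hd'.comp_hasDerivAt 1 hline
  have e2 : HasDerivAt (fun t : ℝ => φ (t * ‖x‖) / (t * ‖x‖) ^ 3)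
      ((deriv φ ‖x‖ * ‖x‖ * ‖x‖ ^ 3 - φ ‖x‖ * (3 * ‖x‖ ^ 2 * ‖x‖)) / (‖x‖ ^ 3) ^ 2) 1 := by
    have hm : HasDerivAt (fun t : ℝ => t * ‖x‖) ‖x‖ 1 := by
      simpa using (hasDerivAt_id (1 : ℝ)).mul_const ‖x‖
    have hφ : HasDerivAt φ (deriv φ ‖x‖) (1 * ‖x‖) := by
      rw [one_mul]; exact (h1.differentiable (by simp) _).hasDerivAt
    have := (hφ.comp (1 : ℝ) hm).div (hm.fun_pow 3) (by simpa using hr)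
    refine this.congr_deriv ?_
    simp
  have e3 : (fun t : ℝ => φ ‖t • x‖ / ‖t • x‖ ^ 3) =ᶠ[𝓝 1]
      fun t : ℝ => φ (t * ‖x‖) / (t * ‖x‖) ^ 3 := by
    filter_upwards [lt_mem_nhds one_pos] with t ht
    rw [norm_smul, Real.norm_of_nonneg ht.le]
  rw [e1.unique (e2.congr_of_eventuallyEq e3)]
  simp only [Finset.sum_const, Finset.card_univ, Fintype.card_fin, nsmul_eq_mul, Nat.cast_ofNat]
  field_simp
  ring

namespace NestedShells

variable {N : ℕ}

theorem shell_eq_radialSet (S : NestedShells N) (i : Fin N) :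
    S.shell i = radialSet (Set.Ioo (S.rIn i) (S.rOut i)) := rfl

theorem Ioo_subset_Ioi (S : NestedShells N) (i : Fin N) :
    Set.Ioo (S.rIn i) (S.rOut i) ⊆ Set.Ioi 0 := fun _ hr => (S.rIn_pos i).trans hr.1

/-- The radial component of the gradient, multiplied by `|x|`. -/
def radialGrad (S : NestedShells N) (p : S.Pairs) (x : Space3) : ℂ := ∑ l, x l • (p.snd x) l

theorem integrable_radialGrad (S : NestedShells N) (p : S.Pairs) :
    Integrable (S.radialGrad p) (volume.restrict S.domain) := by
  obtain ⟨b, hb0, hb⟩ := S.exists_radius_bound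
  refine (((Lp.memLp p.snd).integrable (by norm_num)).norm.const_mul (3 * b)).mono' ?_ ?_
  · refine Finset.aestronglyMeasurable_fun_sum _ fun l _ => ?_
    exact ((EuclideanSpace.proj (𝕜 := ℝ) l).continuous.aestronglyMeasurable).smul
      (memLp_coord (Lp.memLp p.snd) l).1
  · filter_upwards [ae_restrict_mem S.measurableSet_domain] with x hx
    refine (norm_sum_smul_le x (p.snd x)).trans ?_
    rw [mul_assoc]
    gcongr
    exact hb x hx

/-- The weak derivative of the spherical means. -/
def meanGrad (S : NestedShells N) (p : S.Pairs) (r : ℝ) : ℂ := r⁻¹ • sphereMean (S.radialGrad p) r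

theorem integrableOn_shell (S : NestedShells N) (i : Fin N) {u : Space3 → ℂ}
    (hu : Integrable u (volume.restrict S.domain)) : IntegrableOn u (S.shell i) :=
  hu.mono_measure (Measure.restrict_mono (S.shell_subset_domain i) le_rfl)

theorem integrableOn_smul_sphereMean (S : NestedShells N) (i : Fin N) {u : Space3 → ℂ}
    (hu : Integrable u (volume.restrict S.domain)) (k : ℕ) :
    IntegrableOn (fun r => (r ^ k)⁻¹ • sphereMean u r) (Set.Ioo (S.rIn i) (S.rOut i)) := by
  have h := integrableOn_sphereMean measurableSet_Ioo (S.Ioo_subset_Ioi i)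
    (S.integrableOn_shell i hu)
  have ha := S.rIn_pos i
  have h2 : IntegrableOn (fun r : ℝ => (r ^ (k + 2))⁻¹ • (r ^ 2 • sphereMean u r))
      (Set.Ioo (S.rIn i) (S.rOut i)) := by
    have hm : AEStronglyMeasurable (fun r : ℝ => (r ^ (k + 2))⁻¹)
        (volume.restrict (Set.Ioo (S.rIn i) (S.rOut i))) :=
      (measurable_id.pow_const (k + 2)).inv.aestronglyMeasurable
    refine h.bdd_smul (S.rIn i ^ (k + 2))⁻¹ hm ?_
    filter_upwards [ae_restrict_mem measurableSet_Ioo] with r hr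
    have hr0 : 0 < r := ha.trans hr.1
    rw [Real.norm_of_nonneg (by positivity)]
    exact inv_anti₀ (by positivity) (pow_le_pow_left₀ ha.le hr.1.le _)
  refine h2.congr_fun (fun r hr => ?_) measurableSet_Ioo
  have hr0 : r ≠ 0 := (ha.trans hr.1).ne'
  simp only [smul_smul]
  congr 1
  field_simp
  ring

theorem integrableOn_meanGrad (S : NestedShells N) (p : S.Pairs) (i : Fin N) :
    IntegrableOn (S.meanGrad p) (Set.Ioo (S.rIn i) (S.rOut i)) := by
  have h := S.integrableOn_smul_sphereMean i (S.integrable_radialGrad p) 1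
  simp only [pow_one] at h
  exact h

/-- The weak gradient is tested against `φ(|x|) x / |x|³`. Its divergence `φ'(|x|) / |x|²` cancels
the weight `r²` of polar coordinates, leaving `φ'` against the spherical mean. On the other side `r²
/ r³` leaves the factor `1 / r` of `meanGrad`. -/
theorem weakDeriv_sphereMean (S : NestedShells N) {p : S.Pairs} (hp : p ∈ S.H1) (i : Fin N)
    {φ : ℝ → ℝ} (h1 : ContDiff ℝ ((⊤ : ℕ∞) : WithTop ℕ∞) φ) (h2 : HasCompactSupport φ)
    (h3 : tsupport φ ⊆ Set.Ioo (S.rIn i) (S.rOut i)) :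
    ∫ r in Set.Ioo (S.rIn i) (S.rOut i), deriv φ r • sphereMean p.fst r =
      -∫ r in Set.Ioo (S.rIn i) (S.rOut i), φ r • S.meanGrad p r := by
  have ha := S.rIn_pos i
  have hψ := contDiff_radial_div ha h1 h3
  have hsupp : ∀ l, tsupport (fun x : Space3 => φ ‖x‖ / ‖x‖ ^ 3 * x l) ⊆ S.shell i := fun l =>
    (closure_mono (Function.support_mul_subset_left _ _)).trans (tsupport_radial_div_subset h3)
  have key := S.integral_div_smul_eq hp (Φ := fun l x => φ ‖x‖ / ‖x‖ ^ 3 * x l)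
    (fun l => hψ.mul (EuclideanSpace.proj (𝕜 := ℝ) l).contDiff)
    (fun l => (hasCompactSupport_radial_div h3).mul_right)
    (fun l => (hsupp l).trans (S.shell_subset_domain i))
  have hbdd : ∀ {ρ : ℝ → ℝ} {k : ℕ} {u : Space3 → ℂ}, Continuous ρ → HasCompactSupport ρ →
      Integrable u (volume.restrict S.domain) →
      IntegrableOn (fun x => (ρ ‖x‖ / ‖x‖ ^ k) • u x) (S.shell i) := by
    intro ρ k u hρ hc hu
    obtain ⟨C, hC⟩ := hc.exists_bound_of_continuous hρ
    have hC0 : 0 ≤ C := (norm_nonneg _).trans (hC 0)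
    have hm : AEStronglyMeasurable (fun x : Space3 => ρ ‖x‖ / ‖x‖ ^ k)
        (volume.restrict (S.shell i)) :=
      ((hρ.measurable.comp measurable_norm).div
        (measurable_norm.pow_const k)).aestronglyMeasurable
    refine (S.integrableOn_shell i hu).bdd_smul (C / S.rIn i ^ k) hm ?_
    filter_upwards [ae_restrict_mem (S.measurableSet_shell i)] with x hx
    rw [norm_div, norm_pow, norm_norm]
    exact div_le_div₀ hC0 (hC _) (by positivity) (pow_le_pow_left₀ ha.le hx.1.le _)
  have hleft : ∫ x in S.domain, (∑ l, fderiv ℝ (fun x : Space3 => φ ‖x‖ / ‖x‖ ^ 3 * x l) x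
      (unitVec l)) • p.fst x =
      sphereArea • ∫ r in Set.Ioo (S.rIn i) (S.rOut i), deriv φ r • sphereMean p.fst r := by
    have e : ∀ x ∈ S.domain, x ∉ S.shell i → (∑ l, fderiv ℝ (fun x : Space3 =>
        φ ‖x‖ / ‖x‖ ^ 3 * x l) x (unitVec l)) • p.fst x = 0 := fun x _ hx => by
      have : ∀ l, fderiv ℝ (fun x : Space3 => φ ‖x‖ / ‖x‖ ^ 3 * x l) x = 0 := fun l =>
        image_eq_zero_of_notMem_tsupport fun h => hx (hsupp l (tsupport_fderiv_subset ℝ h))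
      simp [this]
    rw [setIntegral_eq_of_subset_of_forall_sdiff_eq_zero S.measurableSet_domain
      (S.shell_subset_domain i) fun x hx => e x hx.1 hx.2]
    rw [setIntegral_congr_fun (g := fun x => (deriv φ ‖x‖ / ‖x‖ ^ 2) • p.fst x)
      (S.measurableSet_shell i) fun x hx => by
        simp only
        rw [div_radial_field ha h1 h3 (norm_pos_iff.mp (ha.trans hx.1))]]
    have hint := hbdd (k := 2) (h1.continuous_deriv (by simp)) h2.deriv (S.integrable_fst p)
    rw [shell_eq_radialSet] at hint ⊢
    rw [integral_radial_smul (h := fun r => deriv φ r / r ^ 2)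
      measurableSet_Ioo (S.Ioo_subset_Ioi i) hint]
    congr 1
    refine setIntegral_congr_fun measurableSet_Ioo fun r hr => ?_
    have hr0 : r ≠ 0 := (ha.trans hr.1).ne'
    simp only [smul_smul]
    congr 1
    field_simp
  have hright : ∫ x in S.domain, ∑ l, (φ ‖x‖ / ‖x‖ ^ 3 * x l) • (p.snd x) l =
      sphereArea • ∫ r in Set.Ioo (S.rIn i) (S.rOut i), φ r • S.meanGrad p r := by
    have e0 : ∀ x, ∑ l, (φ ‖x‖ / ‖x‖ ^ 3 * x l) • (p.snd x) l =
        (φ ‖x‖ / ‖x‖ ^ 3) • S.radialGrad p x := fun x => by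
      simp only [radialGrad, Finset.smul_sum, smul_smul]
    simp only [e0]
    rw [setIntegral_eq_of_subset_of_forall_sdiff_eq_zero S.measurableSet_domain
      (S.shell_subset_domain i) fun x hx => by
        rw [image_eq_zero_of_notMem_tsupport (f := φ) fun h => hx.2 (h3 h), zero_div, zero_smul]]
    have hint := hbdd (k := 3) h1.continuous h2 (S.integrable_radialGrad p)
    rw [shell_eq_radialSet] at hint ⊢
    rw [integral_radial_smul (h := fun r => φ r / r ^ 3)
      measurableSet_Ioo (S.Ioo_subset_Ioi i) hint]
    congr 1
    refine setIntegral_congr_fun measurableSet_Ioo fun r hr => ?_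
    have hr0 : r ≠ 0 := (ha.trans hr.1).ne'
    simp only [meanGrad, smul_smul]
    congr 1
    field_simp
  rw [hleft, hright, ← smul_neg] at key
  exact smul_right_injective _ sphereArea_pos.ne' key

/-- The spherical means of an `H¹` function are absolutely continuous on every shell. -/
theorem exists_sphereMean_eq (S : NestedShells N) {p : S.Pairs} (hp : p ∈ S.H1) (i : Fin N) :
    ∃ c : ℂ, ∀ᵐ r ∂volume.restrict (Set.Ioo (S.rIn i) (S.rOut i)),
      sphereMean p.fst r = c + ∫ t in S.rIn i..r, S.meanGrad p t :=
  ae_eq_primitive_of_weakDeriv (S.rIn_lt_rOut i)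
    (by simpa using S.integrableOn_smul_sphereMean i (S.integrable_fst p) 0)
    (S.integrableOn_meanGrad p i) fun _ h1 h2 h3 => S.weakDeriv_sphereMean hp i h1 h2 h3

end NestedShells

end

noncomputable section

open scoped Quaternion

/-! ### One-sided averages and existence of traces. -/

theorem tendsto_average_left {F : ℝ → ℂ} (hF : Continuous F) (b : ℝ) :
    Tendsto (fun ε : ℝ => (ε : ℂ)⁻¹ * ∫ r in (b - ε)..b, F r) (𝓝[>] 0) (𝓝 (F b)) := by
  have h1 : HasDerivAt (fun r => ∫ t in b..r, F t) (F b) (b - 0) := by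
    rw [sub_zero]; exact hF.integral_hasStrictDerivAt b b |>.hasDerivAt
  have h2 := (h1.comp_const_sub b 0).neg
  rw [neg_neg] at h2
  have h3 := (hasDerivAt_iff_tendsto_slope_zero.mp h2).mono_left
    (nhdsWithin_mono 0 fun x (hx : 0 < x) => hx.ne')
  refine h3.congr fun ε => ?_
  rw [intervalIntegral.integral_symm]
  simp

theorem tendsto_average_right {F : ℝ → ℂ} (hF : Continuous F) (a : ℝ) :
    Tendsto (fun ε : ℝ => (ε : ℂ)⁻¹ * ∫ r in a..(a + ε), F r) (𝓝[>] 0) (𝓝 (F a)) := by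
  have h1 : HasDerivAt (fun r => ∫ t in a..r, F t) (F a) a :=
    hF.integral_hasStrictDerivAt a a |>.hasDerivAt
  have h3 := (hasDerivAt_iff_tendsto_slope_zero.mp h1).mono_left
    (nhdsWithin_mono 0 fun x (hx : 0 < x) => hx.ne')
  refine h3.congr fun ε => ?_
  simp

namespace NestedShells

variable {N : ℕ}

/-- The spherical means of an `H¹` function on a shell extend to a continuous function. -/
theorem exists_continuous_sphereMean (S : NestedShells N) {p : S.Pairs} (hp : p ∈ S.H1)
    (i : Fin N) : ∃ F : ℝ → ℂ, Continuous F ∧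
      ∀ᵐ r ∂volume.restrict (Set.Ioo (S.rIn i) (S.rOut i)), sphereMean p.fst r = F r := by
  obtain ⟨c, hc⟩ := S.exists_sphereMean_eq hp i
  -- Cutting off outside the shell makes the primitive continuous on the whole line, including both
  -- ends of the shell.
  set G : ℝ → ℂ := (Set.Ioo (S.rIn i) (S.rOut i)).indicator (S.meanGrad p) with hG
  have hint : Integrable G :=
    (integrable_indicator_iff measurableSet_Ioo).mpr (S.integrableOn_meanGrad p i)
  refine ⟨fun r => c + ∫ t in S.rIn i..r, G t, continuous_const.add
    (intervalIntegral.continuous_primitive (fun _ _ => hint.intervalIntegrable) _), ?_⟩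
  filter_upwards [hc, ae_restrict_mem measurableSet_Ioo] with r hr hmem
  rw [hr]
  congr 1
  refine intervalIntegral.integral_congr_ae (ae_of_all _ fun t ht => ?_)
  rw [Set.uIoc_of_le hmem.1.le] at ht
  have ht' : t ∈ Set.Ioo (S.rIn i) (S.rOut i) := ⟨ht.1, ht.2.trans_lt hmem.2⟩
  rw [hG, Set.indicator_of_mem ht']

theorem integral_radialSet_Ioo_eq (S : NestedShells N) {p : S.Pairs}
    {i : Fin N} {F : ℝ → ℂ}
    (hF : ∀ᵐ r ∂volume.restrict (Set.Ioo (S.rIn i) (S.rOut i)), sphereMean p.fst r = F r)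
    {c d : ℝ} (hcd : c ≤ d) (hc : S.rIn i ≤ c) (hd : d ≤ S.rOut i) :
    ∫ x in radialSet (Set.Ioo c d), p.fst x = sphereArea • ∫ r in c..d, r ^ 2 • F r := by
  have hsub : Set.Ioo c d ⊆ Set.Ioo (S.rIn i) (S.rOut i) := Set.Ioo_subset_Ioo hc hd
  have hint : IntegrableOn p.fst (radialSet (Set.Ioo c d)) :=
    (S.integrableOn_shell i (S.integrable_fst p)).mono_set fun x hx => hsub hx
  rw [integral_eq_integral_sphereMean measurableSet_Ioo (hsub.trans (S.Ioo_subset_Ioi i)) hint,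
    intervalIntegral.integral_of_le hcd, integral_Ioc_eq_integral_Ioo]
  congr 1
  refine integral_congr_ae ?_
  filter_upwards [ae_mono (Measure.restrict_mono hsub le_rfl) hF] with r hr
  rw [hr]

/-- The means of an `H¹` function over thin collars converge. -/
theorem exists_tendsto_collar (S : NestedShells N) {p : S.Pairs} (hp : p ∈ S.H1) (i : Fin N)
    (s : Side) : ∃ c : ℂ, Tendsto (fun ε : ℝ => (ε : ℂ)⁻¹ * ∫ x in S.collar i ε s, p.fst x)
      (𝓝[>] 0) (𝓝 c) := by
  obtain ⟨F, hFc, hF⟩ := S.exists_continuous_sphereMean hp i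
  have hFc2 : Continuous fun r : ℝ => r ^ 2 • F r := (continuous_pow 2).smul hFc
  have hlt := S.rIn_lt_rOut i
  have hsmall : ∀ᶠ ε : ℝ in 𝓝[>] 0, 0 < ε ∧ ε < S.rOut i - S.rIn i :=
    Ioo_mem_nhdsGT (sub_pos.mpr hlt)
  cases s
  · refine ⟨_, ((tendsto_average_left hFc2 (S.rOut i)).const_smul sphereArea).congr' ?_⟩
    filter_upwards [hsmall] with ε hε
    have := S.integral_radialSet_Ioo_eq hF (c := S.rOut i - ε) (d := S.rOut i) (by linarith)
      (by linarith) le_rfl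
    change _ = (ε : ℂ)⁻¹ * ∫ x in radialSet (Set.Ioo (S.rOut i - ε) (S.rOut i)), p.fst x
    rw [this, mul_smul_comm]
  · refine ⟨_, ((tendsto_average_right hFc2 (S.rIn i)).const_smul sphereArea).congr' ?_⟩
    filter_upwards [hsmall] with ε hε
    have := S.integral_radialSet_Ioo_eq hF (c := S.rIn i) (d := S.rIn i + ε) (by linarith)
      le_rfl (by linarith)
    change _ = (ε : ℂ)⁻¹ * ∫ x in radialSet (Set.Ioo (S.rIn i) (S.rIn i + ε)), p.fst x
    rw [this, mul_smul_comm]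

/-! ### The Poincaré inequality -/

theorem integral_norm_radialGrad_le (S : NestedShells N) : ∃ C : ℝ, 0 ≤ C ∧ ∀ p : S.Pairs,
    ∫ x in S.domain, ‖S.radialGrad p x‖ ≤ C * ‖p.snd‖ := by
  obtain ⟨b, hb0, hb⟩ := S.exists_radius_bound
  have h1 : MemLp (fun _ : Space3 => (1 : ℝ)) 2 (volume.restrict S.domain) := memLp_const 1
  refine ⟨3 * b * (eLpNorm (fun _ : Space3 => (1 : ℝ)) 2 (volume.restrict S.domain)).toReal,
    by positivity, fun p => ?_⟩
  have hg := Lp.memLp p.snd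
  have hint := (hg.integrable (by norm_num)).norm.const_mul (3 * b)
  calc ∫ x in S.domain, ‖S.radialGrad p x‖
      ≤ ∫ x in S.domain, 3 * b * ‖p.snd x‖ := by
        refine integral_mono_ae (S.integrable_radialGrad p).norm hint ?_
        filter_upwards [ae_restrict_mem S.measurableSet_domain] with x hx
        refine (norm_sum_smul_le x (p.snd x)).trans ?_
        rw [mul_assoc]
        gcongr
        exact hb x hx
    _ = 3 * b * ∫ x in S.domain, ‖(1 : ℝ)‖ * ‖p.snd x‖ := by
        rw [integral_const_mul]
        simp
    _ ≤ _ := by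
        have := integral_norm_mul_norm_le h1 hg
        rw [mul_assoc (3 * b), Lp.norm_def]
        exact mul_le_mul_of_nonneg_left this (by positivity)

theorem integral_norm_meanGrad_le (S : NestedShells N) (i : Fin N) : ∃ C : ℝ, 0 ≤ C ∧
    ∀ p : S.Pairs, ∫ r in Set.Ioo (S.rIn i) (S.rOut i), ‖S.meanGrad p r‖ ≤ C * ‖p.snd‖ := by
  obtain ⟨C, hC0, hC⟩ := S.integral_norm_radialGrad_le
  have ha := S.rIn_pos i
  have hκ := sphereArea_pos
  refine ⟨(S.rIn i ^ 3)⁻¹ * (sphereArea⁻¹ * C), by positivity, fun p => ?_⟩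
  have hγ := S.integrable_radialGrad p
  have hγi := S.integrableOn_shell i hγ
  have hM := integrableOn_sphereMean measurableSet_Ioo (S.Ioo_subset_Ioi i) hγi
  have h1 : ∫ r in Set.Ioo (S.rIn i) (S.rOut i), r ^ 2 • ‖sphereMean (S.radialGrad p) r‖ ≤
      sphereArea⁻¹ * (C * ‖p.snd‖) := by
    have h2 := integral_radialSet measurableSet_Ioo (S.Ioo_subset_Ioi i)
      (fun r => ‖sphereMean (S.radialGrad p) r‖)
    rw [smul_eq_mul] at h2
    rw [← mul_le_mul_iff_right₀ hκ, ← h2, mul_inv_cancel_left₀ hκ.ne']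
    simp only [← rotAvg_eq_sphereMean]
    refine (integral_norm_rotAvg_le (measurePreserving_rot_radialSet measurableSet_Ioo)
      hγi).trans ((setIntegral_mono_set hγ.norm ?_ ?_).trans (hC p))
    · exact ae_of_all _ fun x => norm_nonneg _
    · exact (S.shell_subset_domain i).eventuallyLE
  rw [mul_assoc, mul_assoc]
  refine le_trans ?_ (mul_le_mul_of_nonneg_left h1 (by positivity))
  rw [← integral_const_mul]
  have hM' : IntegrableOn (fun r : ℝ => r ^ 2 • ‖sphereMean (S.radialGrad p) r‖)
      (Set.Ioo (S.rIn i) (S.rOut i)) := by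
    refine hM.norm.congr (ae_of_all _ fun r => ?_)
    simp
  refine setIntegral_mono_on (S.integrableOn_meanGrad p i).norm (hM'.const_mul _)
    measurableSet_Ioo fun r hr => ?_
  have hr0 : 0 < r := ha.trans hr.1
  rw [meanGrad, norm_smul, norm_inv, Real.norm_of_nonneg hr0.le, smul_eq_mul, ← mul_assoc]
  refine mul_le_mul_of_nonneg_right ?_ (norm_nonneg _)
  -- The factor `1 / r` is at most `r² / rIn³`, which restores the polar weight and lets the
  -- integral over the shell be used.
  rw [inv_mul_eq_div, inv_eq_one_div, div_le_div_iff₀ hr0 (by positivity), one_mul]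
  calc S.rIn i ^ 3 ≤ r ^ 3 := pow_le_pow_left₀ ha.le hr.1.le 3
    _ = r ^ 2 * r := by ring

/-- On one shell the average is a constant `c` plus a primitive of `meanGrad`, and the primitive is
bounded by the gradient. Averaging does not change the integral over the shell, so `c` is controlled
by that integral and the gradient. -/
theorem ae_norm_rotAvg_le_shell (S : NestedShells N) (i : Fin N) : ∃ C : ℝ, 0 ≤ C ∧ ∀ p ∈ S.H1,
    ∀ᵐ x ∂volume.restrict (S.shell i),
      ‖rotAvg p.fst x‖ ≤ C * (‖p.snd‖ + ‖∫ x in S.shell i, p.fst x‖) := by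
  obtain ⟨C, hC0, hC⟩ := S.integral_norm_meanGrad_le i
  have hlt := S.rIn_lt_rOut i
  set v := volume.real (S.shell i) with hv
  have hfin : volume (S.shell i) < ⊤ :=
    (measure_mono (S.shell_subset_domain i)).trans_lt S.volume_domain_lt_top
  have hne : (S.shell i).Nonempty := by
    refine ⟨((S.rIn i + S.rOut i) / 2) • unitVec 0, ?_⟩
    have hn : ‖((S.rIn i + S.rOut i) / 2) • unitVec 0‖ = (S.rIn i + S.rOut i) / 2 := by
      rw [norm_smul, Real.norm_of_nonneg (by linarith [S.rIn_pos i])]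
      simp [unitVec]
    constructor <;> rw [hn] <;> linarith
  have hv0 : 0 < v :=
    ENNReal.toReal_pos ((S.isOpen_shell i).measure_pos volume hne).ne' hfin.ne
  refine ⟨2 * C + v⁻¹, by positivity, fun p hp => ?_⟩
  obtain ⟨c, hc⟩ := S.exists_sphereMean_eq hp i
  have hP : ∀ r ∈ Set.Ioo (S.rIn i) (S.rOut i),
      ‖∫ t in S.rIn i..r, S.meanGrad p t‖ ≤ C * ‖p.snd‖ := fun r hr => by
    rw [intervalIntegral.integral_of_le hr.1.le]
    refine (norm_integral_le_integral_norm _).trans (le_trans ?_ (hC p))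
    refine setIntegral_mono_set (S.integrableOn_meanGrad p i).norm
      (ae_of_all _ fun x => norm_nonneg _) (LE.le.eventuallyLE ?_)
    exact fun t ht => ⟨ht.1, ht.2.trans_lt hr.2⟩
  have hnear : ∀ᵐ x ∂volume.restrict (S.shell i), ‖rotAvg p.fst x - c‖ ≤ C * ‖p.snd‖ := by
    have h : ∀ᵐ r ∂volume.restrict (Set.Ioo (S.rIn i) (S.rOut i)),
        ‖sphereMean p.fst r - c‖ ≤ C * ‖p.snd‖ := by
      filter_upwards [hc, ae_restrict_mem measurableSet_Ioo] with r hr hmem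
      rw [hr, add_sub_cancel_left]
      exact hP r hmem
    filter_upwards [ae_radialSet measurableSet_Ioo (S.Ioo_subset_Ioi i) h] with x hx
    rwa [rotAvg_eq_sphereMean]
  have hpi := S.integrableOn_shell i (S.integrable_fst p)
  have hmean : v * ‖c‖ ≤ ‖∫ x in S.shell i, p.fst x‖ + v * (C * ‖p.snd‖) := by
    have hri : IntegrableOn (rotAvg p.fst) (S.shell i) := integrable_rotAvg (measurePreserving_rot_radialSet measurableSet_Ioo) hpi
    have e1 : ∫ x in S.shell i, rotAvg p.fst x = ∫ x in S.shell i, p.fst x :=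
      integral_rotAvg (measurePreserving_rot_radialSet measurableSet_Ioo) hpi
    have hcst : IntegrableOn (fun _ : Space3 => c) (S.shell i) := integrableOn_const hfin.ne
    have e2 : ∫ x in S.shell i, (rotAvg p.fst x - c) = (∫ x in S.shell i, p.fst x) - v • c := by
      rw [integral_sub hri hcst, e1, setIntegral_const]
    have e3 : ‖∫ x in S.shell i, (rotAvg p.fst x - c)‖ ≤ C * ‖p.snd‖ * v :=
      norm_setIntegral_le_of_norm_le_const_ae hfin hnear
    rw [e2] at e3
    have e4 := norm_sub_norm_le (v • c) (∫ x in S.shell i, p.fst x)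
    rw [norm_sub_rev, norm_smul, Real.norm_of_nonneg hv0.le] at e4
    linarith
  have hcb : ‖c‖ ≤ v⁻¹ * ‖∫ x in S.shell i, p.fst x‖ + C * ‖p.snd‖ := by
    rw [← mul_le_mul_iff_right₀ hv0]
    refine hmean.trans_eq ?_
    field_simp
  filter_upwards [hnear] with x hx
  have h5 : ‖rotAvg p.fst x‖ ≤ C * ‖p.snd‖ + ‖c‖ := by
    have := norm_sub_norm_le (rotAvg p.fst x) c
    linarith
  have hvi : 0 < v⁻¹ := inv_pos.mpr hv0
  have h6 := mul_nonneg hvi.le (norm_nonneg p.snd)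
  have h7 := mul_nonneg hC0 (norm_nonneg (∫ x in S.shell i, p.fst x))
  linarith

theorem ae_norm_rotAvg_le (S : NestedShells N) : ∃ C : ℝ, 0 ≤ C ∧ ∀ p ∈ S.H1,
    ∀ᵐ x ∂volume.restrict S.domain,
      ‖rotAvg p.fst x‖ ≤ C * (‖p.snd‖ + ∑ i, ‖∫ x in S.shell i, p.fst x‖) := by
  choose C hC0 hC using S.ae_norm_rotAvg_le_shell
  refine ⟨∑ i, C i, Finset.sum_nonneg fun i _ => hC0 i, fun p hp => ?_⟩
  refine (ae_restrict_iUnion_iff S.shell _).mpr fun i => ?_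
  filter_upwards [hC i p hp] with x hx
  refine hx.trans (mul_le_mul ?_ ?_ (by positivity) (Finset.sum_nonneg fun i _ => hC0 i))
  · exact Finset.single_le_sum (fun i _ => hC0 i) (Finset.mem_univ i)
  · gcongr
    exact Finset.single_le_sum (f := fun i => ‖∫ x in S.shell i, p.fst x‖)
      (fun i _ => norm_nonneg _) (Finset.mem_univ i)

/-- The rotational average is bounded pointwise, hence in `L²` because `D` has finite measure. The
deviation from it is bounded by testing: a test function moved by a rotation changes its pairing
with `u` by at most a multiple of the gradient norm. -/
theorem norm_fst_le (S : NestedShells N) : ∃ C : ℝ, 0 ≤ C ∧ ∀ p ∈ S.H1,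
    ‖p.fst‖ ≤ C * (‖p.snd‖ + ∑ i, ‖∫ x in S.shell i, p.fst x‖) := by
  obtain ⟨C, hC0, hC⟩ := S.ae_norm_rotAvg_le
  obtain ⟨b, hb0, hb⟩ := S.exists_radius_bound
  set μ := volume.restrict S.domain with hμ
  set w := (eLpNorm (fun _ : Space3 => (1 : ℝ)) 2 μ).toReal with hw
  refine ⟨2 * (6 * b * Real.pi) + w * C, by positivity, fun p hp => ?_⟩
  set m := ∑ i, ‖∫ x in S.shell i, p.fst x‖ with hm
  have hm0 : 0 ≤ m := Finset.sum_nonneg fun i _ => norm_nonneg _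
  have hp1 := Lp.memLp p.fst
  have hrot := S.measurePreserving_rot
  have hrm : AEStronglyMeasurable (rotAvg p.fst) μ :=
    (integrable_rotAvg hrot (S.integrable_fst p)).1
  have hr : MemLp (rotAvg p.fst) 2 μ := MemLp.of_bound hrm _ (hC p hp)
  have h1 : (eLpNorm (fun x => rotAvg p.fst x - p.fst x) 2 μ).toReal ≤
      2 * (6 * b * Real.pi * ‖p.snd‖) := by
    refine eLpNorm_le_of_test S.isOpen_domain (hr.sub hp1) (by positivity) fun φ k1 k2 k3 => ?_
    refine (norm_integral_smul_sub_rotAvg_le hrot (S.integrable_fst p) k1.continuous k2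
      (S.norm_integral_comp_rot_sub_le hb0.le hb hp k1 k2 k3)).trans_eq ?_
    ring
  have h2 : (eLpNorm (rotAvg p.fst) 2 μ).toReal ≤ w * (C * (‖p.snd‖ + m)) := by
    have h3 : eLpNorm (rotAvg p.fst) 2 μ ≤
        eLpNorm (fun _ : Space3 => C * (‖p.snd‖ + m)) 2 μ :=
      eLpNorm_mono_ae_real (hC p hp)
    refine (ENNReal.toReal_mono (memLp_const _).2.ne h3).trans_eq ?_
    have h4 : (fun _ : Space3 => C * (‖p.snd‖ + m)) =
        (C * (‖p.snd‖ + m)) • (fun _ : Space3 => (1 : ℝ)) := by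
      funext x; simp
    rw [h4, eLpNorm_const_smul, ENNReal.toReal_mul, toReal_enorm,
      Real.norm_of_nonneg (by positivity), mul_comm]
  have hdiff : MemLp (fun x => rotAvg p.fst x - p.fst x) 2 μ := hr.sub hp1
  have h5 : ‖p.fst‖ ≤ (eLpNorm (rotAvg p.fst) 2 μ).toReal +
      (eLpNorm (fun x => rotAvg p.fst x - p.fst x) 2 μ).toReal := by
    rw [Lp.norm_def, ← ENNReal.toReal_add hr.2.ne hdiff.2.ne]
    refine ENNReal.toReal_mono (ENNReal.add_ne_top.mpr ⟨hr.2.ne, hdiff.2.ne⟩) ?_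
    have h6 : (p.fst : Space3 → ℂ) = rotAvg p.fst - fun x => rotAvg p.fst x - p.fst x := by
      funext x; simp
    conv_lhs => rw [h6]
    exact eLpNorm_sub_le hr.1 hdiff.1 (by norm_num)
  have h7 : 0 ≤ 2 * (6 * b * Real.pi) * m := by positivity
  calc ‖p.fst‖ ≤ _ := h5.trans (add_le_add h2 h1)
    _ ≤ _ := by linarith

/-- The Poincaré inequality on `D`. -/
theorem exists_poincare (S : NestedShells N) : ∃ C : ℝ, 0 ≤ C ∧ ∀ p ∈ S.H1,
    ‖p.fst‖ ^ 2 ≤ C * (‖p.snd‖ ^ 2 + ∑ i, ‖∫ x in S.shell i, p.fst x‖ ^ 2) := by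
  obtain ⟨C, hC0, hC⟩ := S.norm_fst_le
  -- From `(x + y)² ≤ 2 x² + 2 y²` and `(∑ m)² ≤ N ∑ m²`.
  refine ⟨C ^ 2 * (2 * (N + 1)), by positivity, fun p hp => ?_⟩
  set m : Fin N → ℝ := fun i => ‖∫ x in S.shell i, p.fst x‖ with hm
  have h1 : (∑ i, m i) ^ 2 ≤ N * ∑ i, m i ^ 2 := by
    simpa using sq_sum_le_card_mul_sum_sq (s := Finset.univ) (f := m)
  have h2 : (0 : ℝ) ≤ ∑ i, m i ^ 2 := Finset.sum_nonneg fun i _ => sq_nonneg _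
  have h3 : (‖p.snd‖ + ∑ i, m i) ^ 2 ≤ 2 * (N + 1) * (‖p.snd‖ ^ 2 + ∑ i, m i ^ 2) := by
    have h4 : (0 : ℝ) ≤ N * ‖p.snd‖ ^ 2 := by positivity
    linarith [sq_nonneg (‖p.snd‖ - ∑ i, m i)]
  calc ‖p.fst‖ ^ 2 ≤ (C * (‖p.snd‖ + ∑ i, m i)) ^ 2 :=
        pow_le_pow_left₀ (norm_nonneg _) (hC p hp) 2
    _ = C ^ 2 * (‖p.snd‖ + ∑ i, m i) ^ 2 := by ring
    _ ≤ C ^ 2 * (2 * (N + 1) * (‖p.snd‖ ^ 2 + ∑ i, m i ^ 2)) :=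
        mul_le_mul_of_nonneg_left h3 (sq_nonneg C)
    _ = _ := by ring

end NestedShells

end

noncomputable section

namespace NestedShells

variable {N : ℕ}

/-! ### The operator of the modified form -/

/-- Banach-Steinhaus: a pointwise limit of bounded functionals on a complete space is bounded. -/
theorem exists_clm_of_tendsto {E : Type*} [NormedAddCommGroup E] [NormedSpace ℂ E]
    [CompleteSpace E] {l : Filter ℝ} [l.IsCountablyGenerated] [l.NeBot] (g : ℝ → E →L[ℂ] ℂ)
    {f : E → ℂ} (h : ∀ x, Tendsto (fun n => g n x) l (𝓝 (f x))) :
    ∃ τ : E →L[ℂ] ℂ, ∀ x, τ x = f x :=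
  ⟨continuousLinearMapOfTendsto g (tendsto_pi_nhds.mpr h), fun _ => rfl⟩

/-- For small thickness each collar average is a bounded functional, and the averages converge for
every element of `V`. Their limit is then bounded without any quantitative trace estimate. -/
theorem exists_trace (S : NestedShells N) (V : Submodule ℂ S.Pairs) [CompleteSpace V]
    (hV : V ≤ S.H1) (i : Fin N) (s : Side) :
    ∃ τ : V →L[ℂ] ℂ, ∀ v : V,
      Tendsto (fun ε : ℝ => (ε : ℂ)⁻¹ * ∫ x in S.collar i ε s, (v : S.Pairs).fst x)
        (𝓝[>] 0) (𝓝 (τ v)) := by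
  choose c hc using fun v : V => S.exists_tendsto_collar (hV v.2) i s
  let g : ℝ → V →L[ℂ] ℂ := fun ε => (ε : ℂ)⁻¹ •
    (S.setIntegralCLM (S.collar i ε s) (S.isOpen_collar i ε s).measurableSet).comp V.subtypeL
  have hg : ∀ v, Tendsto (fun ε => g ε v) (𝓝[>] (0 : ℝ)) (𝓝 (c v)) := by
    intro v
    refine (hc v).congr' ?_
    have hpos : (0 : ℝ) < S.rOut i - S.rIn i := sub_pos.mpr (S.rIn_lt_rOut i)
    filter_upwards [nhdsWithin_le_nhds (Iio_mem_nhds hpos)] with ε hε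
    have := S.setIntegralCLM_apply (S.isOpen_collar i ε s).measurableSet
      ((S.collar_subset_shell i s hε).trans (S.shell_subset_domain i)) (v : S.Pairs)
    simp only [g, smul_apply, ContinuousLinearMap.comp_apply,
      Submodule.subtypeL_apply, this, smul_eq_mul]
  obtain ⟨τ, hτ⟩ := exists_clm_of_tendsto g hg
  exact ⟨τ, fun v => by rw [hτ v]; exact hc v⟩

theorem surfaceIntegral_eq (S : NestedShells N) {i : Fin N} {s : Side} {u : Space3 → ℂ} {c : ℂ}
    (h : Tendsto (fun ε : ℝ => (ε : ℂ)⁻¹ * ∫ x in S.collar i ε s, u x) (𝓝[>] 0) (𝓝 c)) :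
    S.surfaceIntegral i s u = c :=
  h.limUnder_eq

theorem surfaceIntegral_conj_eq (S : NestedShells N) {i : Fin N} {s : Side} {u : Space3 → ℂ}
    {c : ℂ}
    (h : Tendsto (fun ε : ℝ => (ε : ℂ)⁻¹ * ∫ x in S.collar i ε s, u x) (𝓝[>] 0) (𝓝 c)) :
    S.surfaceIntegral i s (fun x => conj (u x)) = conj c := by
  refine S.surfaceIntegral_eq ?_
  refine ((Complex.continuous_conj.tendsto c).comp h).congr fun ε => ?_
  simp [integral_conj]

theorem inner_fst_eq_integral (S : NestedShells N) (p q : S.Pairs) :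
    inner ℂ q.fst p.fst = ∫ x in S.domain, p.fst x * conj (q.fst x) := by
  rw [L2.inner_def]
  rfl

theorem inner_snd_eq_integral (S : NestedShells N) (p q : S.Pairs) :
    inner ℂ q.snd p.snd = ∫ x in S.domain, ∑ l, (p.snd x) l * conj ((q.snd x) l) := by
  rw [L2.inner_def]
  refine integral_congr_ae (ae_of_all _ fun x => ?_)
  simp only [PiLp.inner_apply]
  rfl

theorem volumeForm_eq_inner (S : NestedShells N) (c : ℂ) (p q : S.Pairs) :
    ∑ i, ∫ x in S.shell i,
      ((∑ l, (p.snd x) l * conj ((q.snd x) l)) - c * p.fst x * conj (q.fst x)) =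
      inner ℂ q.snd p.snd - c * inner ℂ q.fst p.fst := by
  have h2 : Integrable (fun x => ∑ l, (p.snd x) l * conj ((q.snd x) l))
      (volume.restrict S.domain) := by
    refine (L2.integrable_inner (𝕜 := ℂ) q.snd p.snd).congr (ae_of_all _ fun x => ?_)
    simp only [PiLp.inner_apply]
    rfl
  have h1 : Integrable (fun x => c * p.fst x * conj (q.fst x)) (volume.restrict S.domain) := by
    refine ((L2.integrable_inner (𝕜 := ℂ) q.fst p.fst).const_mul c).congr
      (ae_of_all _ fun x => ?_)
    exact (mul_assoc _ _ _).symm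
  have h3 := S.sum_integral_shell (h2.sub h1)
  simp only [Pi.sub_apply] at h3
  rw [h3, integral_sub h2 h1, S.inner_fst_eq_integral,
    S.inner_snd_eq_integral, ← integral_const_mul]
  simp only [mul_assoc]

theorem continuousAt_comp_div (c : ℝ) {α : ℂ → ℂ} (hα : ContinuousAt α 0) :
    ContinuousAt (fun z : ℂ × ℝ => α (z.1 / c)) 0 := by
  have h0 : ContinuousAt (fun z : ℂ × ℝ => z.1 / (c : ℂ)) 0 :=
    (continuous_fst.div_const _).continuousAt
  exact ContinuousAt.comp (g := α) (by simpa using hα) h0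

/-- The Hilbert space core of the perturbation argument. Here `P`, `Q` are the function and the
gradient, `m` the masses, `τ` the traces, `b` the value on a sphere and `b'` the value on its
partner across the host. At `z = 0` both perturbations carry a factor zero, and what remains is `Q*
Q + ∑ m_i* m_i`, coercive by `hcoer`. -/
theorem exists_perturbed_operator {ι H E F : Type*} [Fintype ι]
    [NormedAddCommGroup H] [InnerProductSpace ℂ H] [CompleteSpace H]
    [NormedAddCommGroup E] [InnerProductSpace ℂ E] [CompleteSpace E]
    [NormedAddCommGroup F] [InnerProductSpace ℂ F] [CompleteSpace F]
    (P : H →L[ℂ] E) (Q : H →L[ℂ] F) (m : ι → H →L[ℂ] ℂ) (τ b b' : ι → Side → H →L[ℂ] ℂ)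
    {α β : ι → Side → ℂ → ℂ} (hα : ∀ i s, ContinuousAt (α i s) 0)
    (hβ : ∀ i s, ContinuousAt (β i s) 0) (vel : ℝ) (c : ℂ)
    (hcoer : ∃ C : ℝ, 0 < C ∧ ∀ v, ‖v‖ ^ 2 ≤ C * (‖Q v‖ ^ 2 + ∑ i, ‖m i v‖ ^ 2)) :
    ∃ A : ℂ × ℝ → H →L[ℂ] H, ContinuousAt A 0 ∧ IsUnit (A 0) ∧ ∀ z u v,
      inner ℂ v (A z u) = inner ℂ (Q v) (Q u) + ∑ i, m i u * conj (m i v)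
        - z.1 ^ 2 / c * inner ℂ (P v) (P u)
        - z.2 * ∑ i, ((α i Side.outer (z.1 / vel) * b i Side.outer u
            + β i Side.outer (z.1 / vel) * b' i Side.outer u) * conj (τ i Side.outer v)
          - (α i Side.inner (z.1 / vel) * b i Side.inner u
            + β i Side.inner (z.1 / vel) * b' i Side.inner u) * conj (τ i Side.inner v)) := by
  -- The product of a functional of `u` with the conjugate of a functional of `v` is represented by
  -- an operator of rank at most one.
  let B : ι → Side → ℂ → H →L[ℂ] H := fun i s k =>
    (τ i s).adjoint.comp (α i s k • b i s + β i s k • b' i s)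
  have hB : ∀ i s, ContinuousAt (fun z : ℂ × ℝ => B i s (z.1 / vel)) 0 := fun i s =>
    continuousAt_const.clm_comp (((continuousAt_comp_div vel (hα i s)).smul
      continuousAt_const).add ((continuousAt_comp_div vel (hβ i s)).smul continuousAt_const))
  let A0 : H →L[ℂ] H := Q.adjoint.comp Q + ∑ i, (m i).adjoint.comp (m i)
  have hA0 : ∀ u v, inner ℂ v (A0 u) = inner ℂ (Q v) (Q u) + ∑ i, m i u * conj (m i v) := by
    intro u v
    simp only [A0, add_apply, sum_apply, inner_add_right, inner_sum,
      ContinuousLinearMap.comp_apply, ContinuousLinearMap.adjoint_inner_right]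
    rfl
  refine ⟨fun z => A0 - (z.1 ^ 2 / c) • P.adjoint.comp P
    - (z.2 : ℂ) • ∑ i, (B i Side.outer (z.1 / vel) - B i Side.inner (z.1 / vel)), ?_, ?_, ?_⟩
  · exact (continuousAt_const.sub
      (((continuous_fst.pow 2).div_const _).continuousAt.smul continuousAt_const)).sub
      ((Complex.continuous_ofReal.comp continuous_snd).continuousAt.smul
        (tendsto_finsetSum _ fun i _ => (hB i _).sub (hB i _)))
  · obtain ⟨C, hC, hP⟩ := hcoer
    have hpos : (0 : ℝ) < C⁻¹ := by positivity
    suffices h : IsUnit A0 by simpa using h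
    refine ContinuousLinearMap.isUnit_of_forall_le_norm_inner_map A0 (c := ⟨C⁻¹, hpos.le⟩)
      hpos fun v => ?_
    have h1 : inner ℂ v (A0 v) = ((‖Q v‖ ^ 2 + ∑ i, ‖m i v‖ ^ 2 : ℝ) : ℂ) := by
      rw [hA0, inner_self_eq_norm_sq_to_K]
      push_cast
      congr 1
      exact Finset.sum_congr rfl fun i _ => by rw [Complex.mul_conj']
    rw [norm_inner_symm, h1, Complex.norm_real, Real.norm_of_nonneg (by positivity)]
    show ‖v‖ ^ 2 * C⁻¹ ≤ _
    rw [← div_eq_mul_inv, div_le_iff₀ hC, mul_comm]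
    exact hP v
  · intro z u v
    have hBi : ∀ i s k, inner ℂ v (B i s k u) =
        (α i s k * b i s u + β i s k * b' i s u) * conj (τ i s v) := by
      intro i s k
      simp only [B, ContinuousLinearMap.comp_apply, ContinuousLinearMap.adjoint_inner_right]
      rfl
    simp only [sub_apply, smul_apply, inner_sub_right, inner_smul_right, hA0, sum_apply,
      inner_sum, hBi, ContinuousLinearMap.comp_apply, ContinuousLinearMap.adjoint_inner_right]

/-- The function component of an element of a subspace of pairs. -/
def fstCLM (S : NestedShells N) (V : Submodule ℂ S.Pairs) :
    V →L[ℂ] Lp ℂ 2 (volume.restrict S.domain) :=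
  (WithLp.fstL 2 ℂ _ _).comp V.subtypeL

/-- The gradient component of an element of a subspace of pairs. -/
def sndCLM (S : NestedShells N) (V : Submodule ℂ S.Pairs) :
    V →L[ℂ] Lp (EuclideanSpace ℂ (Fin 3)) 2 (volume.restrict S.domain) :=
  (WithLp.sndL 2 ℂ _ _).comp V.subtypeL

/-- The functional `u ↦ ∫_{D_i} u`. -/
def massCLM (S : NestedShells N) (V : Submodule ℂ S.Pairs) (i : Fin N) : V →L[ℂ] ℂ :=
  (S.setIntegralCLM (S.shell i) (S.measurableSet_shell i)).comp V.subtypeL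

theorem fstCLM_apply (S : NestedShells N) (V : Submodule ℂ S.Pairs) (v : V) :
    S.fstCLM V v = (v : S.Pairs).fst := rfl

theorem sndCLM_apply (S : NestedShells N) (V : Submodule ℂ S.Pairs) (v : V) :
    S.sndCLM V v = (v : S.Pairs).snd := rfl

theorem massCLM_apply (S : NestedShells N) (V : Submodule ℂ S.Pairs) (i : Fin N) (v : V) :
    S.massCLM V i v = ∫ x in S.shell i, (v : S.Pairs).fst x :=
  S.setIntegralCLM_apply _ (S.shell_subset_domain i) _

theorem exists_coercive (S : NestedShells N) (V : Submodule ℂ S.Pairs) (hV : V ≤ S.H1) :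
    ∃ C : ℝ, 0 < C ∧ ∀ v : V, ‖v‖ ^ 2 ≤
      C * (‖S.sndCLM V v‖ ^ 2 + ∑ i, ‖S.massCLM V i v‖ ^ 2) := by
  obtain ⟨C, hC, hP⟩ := S.exists_poincare
  -- The additional one absorbs the gradient part of the `H¹` norm.
  refine ⟨C + 1, by positivity, fun v => ?_⟩
  have h2 : ‖v‖ ^ 2 = ‖(v : S.Pairs).fst‖ ^ 2 + ‖(v : S.Pairs).snd‖ ^ 2 :=
    WithLp.prod_norm_sq_eq_of_L2 _
  have h3 := hP v (hV v.2)
  simp only [massCLM_apply, sndCLM_apply]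
  have h4 : 0 ≤ ∑ i, ‖∫ x in S.shell i, (v : S.Pairs).fst x‖ ^ 2 := by positivity
  rw [h2]
  linarith

theorem modifiedForm_eq (S : NestedShells N) (vel velR : ℝ) (ω : ℂ) (δ : ℝ) (p q : S.Pairs)
    {d t : Fin N → Side → ℂ}
    (hd : ∀ i s, S.dtn (ω / vel) (S.boundaryValue p.fst) i s = d i s)
    (ht : ∀ i s, S.surfaceIntegral i s (fun x => conj (q.fst x)) = conj (t i s)) :
    S.modifiedForm vel velR ω δ p q = inner ℂ q.snd p.snd
      + ∑ i, (∫ x in S.shell i, p.fst x) * conj (∫ x in S.shell i, q.fst x)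
      - ω ^ 2 / velR ^ 2 * inner ℂ q.fst p.fst
      - δ * ∑ i, (d i Side.outer * conj (t i Side.outer)
        - d i Side.inner * conj (t i Side.inner)) := by
  rw [modifiedForm, form, S.volumeForm_eq_inner]
  simp only [hd, ht, integral_conj]
  ring

set_option maxHeartbeats 1000000 in
-- The form is identified with the operator only for parameters near zero, since the linear
-- expression of the Dirichlet-to-Neumann map is available only for `k = ω / vel` near zero.
theorem exists_modifiedForm_operator (S : NestedShells N) (vel velR : ℝ)
    (V : Submodule ℂ S.Pairs) [CompleteSpace V] (hV : V ≤ S.H1) :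
    ∃ A : ℂ × ℝ → V →L[ℂ] V, ContinuousAt A 0 ∧ IsUnit (A 0) ∧
      ∀ᶠ z in 𝓝 (0 : ℂ × ℝ), ∀ u v : V,
        inner ℂ v (A z u) = S.modifiedForm vel velR z.1 z.2 u v := by
  choose τ hτ using S.exists_trace V hV
  choose J T α β hα hβ hdtn using S.exists_dtn_coefficients
  obtain ⟨b, hb⟩ : ∃ b : Fin N → Side → V →L[ℂ] ℂ, ∀ (u : V) i s,
      S.boundaryValue (u : S.Pairs).fst i s = b i s u := by
    refine ⟨fun i s => ((4 * Real.pi * S.radius i s ^ 2 : ℝ) : ℂ)⁻¹ • τ i s, fun u i s => ?_⟩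
    rw [boundaryValue, S.surfaceIntegral_eq (hτ i s u), smul_apply, smul_eq_mul, div_eq_inv_mul]
  obtain ⟨A, hA, hunit, hform⟩ := exists_perturbed_operator
    (S.fstCLM V) (S.sndCLM V) (S.massCLM V) τ b
    (fun i s => b (J i s) (T i s)) hα hβ vel (velR ^ 2) (S.exists_coercive V hV)
  refine ⟨A, hA, hunit, ?_⟩
  have hk : Tendsto (fun z : ℂ × ℝ => z.1 / (vel : ℂ)) (𝓝 0) (𝓝 0) := by
    have := ((continuous_fst (X := ℂ) (Y := ℝ)).div_const (vel : ℂ)).tendsto 0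
    simpa using this
  have hev : ∀ᶠ z in 𝓝 (0 : ℂ × ℝ), ∀ i, ∀ f : Fin N → Side → ℂ,
      (S.dtn (z.1 / vel) f i Side.outer = α i Side.outer (z.1 / vel) * f i Side.outer
        + β i Side.outer (z.1 / vel) * f (J i Side.outer) (T i Side.outer)) ∧
      (S.dtn (z.1 / vel) f i Side.inner = α i Side.inner (z.1 / vel) * f i Side.inner
        + β i Side.inner (z.1 / vel) * f (J i Side.inner) (T i Side.inner)) := by
    rw [eventually_all]
    intro i
    filter_upwards [hk.eventually (hdtn i Side.outer), hk.eventually (hdtn i Side.inner)]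
      with z h1 h2 f
    exact ⟨h1 f, h2 f⟩
  filter_upwards [hev] with z hz u v
  refine (hform z u v).trans ?_
  refine Eq.trans ?_ (S.modifiedForm_eq vel velR z.1 z.2 u v
    (d := fun i s => α i s (z.1 / vel) * b i s u + β i s (z.1 / vel) * b (J i s) (T i s) u)
    (t := fun i s => τ i s v) ?_ ?_).symm
  · simp only [massCLM_apply, fstCLM_apply, sndCLM_apply]
  · rintro i (_ | _)
    · rw [(hz i _).1, hb, hb]
    · rw [(hz i _).2, hb, hb]
  · exact fun i s => S.surfaceIntegral_conj_eq (hτ i s v)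

/-- A continuous family of operators that is invertible at a point is invertible nearby. -/
theorem eventually_bijective {X H : Type*} [TopologicalSpace X] [NormedAddCommGroup H]
    [NormedSpace ℂ H] [CompleteSpace H] {A : X → H →L[ℂ] H} {x : X} (hA : ContinuousAt A x)
    (hx : IsUnit (A x)) : ∀ᶠ z in 𝓝 x, Function.Bijective (A z) := by
  filter_upwards [hA.eventually_mem (Units.isOpen.mem_nhds hx)] with z hz
  exact ContinuousLinearMap.isUnit_iff_bijective.mp hz

/-! ### Reduction to a finite linear system -/

theorem exists_rieszRepr {H : Type*} [NormedAddCommGroup H] [InnerProductSpace ℂ H]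
    [CompleteSpace H] (f : H →L⋆[ℂ] ℂ) : ∃ y : H, ∀ v, inner ℂ v y = f v := by
  let g : H →L[ℂ] ℂ := (starL ℂ : ℂ ≃L⋆[ℂ] ℂ).toContinuousLinearMap.comp f
  refine ⟨(InnerProductSpace.toDual ℂ H).symm g, fun v => ?_⟩
  rw [← inner_conj_symm, InnerProductSpace.toDual_symm_apply]
  simp [g]

/-- Injectivity of `A` turns the equation into `w = uf + ∑ m_j(w) u_j`, so `w` is determined by the
vector `m(w)`. Such a vector is consistent exactly when it solves the linear system. The maps `w ↦
m(w)` and `x ↦ uf + ∑ x_j u_j` are thus inverse to each other on solutions, which transfers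
uniqueness both ways. -/
theorem reduction_to_linear_system {ι H : Type*} [Fintype ι] [DecidableEq ι]
    [NormedAddCommGroup H] [InnerProductSpace ℂ H] {A : H →L[ℂ] H} (hA : Function.Injective A)
    (m : ι → H →L[ℂ] ℂ) {e : ι → H} {y uf : H} {u : ι → H} (huf : A uf = y)
    (hu : ∀ j, A (u j) = e j) :
    ((∃! w, A w = y + ∑ i, m i w • e i) ↔
      ∃! x : ι → ℂ, (1 - Matrix.of fun i j => m i (u j)).mulVec x = fun i => m i uf) ∧
    ∀ w, A w = y + ∑ i, m i w • e i ↔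
      ∃ x : ι → ℂ, (1 - Matrix.of fun i j => m i (u j)).mulVec x = (fun i => m i uf) ∧
        w = uf + ∑ j, x j • u j := by
  have hvar : ∀ w, A w = y + ∑ i, m i w • e i ↔ w = uf + ∑ j, m j w • u j := by
    intro w
    rw [← huf]
    simp only [← hu, ← map_smul, ← map_sum, ← map_add]
    exact hA.eq_iff
  -- The system is the fixed point condition `m(uf + ∑ x_j u_j) = x`.
  have hsys : ∀ x : ι → ℂ, (1 - Matrix.of fun i j => m i (u j)).mulVec x = (fun i => m i uf) ↔
      ∀ i, m i (uf + ∑ j, x j • u j) = x i := by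
    intro x
    rw [funext_iff]
    refine forall_congr' fun i => ?_
    have h2 : (Matrix.of fun i j => m i (u j)).mulVec x i = ∑ j, x j * m i (u j) := by
      simp only [Matrix.mulVec, dotProduct, Matrix.of_apply, mul_comm]
    rw [Matrix.sub_mulVec, Matrix.one_mulVec, Pi.sub_apply, h2]
    simp only [map_add, map_sum, map_smul, smul_eq_mul]
    rw [sub_eq_iff_eq_add, eq_comm]
  have hfwd : ∀ w, A w = y + ∑ i, m i w • e i →
      (1 - Matrix.of fun i j => m i (u j)).mulVec (fun i => m i w) = fun i => m i uf := by
    intro w hw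
    rw [hsys]
    intro i
    rw [← (hvar w).mp hw]
  have hbwd : ∀ x : ι → ℂ, (1 - Matrix.of fun i j => m i (u j)).mulVec x = (fun i => m i uf) →
      A (uf + ∑ j, x j • u j) = y + ∑ i, m i (uf + ∑ j, x j • u j) • e i := by
    intro x hx
    rw [hvar]
    simp only [(hsys x).mp hx]
  refine ⟨⟨?_, ?_⟩, fun w => ⟨fun hw => ⟨fun i => m i w, hfwd w hw, (hvar w).mp hw⟩, ?_⟩⟩
  · rintro ⟨w, hw, huniq⟩
    refine ⟨fun i => m i w, hfwd w hw, fun x hx => ?_⟩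
    funext i
    rw [← huniq _ (hbwd x hx)]
    exact ((hsys x).mp hx i).symm
  · rintro ⟨x, hx, huniq⟩
    refine ⟨uf + ∑ j, x j • u j, hbwd x hx, fun w hw => ?_⟩
    rw [(hvar w).mp hw, ← huniq _ (hfwd w hw)]
  · rintro ⟨x, hx, rfl⟩
    exact hbwd x hx

/-- Translates forms into operators: `f` is represented by a vector `y` and the source `c i` by the
adjoint of `m i` applied to `1`. The masses occur twice, as bounded functionals `m` and as plain
integrals `m'`, so that the conclusion has the form of the definitions. -/
theorem variational_reduction {ι H : Type*} [Fintype ι] [DecidableEq ι]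
    [NormedAddCommGroup H] [InnerProductSpace ℂ H] [CompleteSpace H] {A : H →L[ℂ] H}
    (hA : Function.Bijective A) (m : ι → H →L[ℂ] ℂ) {a a' : H → H → ℂ} {c m' : ι → H → ℂ}
    (hm : ∀ i v, m i v = m' i v) (hc : ∀ i v, c i v = conj (m' i v))
    (ha' : ∀ u v, inner ℂ v (A u) = a' u v)
    (ha : ∀ u v, a' u v = a u v + ∑ i, m' i u * c i v) :
    (∀ f : H →L⋆[ℂ] ℂ, ∃! uf, ∀ v, a' uf v = f v) ∧ (∀ j, ∃! uj, ∀ v, a' uj v = c j v) ∧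
      ∀ (f : H →L⋆[ℂ] ℂ) (uf : H) (u : ι → H), (∀ v, a' uf v = f v) →
        (∀ j v, a' (u j) v = c j v) →
        ((∃! w, ∀ v, a w v = f v) ↔
          ∃! x : ι → ℂ, (1 - Matrix.of fun i j => m' i (u j)).mulVec x = fun i => m' i uf) ∧
        ∀ w, (∀ v, a w v = f v) ↔
          ∃ x : ι → ℂ, (1 - Matrix.of fun i j => m' i (u j)).mulVec x = (fun i => m' i uf) ∧
            w = uf + ∑ j, x j • u j := by
  have hsol : ∀ (g : H → ℂ) (y : H), (∀ v, inner ℂ v y = g v) → ∀ u,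
      (∀ v, a' u v = g v) ↔ A u = y := by
    intro g y hy u
    simp only [← hy, ← ha']
    exact ⟨ext_inner_left ℂ, fun h v => by rw [h]⟩
  have he : ∀ i v, inner ℂ v ((m i).adjoint 1) = c i v := by
    intro i v
    rw [ContinuousLinearMap.adjoint_inner_right, hc, ← hm]
    simp
  refine ⟨fun f => ?_, fun j => ?_, fun f uf u huf hu => ?_⟩
  · obtain ⟨y, hy⟩ := exists_rieszRepr f
    simpa only [hsol _ y hy] using hA.existsUnique y
  · simpa only [hsol _ _ (he j)] using hA.existsUnique _
  obtain ⟨y, hy⟩ := exists_rieszRepr f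
  have hvar : ∀ w, (∀ v, a w v = f v) ↔ A w = y + ∑ i, m i w • (m i).adjoint 1 := by
    intro w
    rw [← hsol (fun v => f v + ∑ i, m' i w * c i v) _ (fun v => by
      simp only [inner_add_right, inner_sum, inner_smul_right, hy, he, hm])]
    simp only [ha, add_left_inj]
  have hfin := reduction_to_linear_system hA.1 m ((hsol _ y hy uf).mp huf)
    (fun j => (hsol _ _ (he j) (u j)).mp (hu j))
  simp only [← hvar] at hfin
  simpa only [hm] using hfin

end NestedShells

/-! ### The main theorem. -/

open NestedShells

set_option maxHeartbeats 2000000 in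
theorem mainTheorem8 {N : ℕ} (S : NestedShells N) (vel velR : ℝ) (hvel : 0 < vel)
    (hvelR : 0 < velR) (V : Submodule ℂ S.Pairs) (hV : V = S.H1 ∨ V = S.H1rad) :
    ∃ ε : ℝ, 0 < ε ∧ ∀ (ω : ℂ) (δ : ℝ), ‖ω‖ < ε → |δ| < ε →
      (∀ f : V →L⋆[ℂ] ℂ, ∃! uf : V, S.SolvesModified vel velR ω δ f uf) ∧
      (∀ j : Fin N, ∃! uj : V, S.SolvesUnitSource vel velR ω δ j uj) ∧
      ∀ (f : V →L⋆[ℂ] ℂ) (uf : V) (u : Fin N → V),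
        S.SolvesModified vel velR ω δ f uf →
        (∀ j, S.SolvesUnitSource vel velR ω δ j (u j)) →
        ((∃! w : V, S.SolvesVariational vel velR ω δ f w) ↔
          ∃! x : Fin N → ℂ, (1 - S.massMatrix u).mulVec x = S.massVector uf) ∧
        ∀ w : V, S.SolvesVariational vel velR ω δ f w ↔
          ∃ x : Fin N → ℂ, (1 - S.massMatrix u).mulVec x = S.massVector uf ∧
            w = uf + ∑ j, x j • u j := by
  have hVH : V ≤ S.H1 := by
    rcases hV with rfl | rfl
    · exact le_rfl
    · exact fun p hp => hp.1
  have hclosed : IsClosed (V : Set S.Pairs) := by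
    rcases hV with rfl | rfl
    · exact S.isClosed_H1
    · exact S.isClosed_H1rad
  have : CompleteSpace V := hclosed.completeSpace_coe
  obtain ⟨A, hA, hunit, hform⟩ := S.exists_modifiedForm_operator vel velR V hVH
  have hev : ∀ᶠ z in 𝓝 (0 : ℂ × ℝ), Function.Bijective (A z) ∧ ∀ u v : V,
      inner ℂ v (A z u) = S.modifiedForm vel velR z.1 z.2 u v :=
    (eventually_bijective hA hunit).and hform
  -- The norm of `ℂ × ℝ` is the maximum norm, so a ball about `0` is exactly the pair of conditions
  -- on `ω` and `δ`.
  obtain ⟨ε, hε, hball⟩ := Metric.eventually_nhds_iff.mp hev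
  refine ⟨ε, hε, fun ω δ hω hδ => ?_⟩
  obtain ⟨hbij, hF⟩ := hball (y := (ω, δ)) (by
    rw [dist_zero_right, Prod.norm_def]
    exact max_lt hω hδ)
  have hred := variational_reduction hbij (S.massCLM V) (S.massCLM_apply V)
    (c := fun i v => ∫ x in S.shell i, conj ((v : S.Pairs).fst x))
    (a := fun u v => S.form vel velR ω δ u v)
    (fun i v => integral_conj) hF fun _ _ => rfl
  exact hred

end
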